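/- **Theorem.** Let $n\ge 1$ and $D=n+6$. Consider the plane-wave space-time with coordinates $(t,y,x_1,\dots,x_{D-2})$ and metric $$ds^2=-(1+A)\,dt^2+(1-A)\,dy^2-2A\,dt\,dy+\sum_{q=1}^{D-2}dx_q^2,\qquad A(x)=\sum_{q=1}^{D-2}A_q x_q^2,$$ with arbitrary constants $A_q\in\mathbb R$. *Setting.* Let $X:U\to\mathbb R^3$ be a smooth minimal immersion (vanishing mean curvature) of a connected open set $U\subseteq\mathbb R^2$. Its Type II embedding is $t=\tau$, $y=z$, $(x_1,x_2,x_3)=X(\sigma)$, $x_q=0$ for $q\ge 4$, with $(\tau,z)\in\mathbb R^2$, $\sigma\in U$. It is called stationary with respect to a vector field $\chi\not\equiv 0$ on $U$ if the embedding maps $\chi$ to the restriction of a Killing vector field of the space-time. For $\Omega\in\mathbb R$ put $\mathbf k^a\partial_a=\partial_\tau+\Omega\chi$, $\mathbf k=\sqrt{-\gamma_{ab}\mathbf k^a\mathbf k^b}$ and $u^a=\mathbf k^a/\mathbf k$ where $\mathbf k^2:=-\gamma_{ab}\mathbf k^a\mathbf k^b>0$; here $\gamma_{ab}$ is the induced metric,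 $K_{ab}{}^i$ the extrinsic curvature and $K^i=\gamma^{ab}K_{ab}{}^i$. The blackfold equations are $K^i=n\,u^au^bK_{ab}{}^i$ in all normal directions where $\mathbf k^2>0$, and $\mathbf k=0$ on the boundary of the worldvolume. *Surfaces.* For $a,c,\lambda>0$, $0<\tilde\lambda<1$, in coordinates $(\rho,\phi)\in\mathbb R^2$: - plane: $x_3=0$, with $\chi=a(x_1\partial_2-x_2\partial_1)$; - helicoid: $(\rho\cos a\phi,\ \rho\sin a\phi,\ \lambda\phi)$; - catenoid: $(c\cosh\tfrac\rho c\cos a\phi,\ c\cosh\tfrac\rho c\sin a\phi,\ \rho)$; - Scherk's second surface: $X^1=\tilde\lambda c\sinh\tfrac\rho c\sin a\phi+\sqrt{1-\tilde\lambda^2}\,c\cosh\tfrac\rho c\cos a\phi$, $\ X^2=-\tilde\lambda c\sinh\tfrac\rho c\cos a\phi+\sqrt{1-\tilde\lambda^2}\,c\cosh\tfrac\rho c\sin a\phi$, $\ X^3=\tilde\lambda ac\,\phi+\sqrt{1-\tilde\lambda^2}\,\rho$. For the last three $\chi=\partial_\phi$. *(i) Only these.* Suppose $X$ is stationary with respect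 to $\chi$, and on all of $\mathbb R^2\times U$ one has $\mathbf k^2>0$ and $K^i=n\,u^au^bK_{ab}{}^i$ (no boundary condition is needed). Write $\mathcal A=\mathrm{diag}(A_1,A_2,A_3)$. Then either $X(U)$ lies in a plane $\{\nu\cdot x=d\}$, $|\nu|=1$, with $\mathcal A\nu=\mu\nu$ and $\mu d=0$ for some $\mu\in\mathbb R$; or there are $a>0$, an orthogonal matrix $Q$ and $v\in\mathbb R^3$ with $\mathcal Av=0$ such that the motion $x\mapsto Qx+v$ carries a helicoid, a catenoid or a Scherk second surface as above (with this $a$, and some $c$, $\lambda$, $\tilde\lambda$) onto a surface containing $X(U)$, and carries the field $a(x_1\partial_2-x_2\partial_1)+b\,\partial_3$ to the image of $\chi$ on $X(U)$, with $b=\lambda$, $0$, $\tilde\lambda ac$ respectively. Moreover $\mathcal A=Q\,\mathrm{diag}(\kappa,\kappa,0)\,Q^{T}$, with some $\kappa\in\mathbb R$ for the helicoid, and with $\kappa=a^2\Omega^2$ for the catenoid and for Scherk's surface. *(ii) They do occur.* The four surfaces above are minimal immersions. Take as worldvolume the set where $\mathbf k^2>0$, require it to be nonempty, and let $\Omega\in\mathbb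 R$. Then the surface is stationary with respect to its field $\chi$ and solves the blackfold equations (including the boundary condition) if and only if: - plane: $A_1=A_2$ (and for $\Omega=0$ the plane solves the blackfold equations for all values of the $A_q$); - helicoid: $A_1=A_2$, $A_3=0$, and $\Omega^2\lambda^2<1$ or $A_1>a^2\Omega^2$; - catenoid: $A_1=A_2=a^2\Omega^2$ and $A_3=0$; - Scherk's second surface: $A_1=A_2=a^2\Omega^2$, $A_3=0$ and $a^2c^2\tilde\lambda^2\Omega^2<1$. In the last two cases $A_1>0$ whenever $\Omega\neq 0$. -/

import Mathlib

open scoped ContDiff Matrix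

noncomputable section

/-! ### Submanifolds of a coordinate space with a (pseudo-)Riemannian metric -/

/-- The partial derivative `∂_μ f` at `x`. -/
def pd {ι : Type*} [Fintype ι] [DecidableEq ι] (μ : ι) (f : (ι → ℝ) → ℝ) (x : ι → ℝ) : ℝ :=
  fderiv ℝ f x (Pi.single μ 1)

/-- The Christoffel symbol `Γ^ρ_{μν}` of the metric `g` at `x`. -/
def christoffel {ι : Type*} [Fintype ι] [DecidableEq ι] (g : (ι → ℝ) → Matrix ι ι ℝ)
    (ρ μ ν : ι) (x : ι → ℝ) : ℝ :=
  (1 / 2) * ∑ σ, (g x)⁻¹ ρ σ *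
    (pd μ (fun y => g y σ ν) x + pd ν (fun y => g y σ μ) x - pd σ (fun y => g y μ ν) x)

/-- `K` is a Killing vector field of `g`: the Lie derivative of `g` along `K` vanishes. -/
def IsKilling {ι : Type*} [Fintype ι] [DecidableEq ι] (g : (ι → ℝ) → Matrix ι ι ℝ)
    (K : (ι → ℝ) → (ι → ℝ)) : Prop :=
  ∀ x μ ν, ∑ ρ, (K x ρ * pd ρ (fun y => g y μ ν) x
    + g x ρ ν * pd μ (fun y => K y ρ) x + g x μ ρ * pd ν (fun y => K y ρ) x) = 0

/-- The induced metric `γ_{ab} = g_{μν} ∂_a W^μ ∂_b W^ν` of a parametrised submanifold `W`. -/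
def inducedMetric {ι κ : Type*} [Fintype ι] [DecidableEq ι] [Fintype κ] [DecidableEq κ]
    (g : (ι → ℝ) → Matrix ι ι ℝ) (W : (κ → ℝ) → (ι → ℝ)) (s : κ → ℝ) : Matrix κ κ ℝ :=
  fun a b => ∑ μ, ∑ ν, g (W s) μ ν * pd a (fun r => W r μ) s * pd b (fun r => W r ν) s

/-- The covector `n` is normal to the submanifold `W` at the parameter `s`. -/
def IsNormal {ι κ : Type*} [Fintype ι] [Fintype κ] [DecidableEq κ]
    (W : (κ → ℝ) → (ι → ℝ)) (s : κ → ℝ) (n : ι → ℝ) : Prop :=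
  ∀ a, ∑ μ, n μ * pd a (fun r => W r μ) s = 0

/-- The extrinsic curvature `K_{ab}` in the direction of the normal covector `n`. -/
def extrinsicCurvature {ι κ : Type*} [Fintype ι] [DecidableEq ι] [Fintype κ] [DecidableEq κ]
    (g : (ι → ℝ) → Matrix ι ι ℝ) (W : (κ → ℝ) → (ι → ℝ)) (s : κ → ℝ) (n : ι → ℝ) (a b : κ) : ℝ :=
  ∑ ρ, n ρ * (pd a (fun r => pd b (fun r' => W r' ρ) r) s
    + ∑ μ, ∑ ν, christoffel g ρ μ ν (W s) * pd a (fun r => W r μ) s * pd b (fun r => W r ν) s)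

/-- The mean extrinsic curvature `γ^{ab} K_{ab}` in the direction of the normal covector `n`. -/
def meanCurvature {ι κ : Type*} [Fintype ι] [DecidableEq ι] [Fintype κ] [DecidableEq κ]
    (g : (ι → ℝ) → Matrix ι ι ℝ) (W : (κ → ℝ) → (ι → ℝ)) (s : κ → ℝ) (n : ι → ℝ) : ℝ :=
  ∑ a, ∑ b, (inducedMetric g W s)⁻¹ a b * extrinsicCurvature g W s n a b

/-! ### The blackfold equations -/

/-- The square `-γ_{ab} k^a k^b` of the modulus of the worldvolume vector field `k`. -/
def modulusSq {ι κ : Type*} [Fintype ι] [DecidableEq ι] [Fintype κ] [DecidableEq κ]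
    (g : (ι → ℝ) → Matrix ι ι ℝ) (W : (κ → ℝ) → (ι → ℝ)) (k : (κ → ℝ) → (κ → ℝ))
    (s : κ → ℝ) : ℝ :=
  -∑ a, ∑ b, inducedMetric g W s a b * k s a * k s b

/-- On the set `S` the field `k` is timelike and, with the velocity `u = k / √(-γ(k, k))`, the
extrinsic equation `K^i = n u^a u^b K_{ab}^i` holds in all normal directions. -/
def SolvesExtrinsicEquation {ι κ : Type*} [Fintype ι] [DecidableEq ι] [Fintype κ] [DecidableEq κ]
    (n : ℕ) (g : (ι → ℝ) → Matrix ι ι ℝ) (W : (κ → ℝ) → (ι → ℝ)) (k : (κ → ℝ) → (κ → ℝ))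
    (S : Set (κ → ℝ)) : Prop :=
  ∀ s ∈ S, 0 < modulusSq g W k s ∧ ∀ ν, IsNormal W s ν →
    meanCurvature g W s ν =
      n * ∑ a, ∑ b, (k s a / √(modulusSq g W k s)) * (k s b / √(modulusSq g W k s))
        * extrinsicCurvature g W s ν a b

/-- The blackfold equations on the worldvolume `S`: the extrinsic equation on `S`, and the
vanishing of the modulus of `k` on the boundary of `S`. -/
def SolvesBlackfoldEquations {ι κ : Type*} [Fintype ι] [DecidableEq ι] [Fintype κ] [DecidableEq κ]
    (n : ℕ) (g : (ι → ℝ) → Matrix ι ι ℝ) (W : (κ → ℝ) → (ι → ℝ)) (k : (κ → ℝ) → (κ → ℝ))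
    (S : Set (κ → ℝ)) : Prop :=
  SolvesExtrinsicEquation n g W k S ∧ ∀ s ∈ frontier S, modulusSq g W k s = 0

/-! ### Minimal surfaces in `ℝ³` -/

/-- `X` is a smooth immersion of `U ⊆ ℝ²` into Euclidean `ℝ³` with vanishing mean curvature. -/
def IsMinimalSurface (U : Set (Fin 2 → ℝ)) (X : (Fin 2 → ℝ) → (Fin 3 → ℝ)) : Prop :=
  ContDiffOn ℝ ∞ X U ∧ (∀ σ ∈ U, Function.Injective (fderiv ℝ X σ)) ∧
    ∀ σ ∈ U, ∀ ν, IsNormal X σ ν → meanCurvature (fun _ => 1) X σ ν = 0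

/-- The plane `x₃ = 0`. -/
def planeSurface (σ : Fin 2 → ℝ) : Fin 3 → ℝ := ![σ 0, σ 1, 0]

/-- The helicoid, in the coordinates `(ρ, φ) = (σ 0, σ 1)`. -/
def helicoid (a lam : ℝ) (σ : Fin 2 → ℝ) : Fin 3 → ℝ :=
  ![σ 0 * Real.cos (a * σ 1), σ 0 * Real.sin (a * σ 1), lam * σ 1]

/-- The catenoid, in the coordinates `(ρ, φ) = (σ 0, σ 1)`. -/
def catenoid (a c : ℝ) (σ : Fin 2 → ℝ) : Fin 3 → ℝ :=
  ![c * Real.cosh (σ 0 / c) * Real.cos (a * σ 1), c * Real.cosh (σ 0 / c) * Real.sin (a * σ 1),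
    σ 0]

/-- Scherk's second surface with parameter `l`, in the coordinates `(ρ, φ) = (σ 0, σ 1)`. -/
def scherk (a c l : ℝ) (σ : Fin 2 → ℝ) : Fin 3 → ℝ :=
  ![l * (c * Real.sinh (σ 0 / c)) * Real.sin (a * σ 1)
      + √(1 - l ^ 2) * (c * Real.cosh (σ 0 / c)) * Real.cos (a * σ 1),
    -(l * (c * Real.sinh (σ 0 / c)) * Real.cos (a * σ 1))
      + √(1 - l ^ 2) * (c * Real.cosh (σ 0 / c)) * Real.sin (a * σ 1),
    l * a * c * σ 1 + √(1 - l ^ 2) * σ 0]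

/-- The worldvolume field `∂_φ` in the coordinates `(ρ, φ) = (σ 0, σ 1)`. -/
def coordField : (Fin 2 → ℝ) → (Fin 2 → ℝ) := fun _ => ![0, 1]

/-- The rotation field on the plane `x₃ = 0`, with angular rate `a`. -/
def rotField (a : ℝ) : (Fin 2 → ℝ) → (Fin 2 → ℝ) := fun σ => ![-(a * σ 1), a * σ 0]

/-- The vector field `a (x₁ ∂₂ - x₂ ∂₁) + b ∂₃` on `ℝ³`. -/
def screwField (a b : ℝ) (x : Fin 3 → ℝ) : Fin 3 → ℝ := ![-(a * x 1), a * x 0, b]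

/-- The surface `X` lies on the image of the surface `S` under the Euclidean motion
`x ↦ Q x + v`, and `χ` is mapped by `X` to the image of the field `screwField a b`. -/
def IsPieceOf (S : (Fin 2 → ℝ) → (Fin 3 → ℝ)) (a b : ℝ) (Q : Matrix (Fin 3) (Fin 3) ℝ)
    (v : Fin 3 → ℝ) (U : Set (Fin 2 → ℝ)) (X : (Fin 2 → ℝ) → (Fin 3 → ℝ))
    (χ : (Fin 2 → ℝ) → (Fin 2 → ℝ)) : Prop :=
  ∀ σ ∈ U, (∃ σ', X σ = Q *ᵥ S σ' + v) ∧
    fderiv ℝ X σ (χ σ) = Q *ᵥ screwField a b (Qᵀ *ᵥ (X σ - v))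

/-! ### Plane waves and wave-fronted embeddings -/

/-- The plane wave metric
`-(1 + A) dt² + (1 - A) dy² - 2 A dt dy + ∑ dx_q²` with `A = ∑ A_q x_q²`. The coordinates are
`t = x (inl 0)`, `y = x (inl 1)` and `x_q = x (inr q)`. -/
def planeWaveMetric {m : ℕ} (A : Fin m → ℝ) (x : Fin 2 ⊕ Fin m → ℝ) :
    Matrix (Fin 2 ⊕ Fin m) (Fin 2 ⊕ Fin m) ℝ :=
  Matrix.fromBlocks
    !![-(1 + ∑ q, A q * x (Sum.inr q) ^ 2), -∑ q, A q * x (Sum.inr q) ^ 2;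
       -∑ q, A q * x (Sum.inr q) ^ 2, 1 - ∑ q, A q * x (Sum.inr q) ^ 2] 0 0 1

/-- The embedding `t = τ`, `y = z`, `x_q = X_q` for the first three transverse coordinates, and
`x_q = 0` for the others. The worldvolume coordinates are `τ = s (inl 0)`, `z = s (inl 1)` and the
surface coordinates `s ∘ inr`. -/
def typeII (m : ℕ) (X : (Fin 2 → ℝ) → (Fin 3 → ℝ)) (s : Fin 2 ⊕ Fin 2 → ℝ) :
    Fin 2 ⊕ Fin m → ℝ :=
  Sum.elim (fun i => s (Sum.inl i))
    (fun q => if h : (q : ℕ) < 3 then X (fun j => s (Sum.inr j)) ⟨q, h⟩ else 0)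

/-- The worldvolume vector field `∂_τ + Ω χ`. -/
def velocityField (Ω : ℝ) (χ : (Fin 2 → ℝ) → (Fin 2 → ℝ)) (s : Fin 2 ⊕ Fin 2 → ℝ) :
    Fin 2 ⊕ Fin 2 → ℝ :=
  Sum.elim ![1, 0] (Ω • χ (fun j => s (Sum.inr j)))

/-- The part of the worldvolume over the set `U` of surface coordinates. -/
def cylinder (U : Set (Fin 2 → ℝ)) : Set (Fin 2 ⊕ Fin 2 → ℝ) :=
  {s | (fun j => s (Sum.inr j)) ∈ U}

/-- The vector field `χ` on the surface is not identically zero, and the embedding maps it to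
the restriction of a Killing vector field of the plane wave space-time (so `∂_τ + Ω χ` is also
mapped to the restriction of a Killing vector field, since `∂_t` is one). -/
def IsStationarySurface {m : ℕ} (A : Fin m → ℝ) (U : Set (Fin 2 → ℝ))
    (X : (Fin 2 → ℝ) → (Fin 3 → ℝ)) (χ : (Fin 2 → ℝ) → (Fin 2 → ℝ)) : Prop :=
  (∃ σ ∈ U, χ σ ≠ 0) ∧
  ∃ K : (Fin 2 ⊕ Fin m → ℝ) → (Fin 2 ⊕ Fin m → ℝ),
    ContDiff ℝ ∞ K ∧ IsKilling (planeWaveMetric A) K ∧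
    ∀ s ∈ cylinder U,
      fderiv ℝ (typeII m X) s (Sum.elim 0 (χ (fun j => s (Sum.inr j)))) = K (typeII m X s)

/-- The region of the worldvolume on which `∂_τ + Ω χ` is timelike. -/
def timelikeRegion {m : ℕ} (A : Fin m → ℝ) (X : (Fin 2 → ℝ) → (Fin 3 → ℝ)) (Ω : ℝ)
    (χ : (Fin 2 → ℝ) → (Fin 2 → ℝ)) : Set (Fin 2 ⊕ Fin 2 → ℝ) :=
  {s | 0 < modulusSq (planeWaveMetric A) (typeII m X) (velocityField Ω χ) s}

/-- The embedding of the surface `X`, with the field `∂_τ + Ω χ`, is stationary, and it solves the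
blackfold equations on the nonempty region where this field is timelike. -/
def IsStationaryBlackfold (n : ℕ) (A : Fin (n + 4) → ℝ) (X : (Fin 2 → ℝ) → (Fin 3 → ℝ))
    (Ω : ℝ) (χ : (Fin 2 → ℝ) → (Fin 2 → ℝ)) : Prop :=
  IsStationarySurface A Set.univ X χ ∧ (timelikeRegion A X Ω χ).Nonempty ∧
    SolvesBlackfoldEquations n (planeWaveMetric A) (typeII (n + 4) X) (velocityField Ω χ)
      (timelikeRegion A X Ω χ)

/-- The matrix `diag(A₁, A₂, A₃)`. -/
def profile3 {n : ℕ} (A : Fin (n + 4) → ℝ) : Matrix (Fin 3) (Fin 3) ℝ :=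
  Matrix.diagonal ![A 0, A 1, A 2]

end

/-! The wave directions almost decouple. The `t`, `y` block of the induced metric is `waveBlock F`
with `F` the profile on the surface, and the extrinsic curvature in that block has the same entry `ν
· 𝒜X` four times. The entries of the inverse block sum to zero, so these directions do not
contribute to the mean curvature, which is therefore the Euclidean one and vanishes. In the
contraction with `u` only the `tt` entry and the surface block survive. Hence the extrinsic equation
says that `𝒜X + Ω² D²X(χ, χ)` is tangent to the surface; neither `n ≥ 1` nor the positive factor
`1/𝐤²` matters (`extrinsicEquation_typeII_iff`).

Stationarity gives two facts (`IsStationarySurface.exists_affine`). The image of `χ` is a Euclidean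
Killing field `V = SX + b` with `S` antisymmetric, and the profile is constant along it, `𝒜X · V =
0`. The normal part of `D²X(χ, χ)` is that of `SV`, so the extrinsic equation becomes algebraic in
`X` and the unit normal `N`.

If `S = 0`, a minimal surface invariant under a translation has constant normal and is planar.
Otherwise a motion turns `V` into the screw field `a(x₁∂₂ - x₂∂₁) + b∂₃` with `a > 0`, `b ≥ 0`.
Invariance, symmetry of the second fundamental form and minimality express `dX` and `dN` in the
frame `V`, `N × V` (`exists_frame`). The flux `k = N₁X₁ + N₂X₂` (subscripts as in the statement of
the theorem) is then constant. With `ζ = artanh N₃` the differentials integrate explicitly, and `X`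
is recovered from `N`, `k` and `b`. The case `b = k = 0` is a plane, `b = 0 < k` a catenoid, `k = 0
< b` a helicoid, and `b, k > 0` a Scherk surface with `c² = k² + (b/a)²`.

The condition `𝒜X · V = 0` is a quadric vanishing on the surface. Differentiating it along `V`
separates the rotational harmonics and forces `𝒜` to be `diag(κ, κ, 0)` in the adapted frame; for `b
= 0` the entries along the axis need the extrinsic equation as well (`potential_eq_zero`). What is
left of the extrinsic equation is `(κ - a²Ω²) k = 0`, so `κ` is free exactly for the helicoid.

For the converse, the three curved surfaces are instances of `screwSurface`, and everything reduces
to functions of the profile curve. The boundary condition is automatic: the worldvolume is the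
positivity set of a continuous function. -/

/-! ### Coordinate computations -/

/-- The inclusion of the first three transverse directions. -/
def incl3 (n : ℕ) (i : Fin 3) : Fin (n + 4) := Fin.castLE (by omega) i

theorem sum_dite_lt_three {n : ℕ} (f : Fin (n + 4) → ℝ) (g : Fin 3 → ℝ) :
    ∑ q : Fin (n + 4), f q * (if h : (q : ℕ) < 3 then g ⟨q, h⟩ else 0)
      = ∑ i, f (incl3 n i) * g i := by
  rw [Fin.sum_univ_succ, Fin.sum_univ_succ, Fin.sum_univ_succ, Fin.sum_univ_three]
  rw [Finset.sum_eq_zero]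
  · rw [dif_pos (by simp), dif_pos (by simp), dif_pos (by rw [Fin.val_succ, Fin.val_succ]; simp),
      add_zero, ← add_assoc]
    rfl
  · intro q _
    rw [dif_neg (by simp), mul_zero]

theorem pd_eq_of_eventuallyEq {ι : Type*} [Fintype ι] [DecidableEq ι] {f g : (ι → ℝ) → ℝ}
    {x : ι → ℝ} (h : f =ᶠ[nhds x] g) (μ : ι) : pd μ f x = pd μ g x := by
  simp only [pd, h.fderiv_eq]

@[simp] theorem pd_const {ι : Type*} [Fintype ι] [DecidableEq ι] (μ : ι) (c : ℝ) (x : ι → ℝ) :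
    pd μ (fun _ => c) x = 0 := by simp [pd]

theorem pd_apply {ι : Type*} [Fintype ι] [DecidableEq ι] (μ ν : ι) (x : ι → ℝ) :
    pd μ (fun y => y ν) x = if μ = ν then 1 else 0 := by
  have : HasFDerivAt (fun y : ι → ℝ => y ν) (ContinuousLinearMap.proj (R := ℝ) ν) x :=
    (ContinuousLinearMap.proj (R := ℝ) (φ := fun _ : ι => ℝ) ν).hasFDerivAt
  simp [pd, this.fderiv, Pi.single_apply, eq_comm]

theorem fderiv_eq_sum_pd {ι : Type*} [Fintype ι] [DecidableEq ι] (f : (ι → ℝ) → ℝ)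
    (x y : ι → ℝ) : fderiv ℝ f x y = ∑ μ, y μ * pd μ f x := by
  conv_lhs => rw [← Finset.univ_sum_single y]
  simp only [map_sum, pd]
  refine Finset.sum_congr rfl fun μ _ => ?_
  rw [← mul_one (y μ), ← smul_eq_mul, ← smul_eq_mul, Pi.single_smul, map_smul]
  simp

theorem pd_component {ι κ : Type*} [Fintype ι] [Fintype κ] [DecidableEq ι]
    {X : (ι → ℝ) → (κ → ℝ)} {x : ι → ℝ} (h : DifferentiableAt ℝ X x) (μ : ι) (i : κ) :
    pd μ (fun r => X r i) x = fderiv ℝ X x (Pi.single μ 1) i := by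
  rw [pd, (hasFDerivAt_pi'.1 h.hasFDerivAt i).fderiv]
  rfl

/-- Restriction of worldvolume coordinates to the surface coordinates. -/
def surfaceCoord : (Fin 2 ⊕ Fin 2 → ℝ) →L[ℝ] (Fin 2 → ℝ) :=
  ContinuousLinearMap.pi fun j => ContinuousLinearMap.proj (Sum.inr j)

@[simp] theorem surfaceCoord_apply (s : Fin 2 ⊕ Fin 2 → ℝ) :
    surfaceCoord s = fun j => s (Sum.inr j) := rfl

theorem pd_inl_comp_surfaceCoord {f : (Fin 2 → ℝ) → ℝ} {s : Fin 2 ⊕ Fin 2 → ℝ}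
    (h : DifferentiableAt ℝ f (fun j => s (Sum.inr j))) (i : Fin 2) :
    pd (Sum.inl i) (fun r => f (fun j => r (Sum.inr j))) s = 0 := by
  have h1 := (HasFDerivAt.comp s (f := surfaceCoord) h.hasFDerivAt surfaceCoord.hasFDerivAt).fderiv
  have h2 : surfaceCoord (Pi.single (Sum.inl i) 1) = 0 := by ext j; simp
  simp only [Function.comp_def, surfaceCoord_apply] at h1
  rw [pd, h1, ContinuousLinearMap.comp_apply, h2, map_zero]

theorem pd_inr_comp_surfaceCoord {f : (Fin 2 → ℝ) → ℝ} {s : Fin 2 ⊕ Fin 2 → ℝ}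
    (h : DifferentiableAt ℝ f (fun j => s (Sum.inr j))) (a : Fin 2) :
    pd (Sum.inr a) (fun r => f (fun j => r (Sum.inr j))) s = pd a f (fun j => s (Sum.inr j)) := by
  have h1 := (HasFDerivAt.comp s (f := surfaceCoord) h.hasFDerivAt surfaceCoord.hasFDerivAt).fderiv
  have h2 : surfaceCoord (Pi.single (Sum.inr a) 1) = Pi.single a 1 := by
    ext j; simp [Pi.single_apply]
  simp only [Function.comp_def, surfaceCoord_apply] at h1
  rw [pd, h1, ContinuousLinearMap.comp_apply, h2, pd]

/-! ### The plane wave metric -/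

section PlaneWave

variable {m : ℕ} (A : Fin m → ℝ)

theorem planeWaveMetric_inl_inl (x : Fin 2 ⊕ Fin m → ℝ) (i j : Fin 2) :
    planeWaveMetric A x (Sum.inl i) (Sum.inl j)
      = !![-1, 0; 0, 1] i j - ∑ q, A q * x (Sum.inr q) ^ 2 := by
  fin_cases i <;> fin_cases j <;> (simp [planeWaveMetric]; try ring)

@[simp] theorem planeWaveMetric_inl_inr (x : Fin 2 ⊕ Fin m → ℝ) (i : Fin 2) (q : Fin m) :
    planeWaveMetric A x (Sum.inl i) (Sum.inr q) = 0 := by simp [planeWaveMetric]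

@[simp] theorem planeWaveMetric_inr_inl (x : Fin 2 ⊕ Fin m → ℝ) (i : Fin 2) (q : Fin m) :
    planeWaveMetric A x (Sum.inr q) (Sum.inl i) = 0 := by simp [planeWaveMetric]

@[simp] theorem planeWaveMetric_inr_inr (x : Fin 2 ⊕ Fin m → ℝ) (p q : Fin m) :
    planeWaveMetric A x (Sum.inr p) (Sum.inr q) = if p = q then 1 else 0 := by
  simp [planeWaveMetric, Matrix.one_apply]

theorem hasFDerivAt_profile (c : ℝ) (x : Fin 2 ⊕ Fin m → ℝ) :
    HasFDerivAt (fun y : Fin 2 ⊕ Fin m → ℝ => c - ∑ q, A q * y (Sum.inr q) ^ 2)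
      (-∑ q, (2 * A q * x (Sum.inr q)) •
        (ContinuousLinearMap.proj (R := ℝ) (φ := fun _ : Fin 2 ⊕ Fin m => ℝ) (Sum.inr q))) x := by
  refine (HasFDerivAt.fun_sum fun q _ => ?_).const_sub c
  have h := ((ContinuousLinearMap.proj (R := ℝ) (φ := fun _ : Fin 2 ⊕ Fin m => ℝ)
    (Sum.inr q)).hasFDerivAt (x := x)).pow 2
  refine (h.const_mul (A q)).congr_fderiv (ContinuousLinearMap.ext fun v => ?_)
  simp
  ring

theorem pd_inl_planeWaveMetric (x : Fin 2 ⊕ Fin m → ℝ) (i : Fin 2) (μ ν : Fin 2 ⊕ Fin m) :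
    pd (Sum.inl i) (fun y => planeWaveMetric A y μ ν) x = 0 := by
  rcases μ with a | p <;> rcases ν with b | q <;> simp only [planeWaveMetric_inl_inl,
    planeWaveMetric_inl_inr, planeWaveMetric_inr_inl, planeWaveMetric_inr_inr, pd_const]
  rw [pd, (hasFDerivAt_profile A _ x).fderiv]
  simp

theorem pd_inr_planeWaveMetric_inl (x : Fin 2 ⊕ Fin m → ℝ) (q : Fin m) (i j : Fin 2) :
    pd (Sum.inr q) (fun y => planeWaveMetric A y (Sum.inl i) (Sum.inl j)) x
      = -(2 * A q * x (Sum.inr q)) := by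
  simp only [planeWaveMetric_inl_inl]
  rw [pd, (hasFDerivAt_profile A _ x).fderiv]
  simp [Pi.single_apply]

theorem pd_planeWaveMetric_inr (x : Fin 2 ⊕ Fin m → ℝ) (μ ν : Fin 2 ⊕ Fin m) (q : Fin m) :
    pd μ (fun y => planeWaveMetric A y (Sum.inr q) ν) x = 0 := by
  rcases ν with b | p <;> simp

/-- The block of the plane wave metric in the directions `t`, `y`. -/
def waveBlock (F : ℝ) : Matrix (Fin 2) (Fin 2) ℝ := !![-(1 + F), -F; -F, 1 - F]

/-- The block has determinant `-1` for every `F`. The entries of the inverse sum to zero, which is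
what removes the wave directions from the mean curvature. -/
theorem waveBlock_inv (F : ℝ) : (waveBlock F)⁻¹ = !![-(1 - F), -F; -F, 1 + F] := by
  refine Matrix.inv_eq_right_inv ?_
  ext i j
  fin_cases i <;> fin_cases j <;> simp [waveBlock, Matrix.mul_apply, Fin.sum_univ_two] <;> ring

theorem isUnit_waveBlock (F : ℝ) : IsUnit (waveBlock F) := by
  rw [Matrix.isUnit_iff_isUnit_det, waveBlock, Matrix.det_fin_two_of]
  ring_nf
  simp

theorem planeWaveMetric_inv_inr (x : Fin 2 ⊕ Fin m → ℝ) (q : Fin m) (σ : Fin 2 ⊕ Fin m) :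
    (planeWaveMetric A x)⁻¹ (Sum.inr q) σ = if Sum.inr q = σ then 1 else 0 := by
  have h : (planeWaveMetric A x)⁻¹ = Matrix.fromBlocks
      (waveBlock (∑ q, A q * x (Sum.inr q) ^ 2))⁻¹ 0 0 1 := by
    refine Matrix.inv_eq_right_inv ?_
    rw [planeWaveMetric, ← waveBlock, Matrix.fromBlocks_multiply, Matrix.mul_nonsing_inv _
      ((Matrix.isUnit_iff_isUnit_det _).1 (isUnit_waveBlock _))]
    simp
  rw [h]
  rcases σ with i | p <;> simp [Matrix.one_apply]

/-- Normal covectors have no `t`, `y` components, so only transverse upper indices are needed. There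
the inverse metric is the identity and the metric components `g_{qν}` are constant, so one of the
three derivative terms survives. -/
theorem christoffel_planeWave (x : Fin 2 ⊕ Fin m → ℝ) (q : Fin m) (μ ν : Fin 2 ⊕ Fin m) :
    christoffel (planeWaveMetric A) (Sum.inr q) μ ν x
      = -(1 / 2) * pd (Sum.inr q) (fun y => planeWaveMetric A y μ ν) x := by
  simp only [christoffel, planeWaveMetric_inv_inr, ite_mul, one_mul, zero_mul, Finset.sum_ite_eq,
    Finset.mem_univ, if_true, pd_planeWaveMetric_inr]
  ring

end PlaneWave

/-! ### The wave-fronted embedding of a surface -/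

section TypeII

variable {n : ℕ} (A : Fin (n + 4) → ℝ) {X : (Fin 2 → ℝ) → (Fin 3 → ℝ)}
  {U : Set (Fin 2 → ℝ)} {s : Fin 2 ⊕ Fin 2 → ℝ}

theorem pd_typeII_inl (μ : Fin 2 ⊕ Fin 2) (j : Fin 2) (r : Fin 2 ⊕ Fin 2 → ℝ) :
    pd μ (fun r => typeII (n + 4) X r (Sum.inl j)) r = if μ = Sum.inl j then 1 else 0 :=
  pd_apply μ (Sum.inl j) r

theorem pd_inl_typeII_inr (hX : DifferentiableAt ℝ X (fun j => s (Sum.inr j))) (i : Fin 2)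
    (q : Fin (n + 4)) : pd (Sum.inl i) (fun r => typeII (n + 4) X r (Sum.inr q)) s = 0 := by
  by_cases h : (q : ℕ) < 3
  · simpa [typeII, h] using pd_inl_comp_surfaceCoord (f := fun σ => X σ ⟨q, h⟩)
      (differentiableAt_pi.1 hX ⟨q, h⟩) i
  · simp [typeII, h]

theorem pd_inr_typeII_inr (hX : DifferentiableAt ℝ X (fun j => s (Sum.inr j))) (a : Fin 2)
    (q : Fin (n + 4)) : pd (Sum.inr a) (fun r => typeII (n + 4) X r (Sum.inr q)) s
      = if h : (q : ℕ) < 3 then pd a (fun σ => X σ ⟨q, h⟩) (fun j => s (Sum.inr j)) else 0 := by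
  by_cases h : (q : ℕ) < 3
  · simpa [typeII, h] using pd_inr_comp_surfaceCoord (f := fun σ => X σ ⟨q, h⟩)
      (differentiableAt_pi.1 hX ⟨q, h⟩) a
  · simp [typeII, h]

theorem sum_typeII_inr (f : Fin (n + 4) → ℝ) :
    ∑ q, f q * typeII (n + 4) X s (Sum.inr q)
      = ∑ i, f (incl3 n i) * X (fun j => s (Sum.inr j)) i := by
  simp only [typeII, Sum.elim_inr, sum_dite_lt_three]

theorem sum_profile_typeII :
    ∑ q, A q * typeII (n + 4) X s (Sum.inr q) ^ 2
      = ∑ i, A (incl3 n i) * X (fun j => s (Sum.inr j)) i ^ 2 := by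
  rw [← sum_dite_lt_three A (fun i => X (fun j => s (Sum.inr j)) i ^ 2)]
  refine Finset.sum_congr rfl fun q _ => ?_
  by_cases h : (q : ℕ) < 3 <;> simp [typeII, h]

theorem inducedMetric_one_apply (σ : Fin 2 → ℝ) (a b : Fin 2) :
    inducedMetric (fun _ => 1) X σ a b
      = ∑ i, pd a (fun r => X r i) σ * pd b (fun r => X r i) σ := by
  simp [inducedMetric, Matrix.one_apply]

theorem inducedMetric_typeII (hX : DifferentiableAt ℝ X (fun j => s (Sum.inr j))) :
    inducedMetric (planeWaveMetric A) (typeII (n + 4) X) s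
      = Matrix.fromBlocks (waveBlock (∑ i, A (incl3 n i) * X (fun j => s (Sum.inr j)) i ^ 2)) 0 0
        (inducedMetric (fun _ => 1) X (fun j => s (Sum.inr j))) := by
  have hw : ∀ i j : Fin 2, planeWaveMetric A (typeII (n + 4) X s) (Sum.inl i) (Sum.inl j)
      = waveBlock (∑ i, A (incl3 n i) * X (fun j => s (Sum.inr j)) i ^ 2) i j := by
    intro i j
    rw [← sum_profile_typeII]
    rfl
  ext (a | a) (b | b)
  · simp [inducedMetric, Fintype.sum_sum_type, pd_typeII_inl, pd_inl_typeII_inr hX, hw]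
  · simp [inducedMetric, Fintype.sum_sum_type, pd_typeII_inl, pd_inl_typeII_inr hX]
  · simp [inducedMetric, Fintype.sum_sum_type, pd_typeII_inl, pd_inl_typeII_inr hX]
  · simp only [inducedMetric, Fintype.sum_sum_type, pd_typeII_inl, planeWaveMetric_inl_inr,
      planeWaveMetric_inr_inr, reduceCtorEq, if_false, mul_zero, zero_mul,
      Finset.sum_const_zero, zero_add, ite_mul, one_mul, Finset.sum_ite_eq, Finset.mem_univ,
      if_true, Matrix.fromBlocks_apply₂₂]
    simp only [pd_inr_typeII_inr hX, Matrix.one_apply, ite_mul, one_mul, zero_mul,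
      Finset.sum_ite_eq, Finset.mem_univ, if_true]
    have := sum_dite_lt_three (n := n) (fun _ => 1) (fun i =>
      pd a (fun σ => X σ i) (fun j => s (Sum.inr j))
        * pd b (fun σ => X σ i) (fun j => s (Sum.inr j)))
    simp only [one_mul] at this
    rw [← this]
    refine Finset.sum_congr rfl fun q _ => ?_
    by_cases h : (q : ℕ) < 3 <;> simp [h]

theorem modulusSq_typeII (hX : DifferentiableAt ℝ X (fun j => s (Sum.inr j))) (Ω : ℝ)
    (χ : (Fin 2 → ℝ) → (Fin 2 → ℝ)) :
    modulusSq (planeWaveMetric A) (typeII (n + 4) X) (velocityField Ω χ) s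
      = 1 + ∑ i, A (incl3 n i) * X (fun j => s (Sum.inr j)) i ^ 2
        - Ω ^ 2 * ∑ i, fderiv ℝ X (fun j => s (Sum.inr j)) (χ (fun j => s (Sum.inr j))) i ^ 2 := by
  have h1 : ∀ i, fderiv ℝ X (fun j => s (Sum.inr j)) (χ (fun j => s (Sum.inr j))) i
      = ∑ a, χ (fun j => s (Sum.inr j)) a * pd a (fun r => X r i) (fun j => s (Sum.inr j)) := by
    intro i
    rw [← fderiv_eq_sum_pd, (hasFDerivAt_pi'.1 hX.hasFDerivAt i).fderiv]
    rfl
  simp only [modulusSq, inducedMetric_typeII A hX, Fintype.sum_sum_type, h1]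
  simp [velocityField, waveBlock, inducedMetric_one_apply, Fin.sum_univ_two, Fin.sum_univ_three]
  ring

theorem isNormal_typeII_iff (hX : DifferentiableAt ℝ X (fun j => s (Sum.inr j)))
    (ν : Fin 2 ⊕ Fin (n + 4) → ℝ) :
    IsNormal (typeII (n + 4) X) s ν ↔ (∀ j, ν (Sum.inl j) = 0) ∧
      IsNormal X (fun j => s (Sum.inr j)) (fun i => ν (Sum.inr (incl3 n i))) := by
  have hr : ∀ a : Fin 2, ∑ q : Fin (n + 4), ν (Sum.inr q) *
      pd (Sum.inr a) (fun r => typeII (n + 4) X r (Sum.inr q)) s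
      = ∑ i, ν (Sum.inr (incl3 n i)) * pd a (fun σ => X σ i) (fun j => s (Sum.inr j)) := by
    intro a
    simp only [pd_inr_typeII_inr hX]
    exact sum_dite_lt_three (fun q => ν (Sum.inr q))
      (fun i => pd a (fun σ => X σ i) (fun j => s (Sum.inr j)))
  simp only [IsNormal, Sum.forall, Fintype.sum_sum_type, hr, pd_typeII_inl,
    pd_inl_typeII_inr hX]
  simp

theorem contDiffAt_of_contDiffOn (hU : IsOpen U) (hX : ContDiffOn ℝ ∞ X U) {σ : Fin 2 → ℝ}
    (hσ : σ ∈ U) : ContDiffAt ℝ ∞ X σ := hX.contDiffAt (hU.mem_nhds hσ)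

theorem differentiableAt_fderiv {σ : Fin 2 → ℝ} (hX : ContDiffAt ℝ ∞ X σ) :
    DifferentiableAt ℝ (fderiv ℝ X) σ :=
  (hX.fderiv_right (m := 1) (by norm_cast)).differentiableAt one_ne_zero

theorem eventually_differentiableAt {σ : Fin 2 → ℝ} (hX : ContDiffAt ℝ ∞ X σ) :
    ∀ᶠ r in nhds σ, DifferentiableAt ℝ X r := by
  have := (hX.of_le (m := 1) (by norm_cast)).eventually (by simp)
  exact this.mono fun r hr => hr.differentiableAt one_ne_zero

theorem pd_pd_component {σ : Fin 2 → ℝ} (hX : ContDiffAt ℝ ∞ X σ) (a b : Fin 2) (i : Fin 3) :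
    pd a (fun r => pd b (fun r' => X r' i) r) σ
      = fderiv ℝ (fderiv ℝ X) σ (Pi.single a 1) (Pi.single b 1) i := by
  have h : (fun r => pd b (fun r' => X r' i) r) =ᶠ[nhds σ]
      fun r => fderiv ℝ X r (Pi.single b 1) i :=
    (eventually_differentiableAt hX).mono fun r hr => pd_component hr b i
  rw [pd_eq_of_eventuallyEq h, pd_component (X := fun r => fderiv ℝ X r (Pi.single b 1))
    ((differentiableAt_fderiv hX).clm_apply (differentiableAt_const _))]
  rw [fderiv_clm_apply (differentiableAt_fderiv hX) (differentiableAt_const _)]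
  simp

theorem differentiableAt_pd {σ : Fin 2 → ℝ} (hX : ContDiffAt ℝ ∞ X σ) (b : Fin 2) (i : Fin 3) :
    DifferentiableAt ℝ (fun r => pd b (fun r' => X r' i) r) σ := by
  have h : (fun r => pd b (fun r' => X r' i) r) =ᶠ[nhds σ]
      fun r => fderiv ℝ X r (Pi.single b 1) i :=
    (eventually_differentiableAt hX).mono fun r hr => pd_component hr b i
  exact (differentiableAt_pi.1 ((differentiableAt_fderiv hX).clm_apply
    (differentiableAt_const _)) i).congr_of_eventuallyEq h

theorem eventually_surfaceCoord {p : (Fin 2 → ℝ) → Prop}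
    (h : ∀ᶠ σ in nhds (fun j => s (Sum.inr j)), p σ) :
    ∀ᶠ r : Fin 2 ⊕ Fin 2 → ℝ in nhds s, p (fun j => r (Sum.inr j)) :=
  (surfaceCoord.continuous.tendsto s).eventually h

theorem pd_pd_inl_typeII (hX : ContDiffAt ℝ ∞ X (fun j => s (Sum.inr j))) (a : Fin 2 ⊕ Fin 2)
    (i : Fin 2) (q : Fin (n + 4)) :
    pd a (fun r => pd (Sum.inl i) (fun r' => typeII (n + 4) X r' (Sum.inr q)) r) s = 0 := by
  rw [pd_eq_of_eventuallyEq (g := fun _ => 0)]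
  · simp
  · exact (eventually_surfaceCoord (eventually_differentiableAt hX)).mono
      fun _ hr => pd_inl_typeII_inr hr i q

theorem eventuallyEq_pd_inr_typeII (hX : ContDiffAt ℝ ∞ X (fun j => s (Sum.inr j))) (b : Fin 2)
    (q : Fin (n + 4)) :
    (fun r => pd (Sum.inr b) (fun r' => typeII (n + 4) X r' (Sum.inr q)) r) =ᶠ[nhds s]
      fun r => if h : (q : ℕ) < 3 then pd b (fun σ => X σ ⟨q, h⟩) (fun j => r (Sum.inr j)) else 0 :=
  (eventually_surfaceCoord (eventually_differentiableAt hX)).mono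
    fun _ hr => pd_inr_typeII_inr hr b q

theorem pd_inl_pd_inr_typeII (hX : ContDiffAt ℝ ∞ X (fun j => s (Sum.inr j))) (i : Fin 2)
    (b : Fin 2) (q : Fin (n + 4)) :
    pd (Sum.inl i) (fun r => pd (Sum.inr b) (fun r' => typeII (n + 4) X r' (Sum.inr q)) r) s
      = 0 := by
  rw [pd_eq_of_eventuallyEq (eventuallyEq_pd_inr_typeII hX b q)]
  by_cases h : (q : ℕ) < 3
  · simp only [h, dite_true]
    exact pd_inl_comp_surfaceCoord (differentiableAt_pd hX b ⟨q, h⟩) i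
  · simp [h]

theorem pd_inr_pd_inr_typeII (hX : ContDiffAt ℝ ∞ X (fun j => s (Sum.inr j))) (a : Fin 2)
    (b : Fin 2) (q : Fin (n + 4)) :
    pd (Sum.inr a) (fun r => pd (Sum.inr b) (fun r' => typeII (n + 4) X r' (Sum.inr q)) r) s
      = if h : (q : ℕ) < 3 then
          pd a (fun r => pd b (fun σ => X σ ⟨q, h⟩) r) (fun j => s (Sum.inr j)) else 0 := by
  rw [pd_eq_of_eventuallyEq (eventuallyEq_pd_inr_typeII hX b q)]
  by_cases h : (q : ℕ) < 3
  · simp only [h, dite_true]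
    exact pd_inr_comp_surfaceCoord (differentiableAt_pd hX b ⟨q, h⟩) a
  · simp [h]

/-! ### Extrinsic curvature of the embedding and the reduced extrinsic equation. -/

section Extrinsic

variable {ν : Fin 2 ⊕ Fin (n + 4) → ℝ} (hν : ∀ j, ν (Sum.inl j) = 0)
  (hX : ContDiffAt ℝ ∞ X (fun j => s (Sum.inr j)))
include hν hX

/-- The value does not depend on `i`, `j`: the profile enters all four entries of the wave block
with the coefficient `-1`, so `Γ^q_{ij} = A_q x_q` throughout. -/
theorem extrinsicCurvature_typeII_inl_inl (i j : Fin 2) :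
    extrinsicCurvature (planeWaveMetric A) (typeII (n + 4) X) s ν (Sum.inl i) (Sum.inl j)
      = ∑ k, ν (Sum.inr (incl3 n k)) * (A (incl3 n k) * X (fun j => s (Sum.inr j)) k) := by
  have hd := hX.differentiableAt (by simp)
  simp only [extrinsicCurvature, Fintype.sum_sum_type, hν, zero_mul, Finset.sum_const_zero,
    zero_add, pd_pd_inl_typeII hX, pd_typeII_inl, pd_inl_typeII_inr hd, mul_zero, add_zero]
  simp only [christoffel_planeWave, pd_inr_planeWaveMetric_inl]
  simp only [← mul_assoc]
  rw [← sum_typeII_inr (X := X) (s := s) (fun q => ν (Sum.inr q) * A q)]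
  refine Finset.sum_congr rfl fun q _ => ?_
  simp
  ring

theorem extrinsicCurvature_typeII_inl_inr (i b : Fin 2) :
    extrinsicCurvature (planeWaveMetric A) (typeII (n + 4) X) s ν (Sum.inl i) (Sum.inr b) = 0 := by
  have hd := hX.differentiableAt (by simp)
  simp [extrinsicCurvature, Fintype.sum_sum_type, hν, pd_inl_pd_inr_typeII hX, pd_typeII_inl,
    pd_inl_typeII_inr hd, christoffel_planeWave]

theorem extrinsicCurvature_typeII_inr_inl (a j : Fin 2) :
    extrinsicCurvature (planeWaveMetric A) (typeII (n + 4) X) s ν (Sum.inr a) (Sum.inl j) = 0 := by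
  have hd := hX.differentiableAt (by simp)
  simp [extrinsicCurvature, Fintype.sum_sum_type, hν, pd_pd_inl_typeII hX, pd_typeII_inl,
    pd_inl_typeII_inr hd, christoffel_planeWave]

theorem extrinsicCurvature_typeII_inr_inr (a b : Fin 2) :
    extrinsicCurvature (planeWaveMetric A) (typeII (n + 4) X) s ν (Sum.inr a) (Sum.inr b)
      = ∑ k, ν (Sum.inr (incl3 n k)) *
          pd a (fun r => pd b (fun σ => X σ k) r) (fun j => s (Sum.inr j)) := by
  have hd := hX.differentiableAt (by simp)
  simp only [extrinsicCurvature, Fintype.sum_sum_type, hν, zero_mul, Finset.sum_const_zero,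
    zero_add, pd_inr_pd_inr_typeII hX, pd_typeII_inl, christoffel_planeWave,
    planeWaveMetric_inr_inr, pd_const, reduceCtorEq, if_false, mul_zero, add_zero]
  exact sum_dite_lt_three (fun q => ν (Sum.inr q))
    (fun i => pd a (fun r => pd b (fun σ => X σ i) r) (fun j => s (Sum.inr j)))

end Extrinsic

theorem extrinsicCurvature_one (σ : Fin 2 → ℝ) (ν : Fin 3 → ℝ) (a b : Fin 2) :
    extrinsicCurvature (fun _ => 1) X σ ν a b
      = ∑ k, ν k * pd a (fun r => pd b (fun σ => X σ k) r) σ := by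
  simp [extrinsicCurvature, christoffel]

/-- The wave block contributes the sum of the entries of `waveBlock⁻¹`, which is zero, times the
common value of the extrinsic curvature there. -/
theorem meanCurvature_typeII {ν : Fin 2 ⊕ Fin (n + 4) → ℝ} (hν : ∀ j, ν (Sum.inl j) = 0)
    (hX : ContDiffAt ℝ ∞ X (fun j => s (Sum.inr j)))
    (hdet : IsUnit (inducedMetric (fun _ => 1) X (fun j => s (Sum.inr j)))) :
    meanCurvature (planeWaveMetric A) (typeII (n + 4) X) s ν
      = meanCurvature (fun _ => 1) X (fun j => s (Sum.inr j))
          (fun i => ν (Sum.inr (incl3 n i))) := by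
  have hinv : (inducedMetric (planeWaveMetric A) (typeII (n + 4) X) s)⁻¹ = Matrix.fromBlocks
      (waveBlock (∑ i, A (incl3 n i) * X (fun j => s (Sum.inr j)) i ^ 2))⁻¹ 0 0
        (inducedMetric (fun _ => 1) X (fun j => s (Sum.inr j)))⁻¹ := by
    rw [inducedMetric_typeII A (hX.differentiableAt (by simp))]
    refine Matrix.inv_eq_right_inv ?_
    rw [Matrix.fromBlocks_multiply, Matrix.mul_nonsing_inv _
      ((Matrix.isUnit_iff_isUnit_det _).1 (isUnit_waveBlock _)), Matrix.mul_nonsing_inv _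
      ((Matrix.isUnit_iff_isUnit_det _).1 hdet)]
    simp
  simp only [meanCurvature, hinv, Fintype.sum_sum_type, Matrix.fromBlocks_apply₁₁,
    Matrix.fromBlocks_apply₁₂, Matrix.fromBlocks_apply₂₁, Matrix.fromBlocks_apply₂₂,
    extrinsicCurvature_typeII_inl_inl A hν hX, extrinsicCurvature_typeII_inr_inr A hν hX,
    extrinsicCurvature_one, Matrix.zero_apply, zero_mul, Finset.sum_const_zero, add_zero, zero_add]
  rw [waveBlock_inv]
  simp [Fin.sum_univ_two]
  ring

/-- The extrinsic blackfold equation of the wave-fronted embedding at one point. -/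
theorem extrinsicEquation_typeII_iff (hn : 1 ≤ n)
    (hX : ContDiffAt ℝ ∞ X (fun j => s (Sum.inr j)))
    (hdet : IsUnit (inducedMetric (fun _ => 1) X (fun j => s (Sum.inr j))))
    (hmin : ∀ ν, IsNormal X (fun j => s (Sum.inr j)) ν →
      meanCurvature (fun _ => 1) X (fun j => s (Sum.inr j)) ν = 0)
    (Ω : ℝ) (χ : (Fin 2 → ℝ) → (Fin 2 → ℝ))
    (hpos : 0 < modulusSq (planeWaveMetric A) (typeII (n + 4) X) (velocityField Ω χ) s) :
    (∀ ν, IsNormal (typeII (n + 4) X) s ν →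
      meanCurvature (planeWaveMetric A) (typeII (n + 4) X) s ν =
        n * ∑ a, ∑ b,
          (velocityField Ω χ s a /
            √(modulusSq (planeWaveMetric A) (typeII (n + 4) X) (velocityField Ω χ) s)) *
          (velocityField Ω χ s b /
            √(modulusSq (planeWaveMetric A) (typeII (n + 4) X) (velocityField Ω χ) s))
          * extrinsicCurvature (planeWaveMetric A) (typeII (n + 4) X) s ν a b) ↔
    ∀ ν, IsNormal X (fun j => s (Sum.inr j)) ν →
      ∑ i, ν i * (A (incl3 n i) * X (fun j => s (Sum.inr j)) i
        + Ω ^ 2 * ∑ a, ∑ b, χ (fun j => s (Sum.inr j)) a * χ (fun j => s (Sum.inr j)) b *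
          pd a (fun r => pd b (fun σ => X σ i) r) (fun j => s (Sum.inr j))) = 0 := by
  have hd := hX.differentiableAt (by simp)
  have key : ∀ ν : Fin 2 ⊕ Fin (n + 4) → ℝ, IsNormal (typeII (n + 4) X) s ν →
      (meanCurvature (planeWaveMetric A) (typeII (n + 4) X) s ν =
        n * ∑ a, ∑ b,
          (velocityField Ω χ s a /
            √(modulusSq (planeWaveMetric A) (typeII (n + 4) X) (velocityField Ω χ) s)) *
          (velocityField Ω χ s b /
            √(modulusSq (planeWaveMetric A) (typeII (n + 4) X) (velocityField Ω χ) s))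
          * extrinsicCurvature (planeWaveMetric A) (typeII (n + 4) X) s ν a b ↔
      ∑ i, ν (Sum.inr (incl3 n i)) * (A (incl3 n i) * X (fun j => s (Sum.inr j)) i
        + Ω ^ 2 * ∑ a, ∑ b, χ (fun j => s (Sum.inr j)) a * χ (fun j => s (Sum.inr j)) b *
          pd a (fun r => pd b (fun σ => X σ i) r) (fun j => s (Sum.inr j))) = 0) := by
    intro ν hν
    obtain ⟨hν0, hν1⟩ := (isNormal_typeII_iff hd ν).1 hν
    set M := modulusSq (planeWaveMetric A) (typeII (n + 4) X) (velocityField Ω χ) s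
    have hM : √M * √M = M := Real.mul_self_sqrt hpos.le
    rw [meanCurvature_typeII A hν0 hX hdet, hmin _ hν1]
    -- The velocity has components `1` along `t` and `0` along `y`, and the mixed entries vanish, so
    -- only the `tt` entry and the surface block remain.
    have hsum : ∑ a, ∑ b, (velocityField Ω χ s a / √M) * (velocityField Ω χ s b / √M)
          * extrinsicCurvature (planeWaveMetric A) (typeII (n + 4) X) s ν a b
        = M⁻¹ * ∑ i, ν (Sum.inr (incl3 n i)) * (A (incl3 n i) * X (fun j => s (Sum.inr j)) i
        + Ω ^ 2 * ∑ a, ∑ b, χ (fun j => s (Sum.inr j)) a * χ (fun j => s (Sum.inr j)) b *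
          pd a (fun r => pd b (fun σ => X σ i) r) (fun j => s (Sum.inr j))) := by
      have h2 : ∀ x y : ℝ, x / √M * (y / √M) = M⁻¹ * (x * y) := by
        intro x y
        rw [div_mul_div_comm, hM]
        field_simp
      simp only [h2, Fintype.sum_sum_type, extrinsicCurvature_typeII_inl_inl A hν0 hX,
        extrinsicCurvature_typeII_inl_inr A hν0 hX, extrinsicCurvature_typeII_inr_inl A hν0 hX,
        extrinsicCurvature_typeII_inr_inr A hν0 hX]
      simp [velocityField, Fin.sum_univ_two, Fin.sum_univ_three]
      ring
    have hn' : (n : ℝ) ≠ 0 := by positivity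
    rw [hsum, eq_comm, mul_eq_zero, mul_eq_zero]
    simp [hn', hpos.ne']
  constructor
  · intro h ν hν
    -- A normal of the surface in `ℝ³`, extended by zero, is a normal of the embedding.
    have hN : IsNormal (typeII (n + 4) X) s (Sum.elim 0
        (fun q => if h : (q : ℕ) < 3 then ν ⟨q, h⟩ else 0)) := by
      rw [isNormal_typeII_iff hd]
      refine ⟨by simp, ?_⟩
      convert hν using 1
      ext i
      simp [incl3]
    have := (key _ hN).1 (h _ hN)
    simpa [incl3] using this
  · intro h ν hν
    exact (key ν hν).2 (h _ ((isNormal_typeII_iff hd ν).1 hν).2)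

end TypeII

/-! ### Minimal surfaces and their unit normals -/

theorem fderiv_dotProduct {E : Type*} [NormedAddCommGroup E] [NormedSpace ℝ E]
    {F G : E → (Fin 3 → ℝ)} {x : E} (hF : DifferentiableAt ℝ F x) (hG : DifferentiableAt ℝ G x)
    (y : E) : fderiv ℝ (fun r => F r ⬝ᵥ G r) x y
      = fderiv ℝ F x y ⬝ᵥ G x + F x ⬝ᵥ fderiv ℝ G x y := by
  have h : HasFDerivAt (fun r => ∑ i, F r i * G r i) _ x := HasFDerivAt.fun_sum fun i _ =>
    (hasFDerivAt_pi'.1 hF.hasFDerivAt i).mul (hasFDerivAt_pi'.1 hG.hasFDerivAt i)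
  simp only [dotProduct]
  rw [h.fderiv]
  simp [Fin.sum_univ_three]
  ring

theorem fderiv_eq_zero_of_eqOn {E F : Type*} [NormedAddCommGroup E] [NormedSpace ℝ E]
    [NormedAddCommGroup F] [NormedSpace ℝ F] {U : Set E} (hU : IsOpen U) {f : E → F} {c : F}
    (h : ∀ x ∈ U, f x = c) {x : E} (hx : x ∈ U) : fderiv ℝ f x = 0 := by
  have : f =ᶠ[nhds x] fun _ => c := Filter.eventually_of_mem (hU.mem_nhds hx) h
  rw [this.fderiv_eq]
  simp

theorem dotProduct_fderiv_of_eq_const {U : Set (Fin 2 → ℝ)} (hU : IsOpen U)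
    {F G : (Fin 2 → ℝ) → (Fin 3 → ℝ)} {c : ℝ} (h : ∀ x ∈ U, F x ⬝ᵥ G x = c) {x : Fin 2 → ℝ}
    (hx : x ∈ U) (hF : DifferentiableAt ℝ F x) (hG : DifferentiableAt ℝ G x) (y : Fin 2 → ℝ) :
    fderiv ℝ F x y ⬝ᵥ G x + F x ⬝ᵥ fderiv ℝ G x y = 0 := by
  rw [← fderiv_dotProduct hF hG, fderiv_eq_zero_of_eqOn hU h hx]
  simp

/-- A minimal surface `X` on an open set `U`, together with a unit normal `N`. -/
structure MinimalPatch (U : Set (Fin 2 → ℝ)) (X N : (Fin 2 → ℝ) → (Fin 3 → ℝ)) : Prop where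
  isOpen : IsOpen U
  differentiableAt : ∀ σ ∈ U, DifferentiableAt ℝ X σ
  differentiableAt_normal : ∀ σ ∈ U, DifferentiableAt ℝ N σ
  unit : ∀ σ ∈ U, N σ ⬝ᵥ N σ = 1
  normal : ∀ σ ∈ U, ∀ y, N σ ⬝ᵥ fderiv ℝ X σ y = 0
  exists_tangent : ∀ σ ∈ U, ∀ Z, N σ ⬝ᵥ Z = 0 → ∃ y, fderiv ℝ X σ y = Z
  symm : ∀ σ ∈ U, ∀ y z, fderiv ℝ N σ y ⬝ᵥ fderiv ℝ X σ z = fderiv ℝ N σ z ⬝ᵥ fderiv ℝ X σ y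
  -- The trace is required only on orthogonal pairs of equal length, so `V` and `N × V` can be
  -- inserted without normalisation.
  trace : ∀ σ ∈ U, ∀ y z, fderiv ℝ X σ y ⬝ᵥ fderiv ℝ X σ y = fderiv ℝ X σ z ⬝ᵥ fderiv ℝ X σ z →
    fderiv ℝ X σ y ⬝ᵥ fderiv ℝ X σ z = 0 →
    fderiv ℝ N σ y ⬝ᵥ fderiv ℝ X σ y + fderiv ℝ N σ z ⬝ᵥ fderiv ℝ X σ z = 0

/-! ### The first fundamental form and the trace of the second. -/

section Gram

variable {X : (Fin 2 → ℝ) → (Fin 3 → ℝ)} {σ : Fin 2 → ℝ}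

theorem dotProduct_fderiv (hX : DifferentiableAt ℝ X σ) (y z : Fin 2 → ℝ) :
    fderiv ℝ X σ y ⬝ᵥ fderiv ℝ X σ z = y ⬝ᵥ inducedMetric (fun _ => 1) X σ *ᵥ z := by
  have h1 : ∀ y i, fderiv ℝ X σ y i = ∑ a, y a * pd a (fun r => X r i) σ := by
    intro y i
    rw [← fderiv_eq_sum_pd, (hasFDerivAt_pi'.1 hX.hasFDerivAt i).fderiv]
    rfl
  simp [dotProduct, Matrix.mulVec, h1, inducedMetric_one_apply, Fin.sum_univ_two,
    Fin.sum_univ_three]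
  ring

theorem isUnit_inducedMetric (hX : DifferentiableAt ℝ X σ)
    (hinj : Function.Injective (fderiv ℝ X σ)) : IsUnit (inducedMetric (fun _ => 1) X σ) := by
  rw [Matrix.isUnit_iff_isUnit_det, isUnit_iff_ne_zero]
  intro h
  obtain ⟨v, hv, hv0⟩ := Matrix.exists_mulVec_eq_zero_iff.2 h
  refine hv (hinj ?_)
  rw [map_zero, ← dotProduct_self_eq_zero, dotProduct_fderiv hX, hv0, dotProduct_zero]

theorem isNormal_iff (hX : DifferentiableAt ℝ X σ) (ν : Fin 3 → ℝ) :
    IsNormal X σ ν ↔ ∀ y, ν ⬝ᵥ fderiv ℝ X σ y = 0 := by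
  have h : ∀ a, ∑ μ, ν μ * pd a (fun r => X r μ) σ
      = ν ⬝ᵥ fderiv ℝ X σ (Pi.single a 1) := fun a => by
    simp only [pd_component hX]
    rfl
  simp only [IsNormal, h]
  refine ⟨fun H y => ?_, fun H a => H _⟩
  conv_lhs => rw [← Finset.univ_sum_single y]
  rw [map_sum, dotProduct_sum]
  refine Finset.sum_eq_zero fun a _ => ?_
  have : (Pi.single a (y a) : Fin 2 → ℝ) = y a • Pi.single a 1 := by
    rw [← Pi.single_smul, smul_eq_mul, mul_one]
  rw [this, map_smul, dotProduct_smul, H, smul_zero]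

theorem meanCurvature_one_eq (hX : ContDiffAt ℝ ∞ X σ) (ν : Fin 3 → ℝ) :
    meanCurvature (fun _ => 1) X σ ν = ∑ a, ∑ b, (inducedMetric (fun _ => 1) X σ)⁻¹ a b *
      (ν ⬝ᵥ fderiv ℝ (fderiv ℝ X) σ (Pi.single a 1) (Pi.single b 1)) := by
  simp only [meanCurvature, extrinsicCurvature_one, pd_pd_component hX, dotProduct]

theorem fderiv_fderiv_apply (D : (Fin 2 → ℝ) →L[ℝ] (Fin 2 → ℝ) →L[ℝ] (Fin 3 → ℝ))
    (y z : Fin 2 → ℝ) :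
    D y z = ∑ a, ∑ b, (y a * z b) • D (Pi.single a 1) (Pi.single b 1) := by
  have h : ∀ y : Fin 2 → ℝ, y = ∑ a, y a • (Pi.single a 1 : Fin 2 → ℝ) := by
    intro y
    conv_lhs => rw [← Finset.univ_sum_single y]
    refine Finset.sum_congr rfl fun a _ => ?_
    rw [← Pi.single_smul, smul_eq_mul, mul_one]
  conv_lhs => rw [h y, h z]
  simp only [map_sum, map_smul, _root_.sum_apply, _root_.smul_apply, Finset.smul_sum, smul_smul]
  rw [Finset.sum_comm]
  simp only [mul_comm]

/-- The mean curvature is the trace of the second fundamental form in an orthogonal frame whose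
vectors have equal length. -/
theorem trace_eq_zero_of_meanCurvature_eq_zero (hX : ContDiffAt ℝ ∞ X σ)
    (hinj : Function.Injective (fderiv ℝ X σ)) {ν : Fin 3 → ℝ}
    (h : meanCurvature (fun _ => 1) X σ ν = 0) {y z : Fin 2 → ℝ}
    (h1 : fderiv ℝ X σ y ⬝ᵥ fderiv ℝ X σ y = fderiv ℝ X σ z ⬝ᵥ fderiv ℝ X σ z)
    (h2 : fderiv ℝ X σ y ⬝ᵥ fderiv ℝ X σ z = 0) :
    ν ⬝ᵥ fderiv ℝ (fderiv ℝ X) σ y y + ν ⬝ᵥ fderiv ℝ (fderiv ℝ X) σ z z = 0 := by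
  have hd := hX.differentiableAt (by simp)
  set H := inducedMetric (fun _ => 1) X σ with hH
  set t := fderiv ℝ X σ y ⬝ᵥ fderiv ℝ X σ y with ht
  -- For `t = 0` both vectors vanish, since the differential is injective.
  by_cases h0 : t = 0
  · have hy : y = 0 := hinj (by rw [map_zero, ← dotProduct_self_eq_zero, ← ht, h0])
    have hz : z = 0 := hinj (by rw [map_zero, ← dotProduct_self_eq_zero, ← h1, h0])
    simp [hy, hz]
  have hz1 := dotProduct_fderiv hd z z
  have hy1 := dotProduct_fderiv hd y y
  have hyz := dotProduct_fderiv hd y z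
  have hzy := dotProduct_fderiv hd z y
  rw [dotProduct_comm, h2] at hzy
  rw [h2] at hyz
  rw [← h1] at hz1
  rw [← ht] at hy1
  -- With `y`, `z` as the rows of `M`, the hypotheses say `M H Mᵀ = t`. Hence `H⁻¹ = t⁻¹ Mᵀ M`, and
  -- the trace becomes a multiple of the sum over `y` and `z`.
  set M : Matrix (Fin 2) (Fin 2) ℝ := Matrix.of ![y, z] with hM
  have hMM : (t⁻¹ • (M * H)) * Mᵀ = 1 := by
    ext i j
    rw [Matrix.smul_mul, Matrix.smul_apply, Matrix.mul_assoc]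
    have : (M * (H * Mᵀ)) i j = M i ⬝ᵥ H *ᵥ (M j) := rfl
    rw [this]
    fin_cases i <;> fin_cases j
    · change t⁻¹ * (y ⬝ᵥ H *ᵥ y) = 1
      rw [← hy1, inv_mul_cancel₀ h0]
    · change t⁻¹ * (y ⬝ᵥ H *ᵥ z) = 0
      rw [← hyz, mul_zero]
    · change t⁻¹ * (z ⬝ᵥ H *ᵥ y) = 0
      rw [← hzy, mul_zero]
    · change t⁻¹ * (z ⬝ᵥ H *ᵥ z) = 1
      rw [← hz1, inv_mul_cancel₀ h0]
  have hinv : H⁻¹ = t⁻¹ • (Mᵀ * M) := by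
    refine Matrix.inv_eq_left_inv ?_
    have := mul_eq_one_comm.1 hMM
    rw [Matrix.mul_smul, ← Matrix.mul_assoc] at this
    rw [Matrix.smul_mul, this]
  rw [meanCurvature_one_eq hX, ← hH, hinv] at h
  rw [fderiv_fderiv_apply _ y y, fderiv_fderiv_apply _ z z]
  simp only [Matrix.smul_apply, Matrix.mul_apply, Matrix.transpose_apply, Fin.sum_univ_two, hM,
    Matrix.of_apply, Matrix.cons_val_zero, Matrix.cons_val_one, smul_eq_mul, mul_assoc,
    ← mul_add, mul_eq_zero, inv_eq_zero, h0, false_or] at h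
  simp only [Fin.sum_univ_two, dotProduct_add, dotProduct_smul, smul_eq_mul]
  linarith

end Gram

/-- The cross product of the coordinate tangent vectors. -/
noncomputable def tangentCross (X : (Fin 2 → ℝ) → (Fin 3 → ℝ)) (σ : Fin 2 → ℝ) : Fin 3 → ℝ :=
  crossProduct (fderiv ℝ X σ (Pi.single 0 1)) (fderiv ℝ X σ (Pi.single 1 1))

/-- Cramer's rule in the plane of `p` and `q`. -/
theorem exists_comb_of_dotProduct_cross_eq_zero {p q Z : Fin 3 → ℝ}
    (hc : crossProduct p q ⬝ᵥ crossProduct p q ≠ 0) (hZ : crossProduct p q ⬝ᵥ Z = 0) :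
    ∃ α β : ℝ, Z = α • p + β • q := by
  refine ⟨(crossProduct Z q ⬝ᵥ crossProduct p q) / (crossProduct p q ⬝ᵥ crossProduct p q),
    (crossProduct p Z ⬝ᵥ crossProduct p q) / (crossProduct p q ⬝ᵥ crossProduct p q), ?_⟩
  ext i
  simp only [Pi.add_apply, Pi.smul_apply, smul_eq_mul]
  field_simp
  simp only [cross_apply, dotProduct, Fin.sum_univ_three, Matrix.cons_val] at hZ ⊢
  fin_cases i <;> simp
  · linear_combination (p 1 * q 2 - p 2 * q 1) * hZ
  · linear_combination (p 2 * q 0 - p 0 * q 2) * hZ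
  · linear_combination (p 0 * q 1 - p 1 * q 0) * hZ

/-- The normal is the normalised cross product of the coordinate vectors, hence differentiable on
all of `U`. Differentiating `N · dX = 0` gives the second conclusion; symmetry and trace of the form
`dN · dX` follow from it. -/
theorem exists_minimalPatch {U : Set (Fin 2 → ℝ)} {X : (Fin 2 → ℝ) → (Fin 3 → ℝ)}
    (hU : IsOpen U) (hX : IsMinimalSurface U X) :
    ∃ N, MinimalPatch U X N ∧ ∀ σ ∈ U, ∀ y z,
      fderiv ℝ N σ y ⬝ᵥ fderiv ℝ X σ z + N σ ⬝ᵥ fderiv ℝ (fderiv ℝ X) σ y z = 0 := by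
  obtain ⟨hsm, hinj, hmin⟩ := hX
  have hcd : ∀ σ ∈ U, ContDiffAt ℝ ∞ X σ := fun σ hσ => contDiffAt_of_contDiffOn hU hsm hσ
  have hd : ∀ σ ∈ U, DifferentiableAt ℝ X σ := fun σ hσ => (hcd σ hσ).differentiableAt (by simp)
  have hpos : ∀ σ ∈ U, 0 < tangentCross X σ ⬝ᵥ tangentCross X σ := by
    intro σ hσ
    refine lt_of_le_of_ne (Finset.sum_nonneg fun i _ => mul_self_nonneg _) fun h => ?_
    -- Lagrange's identity: the squared length of the cross product is the Gram determinant.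
    have hdet : (inducedMetric (fun _ => 1) X σ).det = 0 := by
      rw [h, tangentCross, cross_dot_cross, dotProduct_fderiv (hd σ hσ),
        dotProduct_fderiv (hd σ hσ), dotProduct_fderiv (hd σ hσ), dotProduct_fderiv (hd σ hσ),
        Matrix.det_fin_two]
      simp
    have := (Matrix.isUnit_iff_isUnit_det _).1 (isUnit_inducedMetric (hd σ hσ) (hinj σ hσ))
    simp [hdet] at this
  set N : (Fin 2 → ℝ) → (Fin 3 → ℝ) :=
    fun σ => (√(tangentCross X σ ⬝ᵥ tangentCross X σ))⁻¹ • tangentCross X σ with hN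
  have hsq : ∀ σ ∈ U, √(tangentCross X σ ⬝ᵥ tangentCross X σ) ≠ 0 :=
    fun σ hσ => (Real.sqrt_pos.2 (hpos σ hσ)).ne'
  have hcross : ∀ σ ∈ U, DifferentiableAt ℝ (tangentCross X) σ := by
    intro σ hσ
    have h1 : ∀ a i, DifferentiableAt ℝ (fun r => fderiv ℝ X r (Pi.single a 1) i) σ := fun a i =>
      differentiableAt_pi.1 ((differentiableAt_fderiv (hcd σ hσ)).clm_apply
        (differentiableAt_const _)) i
    rw [differentiableAt_pi]
    intro i
    simp only [tangentCross, cross_apply]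
    fin_cases i <;> simp <;> exact ((h1 _ _).mul (h1 _ _)).sub ((h1 _ _).mul (h1 _ _))
  have hNd : ∀ σ ∈ U, DifferentiableAt ℝ N σ := by
    intro σ hσ
    have h2 : DifferentiableAt ℝ (fun r => tangentCross X r ⬝ᵥ tangentCross X r) σ := by
      simp only [dotProduct]
      exact DifferentiableAt.fun_sum fun i _ => (differentiableAt_pi.1 (hcross σ hσ) i).mul
        (differentiableAt_pi.1 (hcross σ hσ) i)
    exact ((h2.sqrt (hpos σ hσ).ne').inv (hsq σ hσ)).smul (hcross σ hσ)
  have hnormal : ∀ σ ∈ U, ∀ y, N σ ⬝ᵥ fderiv ℝ X σ y = 0 := by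
    intro σ hσ
    refine (isNormal_iff (hd σ hσ) _).1 fun a => ?_
    simp only [pd_component (hd σ hσ)]
    change N σ ⬝ᵥ fderiv ℝ X σ (Pi.single a 1) = 0
    have hc : tangentCross X σ ⬝ᵥ fderiv ℝ X σ (Pi.single a 1) = 0 := by
      rw [tangentCross, dotProduct_comm]
      fin_cases a
      · exact dot_self_cross _ _
      · exact dot_cross_self _ _
    rw [hN, smul_dotProduct, hc, smul_zero]
  have hsecond : ∀ σ ∈ U, ∀ y z,
      fderiv ℝ N σ y ⬝ᵥ fderiv ℝ X σ z + N σ ⬝ᵥ fderiv ℝ (fderiv ℝ X) σ y z = 0 := by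
    intro σ hσ y z
    have hdd := differentiableAt_fderiv (hcd σ hσ)
    have := dotProduct_fderiv_of_eq_const hU (F := N) (G := fun r => fderiv ℝ X r z) (c := 0)
      (fun r hr => hnormal r hr z) hσ (hNd σ hσ) (hdd.clm_apply (differentiableAt_const _)) y
    rw [fderiv_clm_apply hdd (differentiableAt_const _)] at this
    simpa using this
  refine ⟨N, ⟨hU, hd, hNd, ?_, hnormal, ?_, ?_, ?_⟩, hsecond⟩
  · intro σ hσ
    rw [hN, smul_dotProduct, dotProduct_smul, smul_eq_mul, smul_eq_mul, ← mul_assoc, ← mul_inv,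
      Real.mul_self_sqrt (hpos σ hσ).le, inv_mul_cancel₀ (hpos σ hσ).ne']
  · intro σ hσ Z hZ
    rw [hN, smul_dotProduct, smul_eq_mul, mul_eq_zero] at hZ
    obtain ⟨α, β, h⟩ := exists_comb_of_dotProduct_cross_eq_zero (hpos σ hσ).ne'
      (hZ.resolve_left (inv_ne_zero (hsq σ hσ)))
    exact ⟨α • Pi.single 0 1 + β • Pi.single 1 1, by rw [h, map_add, map_smul, map_smul]⟩
  · intro σ hσ y z
    have hsymm : fderiv ℝ (fderiv ℝ X) σ y z = fderiv ℝ (fderiv ℝ X) σ z y :=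
      ((hcd σ hσ).isSymmSndFDerivAt (by simpa using ENat.LEInfty.out)).eq y z
    have h1 := hsecond σ hσ y z
    have h2 := hsecond σ hσ z y
    rw [hsymm] at h1
    linarith
  · intro σ hσ y z h1 h2
    have h3 := trace_eq_zero_of_meanCurvature_eq_zero (hcd σ hσ) (hinj σ hσ)
      (hmin σ hσ _ ((isNormal_iff (hd σ hσ) _).2 (hnormal σ hσ))) h1 h2
    have h4 := hsecond σ hσ y y
    have h5 := hsecond σ hσ z z
    linarith

/-! ### Killing fields of the plane wave -/

/-- A vector field on `ℝ³` which preserves distances to first order at all pairs of points is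
affine with antisymmetric linear part. -/
theorem exists_antisymm_affine {k : (Fin 3 → ℝ) → (Fin 3 → ℝ)}
    (h : ∀ x y, (k x - k y) ⬝ᵥ (x - y) = 0) :
    ∃ (S : Matrix (Fin 3) (Fin 3) ℝ) (b : Fin 3 → ℝ), Sᵀ = -S ∧ ∀ x, k x = S *ᵥ x + b := by
  set κ : (Fin 3 → ℝ) → (Fin 3 → ℝ) := fun x => k x - k 0 with hκ
  have h0 : ∀ x, κ x ⬝ᵥ x = 0 := fun x => by simpa [hκ] using h x 0
  have h1 : ∀ x y, κ x ⬝ᵥ y = -(κ y ⬝ᵥ x) := by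
    intro x y
    have h2 := h x y
    have h3 : k x - k y = κ x - κ y := by simp [hκ]
    rw [h3, sub_dotProduct, dotProduct_sub, dotProduct_sub, h0, h0] at h2
    linarith
  -- By the polarised identity `h1`, each component of `κ x` is minus the pairing of `x` with the
  -- image of a basis vector. This is linear in `x` although no regularity of `k` is assumed.
  refine ⟨Matrix.of fun i => -κ (Pi.single i 1), k 0, ?_, fun x => ?_⟩
  · ext i j
    have := h1 (Pi.single i 1) (Pi.single j 1)
    simp only [dotProduct_single_one] at this
    simp [this]
  · ext i
    have h2 := h1 x (Pi.single i 1)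
    rw [dotProduct_single_one] at h2
    have h3 : (Matrix.of (fun i => -κ (Pi.single i 1)) *ᵥ x) i = -κ (Pi.single i 1) ⬝ᵥ x := rfl
    rw [Pi.add_apply, h3, neg_dotProduct, ← h2]
    simp [hκ]

section Killing

variable {n : ℕ} {A : Fin (n + 4) → ℝ}
  {K : (Fin 2 ⊕ Fin (n + 4) → ℝ) → (Fin 2 ⊕ Fin (n + 4) → ℝ)}

theorem IsKilling.pd_add_pd (hK : IsKilling (planeWaveMetric A) K)
    (x : Fin 2 ⊕ Fin (n + 4) → ℝ) (p q : Fin (n + 4)) :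
    pd (Sum.inr p) (fun y => K y (Sum.inr q)) x + pd (Sum.inr q) (fun y => K y (Sum.inr p)) x
      = 0 := by
  have h := hK x (Sum.inr p) (Sum.inr q)
  simpa [Fintype.sum_sum_type, Finset.sum_add_distrib] using h

/-- The inclusion of `ℝ³` in space-time at `t = y = 0`. -/
def slice (n : ℕ) (x : Fin 3 → ℝ) : Fin 2 ⊕ Fin (n + 4) → ℝ :=
  Sum.elim 0 (fun q => if h : (q : ℕ) < 3 then x ⟨q, h⟩ else 0)

theorem slice_add_smul (x u : Fin 3 → ℝ) (t : ℝ) :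
    slice n (x + t • u) = slice n x + t • slice n u := by
  ext (i | q)
  · simp [slice]
  · by_cases h : (q : ℕ) < 3 <;> simp [slice, h]

/-- Along the segment from `y` to `x` with direction `u`, the derivative of `K · u` is the quadratic
form of the Jacobian at `u`. It vanishes because the transverse Killing equations kill the symmetric
part, so `exists_antisymm_affine` applies. -/
theorem IsKilling.exists_affine (hK : IsKilling (planeWaveMetric A) K) (hs : ContDiff ℝ ∞ K) :
    ∃ (S : Matrix (Fin 3) (Fin 3) ℝ) (b : Fin 3 → ℝ), Sᵀ = -S ∧
      ∀ x i, K (slice n x) (Sum.inr (incl3 n i)) = (S *ᵥ x + b) i := by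
  have hd : Differentiable ℝ K := hs.differentiable (by simp)
  obtain ⟨S, b, hS, h⟩ := exists_antisymm_affine
    (k := fun x i => K (slice n x) (Sum.inr (incl3 n i))) (fun x y => by
    set u := x - y with hu
    have hφ : ∀ t : ℝ, HasDerivAt
        (fun t : ℝ => ∑ i, K (slice n y + t • slice n u) (Sum.inr (incl3 n i)) * u i) 0 t := by
      intro t
      have hline : HasDerivAt (fun t : ℝ => slice n y + t • slice n u) (slice n u) t := by
        simpa using ((hasDerivAt_id t).smul_const (slice n u)).const_add (slice n y)
      have h1 := HasDerivAt.fun_sum (u := Finset.univ) fun (i : Fin 3) _ =>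
        (((hasFDerivAt_pi'.1 (hd (slice n y + t • slice n u)).hasFDerivAt
          (Sum.inr (incl3 n i))).comp_hasDerivAt t hline).mul_const (u i))
      refine h1.congr_deriv ?_
      have h2 : ∀ i : Fin 3, ((ContinuousLinearMap.proj (Sum.inr (incl3 n i))).comp
          (fderiv ℝ K (slice n y + t • slice n u))) (slice n u)
          = ∑ j, u j * pd (Sum.inr (incl3 n j)) (fun y => K y (Sum.inr (incl3 n i)))
            (slice n y + t • slice n u) := by
        intro i
        rw [← (hasFDerivAt_pi'.1 (hd (slice n y + t • slice n u)).hasFDerivAt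
          (Sum.inr (incl3 n i))).fderiv, fderiv_eq_sum_pd, Fintype.sum_sum_type]
        simp only [slice, Sum.elim_inl, Pi.zero_apply, zero_mul, Finset.sum_const_zero, zero_add,
          Sum.elim_inr]
        simp only [mul_comm (dite _ _ _), sum_dite_lt_three]
        simp only [mul_comm]
      simp only [h2]
      have h3 := fun i j : Fin 3 => hK.pd_add_pd (slice n y + t • slice n u) (incl3 n i) (incl3 n j)
      simp only [Fin.sum_univ_three]
      linear_combination (u 0 * u 0 / 2) * h3 0 0 + (u 1 * u 1 / 2) * h3 1 1
        + (u 2 * u 2 / 2) * h3 2 2 + (u 0 * u 1) * h3 0 1 + (u 0 * u 2) * h3 0 2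
        + (u 1 * u 2) * h3 1 2
    have hc := is_const_of_deriv_eq_zero (fun t => (hφ t).differentiableAt)
      (fun t => (hφ t).deriv) 1 0
    rw [← sub_eq_zero, ← Finset.sum_sub_distrib] at hc
    simp only [dotProduct, Pi.sub_apply, sub_mul]
    have hxy : slice n y + slice n u = slice n x := by
      have := slice_add_smul (n := n) y u 1
      rw [one_smul, one_smul, hu, add_sub_cancel] at this
      exact this.symm
    simp only [one_smul, zero_smul, add_zero, hxy] at hc
    exact hc)
  exact ⟨S, b, hS, fun x i => congrFun (h x) i⟩

theorem fderiv_typeII {X : (Fin 2 → ℝ) → (Fin 3 → ℝ)} {s : Fin 2 ⊕ Fin 2 → ℝ}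
    (hX : DifferentiableAt ℝ X (fun j => s (Sum.inr j))) (v : Fin 2 ⊕ Fin 2 → ℝ) :
    fderiv ℝ (typeII (n + 4) X) s v = Sum.elim (fun i => v (Sum.inl i))
      (fun q : Fin (n + 4) => if h : (q : ℕ) < 3 then
        fderiv ℝ X (fun j => s (Sum.inr j)) (fun j => v (Sum.inr j)) ⟨q, h⟩ else 0) := by
  have hd : DifferentiableAt ℝ (typeII (n + 4) X) s := by
    rw [differentiableAt_pi]
    rintro (i | q)
    · exact (ContinuousLinearMap.proj (R := ℝ) (φ := fun _ : Fin 2 ⊕ Fin 2 => ℝ)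
        (Sum.inl i)).differentiableAt
    · by_cases h : (q : ℕ) < 3
      · simp only [typeII, Sum.elim_inr, h, dite_true]
        exact (differentiableAt_pi.1 hX ⟨q, h⟩).comp s surfaceCoord.differentiableAt
      · simp [typeII, h]
  have hcomp : ∀ μ, fderiv ℝ (typeII (n + 4) X) s v μ
      = fderiv ℝ (fun r => typeII (n + 4) X r μ) s v := by
    intro μ
    rw [(hasFDerivAt_pi'.1 hd.hasFDerivAt μ).fderiv]
    rfl
  ext (i | q)
  · rw [hcomp, fderiv_eq_sum_pd]
    simp [pd_typeII_inl]
  · rw [hcomp, fderiv_eq_sum_pd, Fintype.sum_sum_type]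
    simp only [pd_inl_typeII_inr hX, pd_inr_typeII_inr hX, mul_zero, Finset.sum_const_zero,
      zero_add, Sum.elim_inr]
    by_cases h : (q : ℕ) < 3
    · simp only [h, dite_true]
      rw [← fderiv_eq_sum_pd _ _ (fun j => v (Sum.inr j)),
        (hasFDerivAt_pi'.1 hX.hasFDerivAt ⟨q, h⟩).fderiv]
      rfl
    · simp [h]

/-- A stationary surface moves along a Euclidean Killing field which preserves the profile. -/
theorem IsStationarySurface.exists_affine {U : Set (Fin 2 → ℝ)}
    {X : (Fin 2 → ℝ) → (Fin 3 → ℝ)} {χ : (Fin 2 → ℝ) → (Fin 2 → ℝ)}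
    (h : IsStationarySurface A U X χ) (hX : ∀ σ ∈ U, DifferentiableAt ℝ X σ) :
    ∃ (S : Matrix (Fin 3) (Fin 3) ℝ) (b : Fin 3 → ℝ), Sᵀ = -S ∧ ∀ σ ∈ U,
      fderiv ℝ X σ (χ σ) = S *ᵥ X σ + b ∧
      ∑ i, A (incl3 n i) * X σ i * fderiv ℝ X σ (χ σ) i = 0 := by
  obtain ⟨-, K, hsm, hK, hs⟩ := h
  obtain ⟨S, b, hS, hSb⟩ := hK.exists_affine hsm
  have hd : Differentiable ℝ K := hsm.differentiable (by simp)
  refine ⟨S, b, hS, fun σ hσ => ?_⟩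
  have hval : ∀ s ∈ cylinder U, K (typeII (n + 4) X s) = Sum.elim (0 : Fin 2 → ℝ)
      (fun q : Fin (n + 4) => if h : (q : ℕ) < 3 then fderiv ℝ X (fun j => s (Sum.inr j))
        (χ (fun j => s (Sum.inr j))) ⟨q, h⟩ else 0) := by
    intro s hsU
    rw [← hs s hsU, fderiv_typeII (hX _ hsU)]
    rfl
  have hmem : ∀ τ : Fin 2 → ℝ, (Sum.elim τ σ : Fin 2 ⊕ Fin 2 → ℝ) ∈ cylinder U := fun _ => hσ
  have hX0 : typeII (n + 4) X (Sum.elim 0 σ) = slice n (X σ) := rfl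
  refine ⟨?_, ?_⟩
  · ext i
    rw [← hSb, ← hX0, hval _ (hmem 0)]
    simp [incl3]
  -- In the `tt` Killing equation the terms with `∂_t K` drop out: the worldvolume is invariant
  -- under shifts of `t`, and the `t`, `y` components of `K` vanish on it. What remains is the
  -- derivative of the profile along `K`.
  · have h0 := hK (typeII (n + 4) X (Sum.elim 0 σ)) (Sum.inl 0) (Sum.inl 0)
    have hpd : ∀ i : Fin 2, pd (Sum.inl 0) (fun y => K y (Sum.inl i))
        (typeII (n + 4) X (Sum.elim 0 σ)) = 0 := by
      intro i
      have h1 := ((differentiableAt_pi.1 (hd (typeII (n + 4) X (Sum.elim 0 σ)))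
        (Sum.inl i)).hasFDerivAt.hasLineDerivAt (Pi.single (Sum.inl 0) 1))
      have h2 : ∀ t : ℝ, K (typeII (n + 4) X (Sum.elim 0 σ) + t • Pi.single (Sum.inl 0) 1)
          (Sum.inl i) = 0 := by
        intro t
        have : typeII (n + 4) X (Sum.elim 0 σ) + t • Pi.single (Sum.inl 0) 1
            = typeII (n + 4) X (Sum.elim (Pi.single 0 t) σ) := by
          ext (j | q)
          · simp [typeII, Pi.single_apply]
          · simp [typeII]
        rw [this, hval _ (hmem _)]
        rfl
      simp only [HasLineDerivAt, h2] at h1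
      exact h1.unique (hasDerivAt_const _ _)
    simp only [Fintype.sum_sum_type, pd_inl_planeWaveMetric, mul_zero, hpd, add_zero,
      Finset.sum_const_zero, zero_add, pd_inr_planeWaveMetric_inl, planeWaveMetric_inl_inr,
      planeWaveMetric_inr_inl, zero_mul, hval _ (hmem 0), Sum.elim_inr] at h0
    simp only [mul_comm (dite _ _ _), sum_dite_lt_three] at h0
    have hx : ∀ i, typeII (n + 4) X (Sum.elim 0 σ) (Sum.inr (incl3 n i)) = X σ i := by
      intro i
      simp [typeII, incl3]
    simp only [hx] at h0
    simp only [Fin.sum_univ_three] at h0 ⊢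
    linarith

end Killing

/-! ### Minimal surfaces invariant under a screw motion -/

/-- The determinant of the frame is `|N|²|V|² - (N · V)² = |V|²`. -/
theorem eq_zero_of_dotProduct_frame {N V D : Fin 3 → ℝ} (hN : N ⬝ᵥ N = 1) (hNV : N ⬝ᵥ V = 0)
    (hV : V ≠ 0) (h1 : N ⬝ᵥ D = 0) (h2 : V ⬝ᵥ D = 0) (h3 : crossProduct N V ⬝ᵥ D = 0) : D = 0 := by
  refine Matrix.eq_zero_of_mulVec_eq_zero (M := Matrix.of ![N, V, crossProduct N V]) ?_ ?_
  · have h : (Matrix.of ![N, V, crossProduct N V]).det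
        = (N ⬝ᵥ N) * (V ⬝ᵥ V) - (N ⬝ᵥ V) * (V ⬝ᵥ N) := by
      rw [← cross_dot_cross, Matrix.det_fin_three]
      simp [cross_apply, dotProduct, Fin.sum_univ_three]
      ring
    rw [h, hN, hNV, one_mul, zero_mul, sub_zero]
    exact fun h => hV (dotProduct_self_eq_zero.1 h)
  · ext i
    fin_cases i
    · exact h1
    · exact h2
    · exact h3

theorem exists_cos_sin_eq {u v : ℝ} (h : u ^ 2 + v ^ 2 = 1) :
    ∃ θ : ℝ, u = Real.cos θ ∧ v = Real.sin θ := by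
  have hn : ‖(⟨u, v⟩ : ℂ)‖ = 1 := by
    rw [Complex.norm_eq_sqrt_sq_add_sq, h, Real.sqrt_one]
  have h0 : (⟨u, v⟩ : ℂ) ≠ 0 := fun h0 => by simp [h0] at hn
  exact ⟨Complex.arg ⟨u, v⟩, by rw [Complex.cos_arg h0, hn, div_one],
    by rw [Complex.sin_arg, hn, div_one]⟩

theorem Real.hasDerivAt_artanh {x : ℝ} (hx : x ^ 2 < 1) :
    HasDerivAt Real.artanh (1 / (1 - x ^ 2)) x := by
  have hI : x ∈ Set.Ioo (-1) 1 := by rw [sq_lt_one_iff_abs_lt_one, abs_lt] at hx; exact hx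
  have h1 : 0 < 1 + x := by linarith [hI.1]
  have h2 : 0 < 1 - x := by linarith [hI.2]
  have h : HasDerivAt (fun y : ℝ => 1 / 2 * (Real.log (1 + y) - Real.log (1 - y)))
      (1 / 2 * (1 / (1 + x) - -1 / (1 - x))) x :=
    ((((hasDerivAt_id x).const_add 1).log h1.ne').sub
      (((hasDerivAt_id x).const_sub 1).log h2.ne')).const_mul _
  refine (h.congr_of_eventuallyEq ?_).congr_deriv ?_
  · filter_upwards [isOpen_Ioo.mem_nhds hI] with y hy
    rw [Real.artanh_eq_half_log (Set.Ioo_subset_Icc_self hy), Real.log_div]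
    · linarith [hy.1]
    · linarith [hy.2]
  · have : 1 - x ^ 2 ≠ 0 := by nlinarith
    field_simp
    ring

theorem eq_of_hasLineDerivAt_zero {U : Set (Fin 2 → ℝ)} (hU : IsOpen U) (hc : IsPreconnected U)
    {F : (Fin 2 → ℝ) → ℝ} (hF : ∀ σ ∈ U, DifferentiableAt ℝ F σ)
    (h : ∀ σ ∈ U, ∀ y, HasDerivAt (fun t : ℝ => F (σ + t • y)) 0 0) {σ σ' : Fin 2 → ℝ}
    (hσ : σ ∈ U) (hσ' : σ' ∈ U) : F σ = F σ' := by
  refine hU.is_const_of_fderiv_eq_zero hc (fun x hx => (hF x hx).differentiableWithinAt) ?_ hσ hσ'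
  intro x hx
  ext y : 1
  have h1 := (hF x hx).hasFDerivAt.hasLineDerivAt y
  exact h1.unique (h x hx y)

theorem hasDerivAt_line_component {F : (Fin 2 → ℝ) → (Fin 3 → ℝ)} {σ : Fin 2 → ℝ}
    (hF : DifferentiableAt ℝ F σ) (y : Fin 2 → ℝ) (i : Fin 3) :
    HasDerivAt (fun t : ℝ => F (σ + t • y) i) (fderiv ℝ F σ y i) 0 :=
  (hasFDerivAt_pi'.1 hF.hasFDerivAt i).hasLineDerivAt y

theorem screwField_add_screwField {a b : ℝ} (x y : Fin 3 → ℝ) :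
    screwField a b (x + y) = screwField a b x + screwField a 0 y := by
  ext i
  fin_cases i <;> simp [screwField] <;> ring

theorem fderiv_screwField_comp {X : (Fin 2 → ℝ) → (Fin 3 → ℝ)} {σ : Fin 2 → ℝ} (a b : ℝ)
    (hX : DifferentiableAt ℝ X σ) :
    DifferentiableAt ℝ (fun r => screwField a b (X r)) σ ∧ ∀ y,
      fderiv ℝ (fun r => screwField a b (X r)) σ y = screwField a 0 (fderiv ℝ X σ y) := by
  have hi := hasFDerivAt_pi'.1 hX.hasFDerivAt
  have h : HasFDerivAt (fun r => screwField a b (X r)) (ContinuousLinearMap.pi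
      ![-(a • (ContinuousLinearMap.proj 1).comp (fderiv ℝ X σ)),
        a • (ContinuousLinearMap.proj 0).comp (fderiv ℝ X σ), 0]) σ := by
    rw [hasFDerivAt_pi]
    intro i
    fin_cases i
    · exact ((hi 1).const_mul a).neg
    · exact (hi 0).const_mul a
    · exact hasFDerivAt_const b σ
  refine ⟨h.differentiableAt, fun y => ?_⟩
  rw [h.fderiv]
  ext i
  fin_cases i <;> simp [screwField]

namespace MinimalPatch

variable {U : Set (Fin 2 → ℝ)} {X N : (Fin 2 → ℝ) → (Fin 3 → ℝ)}

theorem normal_fderiv_normal (hP : MinimalPatch U X N) {σ : Fin 2 → ℝ} (hσ : σ ∈ U)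
    (y : Fin 2 → ℝ) : N σ ⬝ᵥ fderiv ℝ N σ y = 0 := by
  have h := dotProduct_fderiv_of_eq_const hP.isOpen hP.unit hσ (hP.differentiableAt_normal σ hσ)
    (hP.differentiableAt_normal σ hσ) y
  rw [dotProduct_comm] at h
  linarith

section Screw

variable {a b : ℝ} {χ : (Fin 2 → ℝ) → (Fin 2 → ℝ)} {σ : Fin 2 → ℝ}

theorem normal_screwField (hP : MinimalPatch U X N)
    (hV : ∀ σ ∈ U, fderiv ℝ X σ (χ σ) = screwField a b (X σ)) (hσ : σ ∈ U) :
    a * (N σ 1 * X σ 0 - N σ 0 * X σ 1) + b * N σ 2 = 0 := by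
  have h := hP.normal σ hσ (χ σ)
  rw [hV σ hσ] at h
  simp [screwField, dotProduct, Fin.sum_univ_three] at h
  linarith

/-- The derivative of `N · V = 0`. It gives the `V` component of `dN` from first derivatives of `X`
alone. -/
theorem fderiv_normal_dotProduct_screwField (hP : MinimalPatch U X N)
    (hV : ∀ σ ∈ U, fderiv ℝ X σ (χ σ) = screwField a b (X σ)) (hσ : σ ∈ U) (y : Fin 2 → ℝ) :
    fderiv ℝ N σ y ⬝ᵥ screwField a b (X σ) + N σ ⬝ᵥ screwField a 0 (fderiv ℝ X σ y) = 0 := by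
  obtain ⟨h1, h2⟩ := fderiv_screwField_comp a b (hP.differentiableAt σ hσ)
  rw [← h2]
  refine dotProduct_fderiv_of_eq_const hP.isOpen (G := fun r => screwField a b (X r)) (c := 0)
    (fun r hr => ?_) hσ (hP.differentiableAt_normal σ hσ) h1 y
  rw [← hV r hr, hP.normal r hr]

/-- The differentials of `X` and of the Gauss map in terms of the frame `V`, `N × V`. -/
theorem exists_frame (hP : MinimalPatch U X N)
    (hV : ∀ σ ∈ U, fderiv ℝ X σ (χ σ) = screwField a b (X σ)) (hσ : σ ∈ U)
    (h0 : screwField a b (X σ) ≠ 0) (y : Fin 2 → ℝ) :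
    ∃ α β : ℝ, fderiv ℝ X σ y = ![-(α * a * X σ 1) + β * (N σ 1 * b - N σ 2 * a * X σ 0),
        α * a * X σ 0 - β * (N σ 0 * b + N σ 2 * a * X σ 1),
        α * b + β * a * (N σ 0 * X σ 0 + N σ 1 * X σ 1)] ∧
      fderiv ℝ N σ y = ![-(α * a * N σ 1) + β * a * N σ 2 * N σ 0,
        α * a * N σ 0 + β * a * N σ 2 * N σ 1, -(β * a * (1 - N σ 2 ^ 2))] := by
  have hN := hP.unit σ hσ
  have hNV : N σ ⬝ᵥ screwField a b (X σ) = 0 := by rw [← hV σ hσ, hP.normal σ hσ]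
  have hvv : screwField a b (X σ) ⬝ᵥ screwField a b (X σ) ≠ 0 :=
    fun h => h0 (dotProduct_self_eq_zero.1 h)
  have hNE : N σ ⬝ᵥ crossProduct (N σ) (screwField a b (X σ)) = 0 := dot_self_cross _ _
  have hVE : screwField a b (X σ) ⬝ᵥ crossProduct (N σ) (screwField a b (X σ)) = 0 :=
    dot_cross_self _ _
  have hEE : crossProduct (N σ) (screwField a b (X σ)) ⬝ᵥ
      crossProduct (N σ) (screwField a b (X σ))
      = screwField a b (X σ) ⬝ᵥ screwField a b (X σ) := by
    rw [cross_dot_cross, hN, hNV]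
    ring
  obtain ⟨e, he⟩ := hP.exists_tangent σ hσ _ hNE
  set V := screwField a b (X σ) with hVdef
  set E := crossProduct (N σ) V with hE
  -- `V` and `E = N × V` are orthogonal of equal length and span the tangent plane; `α` and `β` are
  -- the coordinates of `dX y` in this frame.
  have hXy : fderiv ℝ X σ y = (V ⬝ᵥ fderiv ℝ X σ y / V ⬝ᵥ V) • V
      + (E ⬝ᵥ fderiv ℝ X σ y / V ⬝ᵥ V) • E := by
    rw [← sub_eq_zero]
    refine eq_zero_of_dotProduct_frame hN hNV h0 ?_ ?_ ?_
    · simp [dotProduct_sub, dotProduct_add, dotProduct_smul, hP.normal σ hσ y, hNV, hNE]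
    · simp [dotProduct_sub, dotProduct_add, dotProduct_smul, hVE]
      field_simp
      ring
    · rw [← hE]
      simp [dotProduct_sub, dotProduct_add, dotProduct_smul, dotProduct_comm E V, hVE, hEE]
      field_simp
      ring
  set α := V ⬝ᵥ fderiv ℝ X σ y / V ⬝ᵥ V
  set β := E ⬝ᵥ fderiv ℝ X σ y / V ⬝ᵥ V
  have hsc := hP.normal_screwField hV hσ
  have htr := hP.trace σ hσ (χ σ) e (by rw [hV σ hσ, he, hEE])
    (by rw [hV σ hσ, he, hVE])
  have hsy := hP.symm σ hσ y e
  have hLχ := hP.fderiv_normal_dotProduct_screwField hV hσ (χ σ)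
  have hLe := hP.fderiv_normal_dotProduct_screwField hV hσ e
  have hLy := hP.fderiv_normal_dotProduct_screwField hV hσ y
  rw [hV σ hσ, he, ← hVdef] at htr
  rw [he, hXy] at hsy
  rw [hV σ hσ, ← hVdef] at hLχ
  rw [he, ← hVdef] at hLe
  rw [hXy, ← hVdef] at hLy
  have hny := hP.normal_fderiv_normal hσ y
  have hV0 : V 0 = -(a * X σ 1) := rfl
  have hV1 : V 1 = a * X σ 0 := rfl
  have hV2 : V 2 = b := rfl
  have hE0 : E 0 = N σ 1 * V 2 - N σ 2 * V 1 := by simp [hE, cross_apply]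
  have hE1 : E 1 = N σ 2 * V 0 - N σ 0 * V 2 := by simp [hE, cross_apply]
  have hE2 : E 2 = N σ 0 * V 1 - N σ 1 * V 0 := by simp [hE, cross_apply]
  refine ⟨α, β, ?_, ?_⟩
  · rw [hXy]
    ext i
    fin_cases i <;> simp [hV0, hV1, hV2, hE0, hE1, hE2] <;> ring
  · rw [← sub_eq_zero]
    have hN' := hN
    simp only [dotProduct_add, dotProduct_smul, smul_eq_mul] at hsy
    simp only [dotProduct, Fin.sum_univ_three, screwField, Matrix.cons_val, hV0, hV1, hV2, hE0,
      hE1, hE2, Pi.add_apply, Pi.smul_apply, smul_eq_mul] at hsy htr hLχ hLe hLy hny hN'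
    -- The three components of `dN y`: the one along `N` vanishes; the one along `V` comes from
    -- invariance; the one along `E` is `dN e · dX y` by symmetry, and `dN e · E = -(dN χ · V)` by
    -- minimality. The claimed value is `α` times the rotated normal plus `β a (N₂ N - e₃)`, where
    -- `N₂ = N σ 2` and `e₃` spans the axis.
    refine eq_zero_of_dotProduct_frame hN hNV h0 ?_ ?_ ?_
    · simp [dotProduct, Fin.sum_univ_three]
      linear_combination hny - β * a * N σ 2 * hN'
    · simp [dotProduct, Fin.sum_univ_three, hV0, hV1, hV2]
      linear_combination hLy - β * a * b * hN'
    · rw [← hE]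
      simp [dotProduct, Fin.sum_univ_three, hV0, hV1, hV2, hE0, hE1, hE2]
      linear_combination hsy + α * hLe + β * (htr - hLχ)

/-- At a zero of the screw field the normal is parallel to the axis. -/
theorem normal_eq_of_screwField_eq_zero (hP : MinimalPatch U X N)
    (hV : ∀ σ ∈ U, fderiv ℝ X σ (χ σ) = screwField a b (X σ)) (ha : 0 < a) (hσ : σ ∈ U)
    (h0 : screwField a b (X σ) = 0) : N σ 0 = 0 ∧ N σ 1 = 0 := by
  -- Where `V` vanishes, the derivative of `N · V = 0` says that `N` is orthogonal to the quarter
  -- turn of every tangent vector; three vectors spanning the tangent plane then suffice.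
  have hJ : ∀ Z, N σ ⬝ᵥ Z = 0 → N σ 0 * Z 1 - N σ 1 * Z 0 = 0 := by
    intro Z hZ
    obtain ⟨y, rfl⟩ := hP.exists_tangent σ hσ Z hZ
    have h := hP.fderiv_normal_dotProduct_screwField hV hσ y
    rw [h0, dotProduct_zero, zero_add] at h
    simp [dotProduct, Fin.sum_univ_three, screwField] at h
    have h' : a * (N σ 0 * fderiv ℝ X σ y 1 - N σ 1 * fderiv ℝ X σ y 0) = 0 := by linarith
    exact (mul_eq_zero.1 h').resolve_left ha.ne'
  have h1 := hJ ![N σ 2, 0, -N σ 0] (by simp [dotProduct, Fin.sum_univ_three]; ring)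
  have h2 := hJ ![0, N σ 2, -N σ 1] (by simp [dotProduct, Fin.sum_univ_three]; ring)
  have h3 := hJ ![-N σ 1, N σ 0, 0] (by simp [dotProduct, Fin.sum_univ_three]; ring)
  simp at h1 h2 h3
  constructor <;> nlinarith

/-- The flux of a screw invariant minimal surface along the axis is constant. -/
theorem flux_eq (hP : MinimalPatch U X N) (hc : IsPreconnected U)
    (hV : ∀ σ ∈ U, fderiv ℝ X σ (χ σ) = screwField a b (X σ)) (ha : 0 < a) {σ' : Fin 2 → ℝ}
    (hσ : σ ∈ U) (hσ' : σ' ∈ U) :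
    N σ 0 * X σ 0 + N σ 1 * X σ 1 = N σ' 0 * X σ' 0 + N σ' 1 * X σ' 1 := by
  refine eq_of_hasLineDerivAt_zero hP.isOpen hc (F := fun σ => N σ 0 * X σ 0 + N σ 1 * X σ 1)
    (fun r hr => ?_) (fun r hr y => ?_) hσ hσ'
  · have h1 := differentiableAt_pi.1 (hP.differentiableAt r hr)
    have h2 := differentiableAt_pi.1 (hP.differentiableAt_normal r hr)
    exact ((h2 0).mul (h1 0)).add ((h2 1).mul (h1 1))
  · have h1 := hasDerivAt_line_component (hP.differentiableAt r hr) y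
    have h2 := hasDerivAt_line_component (hP.differentiableAt_normal r hr) y
    refine (((h2 0).mul (h1 0)).add ((h2 1).mul (h1 1))).congr_deriv ?_
    simp only [zero_smul, add_zero]
    -- The frame needs `V ≠ 0`. At a zero of `V` both horizontal parts, of `N` and of `X`, vanish,
    -- so the derivative is zero trivially.
    by_cases h0 : screwField a b (X r) = 0
    · obtain ⟨hN0, hN1⟩ := hP.normal_eq_of_screwField_eq_zero hV ha hr h0
      have hx0 : a * X r 0 = 0 := congrFun h0 1
      have hx1 : -(a * X r 1) = 0 := congrFun h0 0
      have hx0' := (mul_eq_zero.1 hx0).resolve_left ha.ne'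
      have hx1' := (mul_eq_zero.1 (neg_eq_zero.1 hx1)).resolve_left ha.ne'
      simp [hN0, hN1, hx0', hx1']
    · obtain ⟨α, β, hX, hN⟩ := hP.exists_frame hV hr h0 y
      rw [hX, hN]
      simp
      ring

end Screw

end MinimalPatch

/-! ### Quadrics vanishing on a screw-invariant surface: separation of harmonics. -/

/-- A quadratic polynomial on `ℝ³` of the kind which arises as the derivative of a quadratic
potential along a screw field. -/
def screwQuadric (α β γ δ ε ζ η θ : ℝ) (x : Fin 3 → ℝ) : ℝ :=
  α * (x 0 ^ 2 - x 1 ^ 2) + β * (x 0 * x 1) + x 2 * (γ * x 0 + δ * x 1) + ε * x 0 + ζ * x 1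
    + η * x 2 + θ

/-- The hypotheses are the real and imaginary parts of `(p - iq)(u + iv) = 0`, up to sign. -/
theorem eq_zero_of_rotated_eq_zero {p q u v : ℝ} (h : u ^ 2 + v ^ 2 ≠ 0) (h1 : p * u + q * v = 0)
    (h2 : q * u - p * v = 0) : p = 0 ∧ q = 0 := by
  constructor
  · have : p * (u ^ 2 + v ^ 2) = 0 := by linear_combination u * h1 - v * h2
    exact (mul_eq_zero.1 this).resolve_right h
  · have : q * (u ^ 2 + v ^ 2) = 0 := by linear_combination v * h1 + u * h2
    exact (mul_eq_zero.1 this).resolve_right h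

theorem cosh_sq_artanh_mul {x : ℝ} (hx : x ^ 2 < 1) :
    Real.cosh (Real.artanh x) ^ 2 * (1 - x ^ 2) = 1 := by
  have hI : x ∈ Set.Ioo (-1) 1 := by rw [sq_lt_one_iff_abs_lt_one, abs_lt] at hx; exact hx
  have h : 0 < 1 - x ^ 2 := by linarith
  rw [Real.cosh_artanh hI, div_pow, Real.sq_sqrt h.le]
  field_simp

theorem sinh_artanh_eq_mul_cosh {x : ℝ} (hx : x ^ 2 < 1) :
    Real.sinh (Real.artanh x) = x * Real.cosh (Real.artanh x) := by
  have hI : x ∈ Set.Ioo (-1) 1 := by rw [sq_lt_one_iff_abs_lt_one, abs_lt] at hx; exact hx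
  rw [Real.cosh_artanh hI, Real.sinh_artanh hI]
  ring

namespace MinimalPatch

variable {U : Set (Fin 2 → ℝ)} {X N : (Fin 2 → ℝ) → (Fin 3 → ℝ)}
variable {a b : ℝ} {χ : (Fin 2 → ℝ) → (Fin 2 → ℝ)} {σ : Fin 2 → ℝ}

theorem hasDerivAt_of_forall_eq (hP : MinimalPatch U X N) {f : (Fin 2 → ℝ) → ℝ} {c d : ℝ}
    (h : ∀ σ ∈ U, f σ = c) (hσ : σ ∈ U) (y : Fin 2 → ℝ)
    (hd : HasDerivAt (fun t : ℝ => f (σ + t • y)) d 0) : d = 0 := by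
  have h1 : (fun t : ℝ => f (σ + t • y)) =ᶠ[nhds 0] fun _ => c := by
    have hcont : Continuous fun t : ℝ => σ + t • y := by fun_prop
    filter_upwards [(hP.isOpen.preimage hcont).mem_nhds (by simpa using hσ)] with t ht
    exact h _ ht
  exact hd.unique ((hasDerivAt_const (0 : ℝ) c).congr_of_eventuallyEq h1)

/-- `V` is tangent, so the derivative `D` along `V` of a quadric vanishing on the surface vanishes
there too. The family is closed under `D`: `(α, β)` turns with frequency `2a`, the pairs `(γ, δ)`
and `(ε, ζ)` with frequency `a`, and the pitch `b` feeds `(γ, δ)` into `(ε, ζ)` and `η` into the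
constant. -/
theorem screwQuadric_derivative (hP : MinimalPatch U X N)
    (hV : ∀ σ ∈ U, fderiv ℝ X σ (χ σ) = screwField a b (X σ)) {α β γ δ ε ζ η θ : ℝ}
    (h : ∀ σ ∈ U, screwQuadric α β γ δ ε ζ η θ (X σ) = 0) (hσ : σ ∈ U) :
    screwQuadric (a * β) (-4 * a * α) (a * δ) (-a * γ) (a * ζ + b * γ) (-a * ε + b * δ) 0 (b * η)
      (X σ) = 0 := by
  have h1 := hasDerivAt_line_component (hP.differentiableAt σ hσ) (χ σ)
  refine hP.hasDerivAt_of_forall_eq h hσ (χ σ) ?_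
  simp only [screwQuadric]
  have h2 := (((h1 0).pow 2).sub ((h1 1).pow 2)).const_mul α
  have h3 := ((h1 0).mul (h1 1)).const_mul β
  have h4 := (h1 2).mul (((h1 0).const_mul γ).add ((h1 1).const_mul δ))
  have h5 := ((((h2.add h3).add h4).add ((h1 0).const_mul ε)).add ((h1 1).const_mul ζ)).add
    ((h1 2).const_mul η)
  refine (h5.add_const θ).congr_deriv ?_
  rw [hV σ hσ]
  simp [screwField]
  ring

/-- This is `D² + a²`. It kills the first harmonic except for the resonant part produced by the
pitch, and multiplies the second harmonic by `-4a² + a²`. -/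
theorem screwQuadric_annihilate (hP : MinimalPatch U X N)
    (hV : ∀ σ ∈ U, fderiv ℝ X σ (χ σ) = screwField a b (X σ)) {α β γ δ ε ζ η θ : ℝ}
    (h : ∀ σ ∈ U, screwQuadric α β γ δ ε ζ η θ (X σ) = 0) (hσ : σ ∈ U) :
    screwQuadric (-3 * a ^ 2 * α) (-3 * a ^ 2 * β) 0 0 (2 * a * b * δ) (-2 * a * b * γ)
      (a ^ 2 * η) (a ^ 2 * θ) (X σ) = 0 := by
  have h2 := hP.screwQuadric_derivative hV (fun σ hσ => hP.screwQuadric_derivative hV h hσ) hσ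
  have h0 := h σ hσ
  simp only [screwQuadric] at h0 h2 ⊢
  linear_combination h2 + a ^ 2 * h0

/-- The quadric and its derivative pair `(α, β/2)` with the real and imaginary parts of `(x₀ + i
x₁)²`, which is nonzero off the axis. -/
theorem screwQuadric_second_harmonic (hP : MinimalPatch U X N)
    (hV : ∀ σ ∈ U, fderiv ℝ X σ (χ σ) = screwField a b (X σ)) (ha : 0 < a) {α β : ℝ}
    (h : ∀ σ ∈ U, screwQuadric α β 0 0 0 0 0 0 (X σ) = 0) (hσ : σ ∈ U)
    (hr : X σ 0 ^ 2 + X σ 1 ^ 2 ≠ 0) : α = 0 ∧ β = 0 := by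
  have h1 := hP.screwQuadric_derivative hV h hσ
  have h0 := h σ hσ
  simp only [screwQuadric] at h0 h1
  have h3 : (X σ 0 ^ 2 - X σ 1 ^ 2) ^ 2 + (2 * (X σ 0 * X σ 1)) ^ 2 ≠ 0 := by
    have : (X σ 0 ^ 2 - X σ 1 ^ 2) ^ 2 + (2 * (X σ 0 * X σ 1)) ^ 2
      = (X σ 0 ^ 2 + X σ 1 ^ 2) ^ 2 := by ring
    rw [this]
    exact pow_ne_zero 2 hr
  obtain ⟨hα, hβ⟩ := eq_zero_of_rotated_eq_zero h3 (p := α) (q := β / 2) (by linarith)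
    (mul_left_cancel₀ ha.ne' (by linear_combination h1 / 2))
  exact ⟨hα, by linarith⟩

theorem screwQuadric_first_harmonic (hP : MinimalPatch U X N)
    (hV : ∀ σ ∈ U, fderiv ℝ X σ (χ σ) = screwField a b (X σ)) (ha : 0 < a) {ε ζ : ℝ}
    (h : ∀ σ ∈ U, screwQuadric 0 0 0 0 ε ζ 0 0 (X σ) = 0) (hσ : σ ∈ U)
    (hr : X σ 0 ^ 2 + X σ 1 ^ 2 ≠ 0) : ε = 0 ∧ ζ = 0 := by
  have h1 := hP.screwQuadric_derivative hV h hσ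
  have h0 := h σ hσ
  simp only [screwQuadric] at h0 h1
  exact eq_zero_of_rotated_eq_zero hr (by linarith)
    (mul_left_cancel₀ ha.ne' (by linear_combination h1))

/-- For a screw field with nonzero pitch the quadric vanishes identically. -/
theorem screwQuadric_eq_zero (hP : MinimalPatch U X N)
    (hV : ∀ σ ∈ U, fderiv ℝ X σ (χ σ) = screwField a b (X σ)) (ha : 0 < a) (hb : b ≠ 0)
    {α β γ δ ε ζ η θ : ℝ}
    (h : ∀ σ ∈ U, screwQuadric α β γ δ ε ζ η θ (X σ) = 0) (hσ : σ ∈ U)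
    (hr : X σ 0 ^ 2 + X σ 1 ^ 2 ≠ 0) :
    α = 0 ∧ β = 0 ∧ γ = 0 ∧ δ = 0 ∧ ε = 0 ∧ ζ = 0 ∧ η = 0 ∧ θ = 0 := by
  have ha' := ha.ne'
  -- `(D² + a²)²` also removes the resonant first harmonic. A further `D²` removes the affine
  -- function of the height and leaves the second harmonic with the factor `9a⁴ · (-4a²) = -36a⁶`.
  have hT := fun σ hσ => hP.screwQuadric_annihilate hV
    (fun σ hσ => hP.screwQuadric_annihilate hV h (σ := σ) hσ) (σ := σ) hσ
  have hD := fun σ hσ => hP.screwQuadric_derivative hV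
    (fun σ hσ => hP.screwQuadric_derivative hV hT (σ := σ) hσ) (σ := σ) hσ
  obtain ⟨h1, h2⟩ := hP.screwQuadric_second_harmonic hV ha (α := -36 * a ^ 6 * α)
    (β := -36 * a ^ 6 * β) (fun σ hσ => by
    have := hD σ hσ
    simp only [screwQuadric] at this ⊢
    linear_combination this) hσ hr
  have hα : α = 0 := by
    have : (-36 * a ^ 6) * α = 0 := by linear_combination h1
    exact (mul_eq_zero.1 this).resolve_left (by positivity)
  have hβ : β = 0 := by
    have : (-36 * a ^ 6) * β = 0 := by linear_combination h2
    exact (mul_eq_zero.1 this).resolve_left (by positivity)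
  subst hα hβ
  have hη : η = 0 := by
    -- With `α = β = 0` only `a⁴(η x₂ + θ)` is left in `hT`; its derivative isolates `η` because `b
    -- ≠ 0`.
    have h3 := hP.screwQuadric_derivative hV hT hσ
    simp only [screwQuadric] at h3
    have : (b * a ^ 4) * η = 0 := by linear_combination h3
    exact (mul_eq_zero.1 this).resolve_left (by positivity)
  have hθ : θ = 0 := by
    have h3 := hT σ hσ
    simp only [screwQuadric] at h3
    have : (a ^ 4) * θ = 0 := by linear_combination h3 - a ^ 4 * X σ 2 * hη
    exact (mul_eq_zero.1 this).resolve_left (by positivity)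
  subst hη hθ
  -- A single `D² + a²` now leaves exactly the resonant terms, which carry `γ` and `δ`.
  obtain ⟨h5, h6⟩ := hP.screwQuadric_first_harmonic hV ha (ε := 2 * a * b * δ)
    (ζ := -2 * a * b * γ) (fun σ hσ => by
    have := hP.screwQuadric_annihilate hV h hσ
    simp only [screwQuadric] at this ⊢
    linear_combination this) hσ hr
  have hγ : γ = 0 := by
    have : (-2 * a * b) * γ = 0 := h6
    exact (mul_eq_zero.1 this).resolve_left (by positivity)
  have hδ : δ = 0 := by
    have : (2 * a * b) * δ = 0 := h5
    exact (mul_eq_zero.1 this).resolve_left (by positivity)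
  subst hγ hδ
  obtain ⟨h7, h8⟩ := hP.screwQuadric_first_harmonic hV ha h hσ hr
  exact ⟨rfl, rfl, rfl, rfl, h7, h8, rfl, rfl⟩

/-- A surface inside the axis would have tangent vectors along the axis only, but the tangent plane
is two-dimensional. -/
theorem exists_radius_ne_zero (hP : MinimalPatch U X N) (hne : U.Nonempty) :
    ∃ σ ∈ U, X σ 0 ^ 2 + X σ 1 ^ 2 ≠ 0 := by
  by_contra! hcon
  obtain ⟨σ, hσ⟩ := hne
  have hZ : ∀ Z, N σ ⬝ᵥ Z = 0 → Z 0 = 0 ∧ Z 1 = 0 := by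
    intro Z hZ
    obtain ⟨y, rfl⟩ := hP.exists_tangent σ hσ Z hZ
    have h1 := hasDerivAt_line_component (hP.differentiableAt σ hσ) y
    refine ⟨hP.hasDerivAt_of_forall_eq (f := fun r => X r 0) (c := 0) (fun r hr => ?_) hσ y (h1 0),
      hP.hasDerivAt_of_forall_eq (f := fun r => X r 1) (c := 0) (fun r hr => ?_) hσ y (h1 1)⟩
    · nlinarith [hcon r hr, sq_nonneg (X r 0), sq_nonneg (X r 1)]
    · nlinarith [hcon r hr, sq_nonneg (X r 0), sq_nonneg (X r 1)]
  have h1 := hZ ![N σ 2, 0, -N σ 0] (by simp [dotProduct, Fin.sum_univ_three]; ring)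
  have h3 := hZ ![-N σ 1, N σ 0, 0] (by simp [dotProduct, Fin.sum_univ_three]; ring)
  simp at h1 h3
  have := hP.unit σ hσ
  simp [dotProduct, Fin.sum_univ_three, h1, h3] at this

/-- At a zero of `V` the pitch vanishes and the normal is parallel to the axis, so the flux vanishes
too. -/
theorem screwField_ne_zero (hP : MinimalPatch U X N)
    (hV : ∀ σ ∈ U, fderiv ℝ X σ (χ σ) = screwField a b (X σ))
    {k : ℝ} (hk : ∀ σ ∈ U, N σ 0 * X σ 0 + N σ 1 * X σ 1 = k) (ha : 0 < a)
    (hbk : b ≠ 0 ∨ k ≠ 0) (hσ : σ ∈ U) :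
    screwField a b (X σ) ≠ 0 := by
  intro h0
  obtain ⟨hN0, hN1⟩ := hP.normal_eq_of_screwField_eq_zero hV ha hσ h0
  rcases hbk with hb | hk0
  · exact hb (congrFun h0 2)
  · exact hk0 (by rw [← hk σ hσ, hN0, hN1]; ring)

/-! ### Integration of the Gauss map: explicit parametrisations. -/

section Phase

variable (hP : MinimalPatch U X N)
  (hV : ∀ σ ∈ U, fderiv ℝ X σ (χ σ) = screwField a b (X σ))
  {k : ℝ} (hk : ∀ σ ∈ U, N σ 0 * X σ 0 + N σ 1 * X σ 1 = k)
  (hN2 : ∀ σ ∈ U, N σ 2 ^ 2 < 1)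
include hP hN2

theorem differentiableAt_artanh_normal (hσ : σ ∈ U) :
    DifferentiableAt ℝ (fun r => Real.artanh (N r 2)) σ :=
  DifferentiableAt.comp (g := Real.artanh) σ (Real.hasDerivAt_artanh (hN2 σ hσ)).differentiableAt
    (differentiableAt_pi.1 (hP.differentiableAt_normal σ hσ) 2)

/-- The substitution `ζ = artanh N₂` absorbs the factor `1 - N₂²`, so that `dζ = -βa` can be
combined linearly with the differential of the height. -/
theorem hasDerivAt_artanh_normal (hσ : σ ∈ U) {y : Fin 2 → ℝ} {β : ℝ}
    (h : fderiv ℝ N σ y 2 = -(β * a * (1 - N σ 2 ^ 2))) :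
    HasDerivAt (fun t : ℝ => Real.artanh (N (σ + t • y) 2)) (-(β * a)) 0 := by
  have h1 := hasDerivAt_line_component (hP.differentiableAt_normal σ hσ) y 2
  have h2 : HasDerivAt Real.artanh (1 / (1 - N σ 2 ^ 2)) (N (σ + (0 : ℝ) • y) 2) := by
    simpa using Real.hasDerivAt_artanh (hN2 σ hσ)
  refine (h2.comp 0 h1).congr_deriv ?_
  have : 1 - N σ 2 ^ 2 ≠ 0 := by linarith [hN2 σ hσ]
  rw [h]
  field_simp

include hV hk

/-- The rotated horizontal part of the normal is constant. -/
theorem exists_phase (hc : IsConnected U) (ha : 0 < a) (hb : b ≠ 0) :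
    ∃ p q : ℝ, ∀ σ ∈ U,
      Real.cosh (Real.artanh (N σ 2)) *
        (N σ 0 * Real.cos (a / b * (X σ 2 + k * Real.artanh (N σ 2)))
          + N σ 1 * Real.sin (a / b * (X σ 2 + k * Real.artanh (N σ 2)))) = p ∧
      Real.cosh (Real.artanh (N σ 2)) *
        (N σ 1 * Real.cos (a / b * (X σ 2 + k * Real.artanh (N σ 2)))
          - N σ 0 * Real.sin (a / b * (X σ 2 + k * Real.artanh (N σ 2)))) = q := by
  obtain ⟨σ₀, hσ₀⟩ := hc.nonempty
  refine ⟨_, _, fun σ hσ => ⟨eq_of_hasLineDerivAt_zero (F := fun σ =>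
      Real.cosh (Real.artanh (N σ 2)) *
        (N σ 0 * Real.cos (a / b * (X σ 2 + k * Real.artanh (N σ 2)))
          + N σ 1 * Real.sin (a / b * (X σ 2 + k * Real.artanh (N σ 2)))))
      hP.isOpen hc.isPreconnected
      (fun r hr => ?_) (fun r hr y => ?_) hσ hσ₀, eq_of_hasLineDerivAt_zero (F := fun σ =>
      Real.cosh (Real.artanh (N σ 2)) *
        (N σ 1 * Real.cos (a / b * (X σ 2 + k * Real.artanh (N σ 2)))
          - N σ 0 * Real.sin (a / b * (X σ 2 + k * Real.artanh (N σ 2)))))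
      hP.isOpen hc.isPreconnected
      (fun r hr => ?_) (fun r hr y => ?_) hσ hσ₀⟩⟩
  · have h1 := differentiableAt_pi.1 (hP.differentiableAt r hr)
    have h2 := differentiableAt_pi.1 (hP.differentiableAt_normal r hr)
    have h3 := hP.differentiableAt_artanh_normal hN2 hr
    have h4 := ((h1 2).add (h3.const_mul k)).const_mul (a / b)
    exact h3.cosh.mul (((h2 0).mul h4.cos).add ((h2 1).mul h4.sin))
  · have h1 := hasDerivAt_line_component (hP.differentiableAt r hr) y
    have h2 := hasDerivAt_line_component (hP.differentiableAt_normal r hr) y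
    obtain ⟨α, β, hX, hN⟩ := hP.exists_frame hV hr
      (hP.screwField_ne_zero hV hk ha (Or.inl hb) hr) y
    have h3 := hP.hasDerivAt_artanh_normal (a := a) hN2 hr (y := y) (β := β) (by rw [hN]; rfl)
    have h4 := ((h1 2).add (h3.const_mul k)).const_mul (a / b)
    refine (h3.cosh.mul (((h2 0).mul h4.cos).add ((h2 1).mul h4.sin))).congr_deriv ?_
    -- The height changes by `αb + βak`, so adding `kζ` cancels the `β` term. The phase advances by
    -- `aα`, the rate at which the horizontal normal rotates, and the factor `cosh ζ` keeps that
    -- normal at unit length.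
    have h5 : a / b * (fderiv ℝ X r y 2 + k * -(β * a)) = a * α := by
      rw [hX]
      simp only [Matrix.cons_val, hk r hr]
      field_simp
      ring
    simp only [Pi.add_apply, h5]
    rw [hN]
    simp only [zero_smul, add_zero, Matrix.cons_val, sinh_artanh_eq_mul_cosh (hN2 r hr),
      Pi.mul_apply]
    ring
  · have h1 := differentiableAt_pi.1 (hP.differentiableAt r hr)
    have h2 := differentiableAt_pi.1 (hP.differentiableAt_normal r hr)
    have h3 := hP.differentiableAt_artanh_normal hN2 hr
    have h4 := ((h1 2).add (h3.const_mul k)).const_mul (a / b)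
    exact h3.cosh.mul (((h2 1).mul h4.cos).sub ((h2 0).mul h4.sin))
  · have h1 := hasDerivAt_line_component (hP.differentiableAt r hr) y
    have h2 := hasDerivAt_line_component (hP.differentiableAt_normal r hr) y
    obtain ⟨α, β, hX, hN⟩ := hP.exists_frame hV hr
      (hP.screwField_ne_zero hV hk ha (Or.inl hb) hr) y
    have h3 := hP.hasDerivAt_artanh_normal (a := a) hN2 hr (y := y) (β := β) (by rw [hN]; rfl)
    have h4 := ((h1 2).add (h3.const_mul k)).const_mul (a / b)
    refine (h3.cosh.mul (((h2 1).mul h4.cos).sub ((h2 0).mul h4.sin))).congr_deriv ?_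
    have h5 : a / b * (fderiv ℝ X r y 2 + k * -(β * a)) = a * α := by
      rw [hX]
      simp only [Matrix.cons_val, hk r hr]
      field_simp
      ring
    simp only [Pi.add_apply, h5]
    rw [hN]
    simp only [zero_smul, add_zero, Matrix.cons_val, sinh_artanh_eq_mul_cosh (hN2 r hr),
      Pi.sub_apply,
      Pi.mul_apply]
    ring

/-- Parametrisation of a minimal surface invariant under a screw motion with nonzero pitch. -/
theorem exists_screw_param (hc : IsConnected U) (ha : 0 < a) (hb : b ≠ 0) :
    ∃ w : ℝ, ∀ σ ∈ U, ∃ ζ ψ : ℝ,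
      X σ 0 = k * Real.cosh ζ * Real.cos (ψ + w) - b / a * Real.sinh ζ * Real.sin (ψ + w) ∧
      X σ 1 = k * Real.cosh ζ * Real.sin (ψ + w) + b / a * Real.sinh ζ * Real.cos (ψ + w) ∧
      X σ 2 = b / a * ψ - k * ζ := by
  obtain ⟨p, q, hpq⟩ := hP.exists_phase hV hk hN2 hc ha hb
  have hunit : p ^ 2 + q ^ 2 = 1 := by
    obtain ⟨σ, hσ⟩ := hc.nonempty
    obtain ⟨rfl, rfl⟩ := hpq σ hσ
    have h1 := hP.unit σ hσ
    simp only [dotProduct, Fin.sum_univ_three] at h1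
    have h2 := cosh_sq_artanh_mul (hN2 σ hσ)
    have h3 := Real.sin_sq_add_cos_sq (a / b * (X σ 2 + k * Real.artanh (N σ 2)))
    linear_combination Real.cosh (Real.artanh (N σ 2)) ^ 2 * (N σ 0 ^ 2 + N σ 1 ^ 2) * h3
      + Real.cosh (Real.artanh (N σ 2)) ^ 2 * h1 + h2
  obtain ⟨w, rfl, rfl⟩ := exists_cos_sin_eq hunit
  refine ⟨w, fun σ hσ => ⟨Real.artanh (N σ 2),
    a / b * (X σ 2 + k * Real.artanh (N σ 2)), ?_⟩⟩
  obtain ⟨h1, h2⟩ := hpq σ hσ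
  have hh := cosh_sq_artanh_mul (hN2 σ hσ)
  have hs := sinh_artanh_eq_mul_cosh (hN2 σ hσ)
  have hu := hP.unit σ hσ
  have hk' := hk σ hσ
  have hn := hP.normal_screwField hV hσ
  simp only [dotProduct, Fin.sum_univ_three] at hu
  set ζ := Real.artanh (N σ 2)
  set ψ := a / b * (X σ 2 + k * ζ) with hψ
  have hcs := Real.sin_sq_add_cos_sq ψ
  -- Undoing the rotation by `ψ` expresses the horizontal normal through the constant phase `w`.
  have hc1 : Real.cos (ψ + w) = Real.cosh ζ * N σ 0 := by
    rw [Real.cos_add, ← h1, ← h2]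
    linear_combination Real.cosh ζ * N σ 0 * hcs
  have hc2 : Real.sin (ψ + w) = Real.cosh ζ * N σ 1 := by
    rw [Real.sin_add, ← h1, ← h2]
    linear_combination Real.cosh ζ * N σ 1 * hcs
  have hn' : b / a * N σ 2 = N σ 0 * X σ 1 - N σ 1 * X σ 0 := by
    field_simp
    linarith
  refine ⟨?_, ?_, ?_⟩
  -- The flux and `N · V = 0` form a linear system for the horizontal position, with right-hand
  -- sides `k` and `(b/a) N₂`. Its determinant `N₀² + N₁²` is `1 / cosh² ζ`.
  · rw [hc1, hc2, hs]
    linear_combination -(X σ 0) * hh + Real.cosh ζ ^ 2 * N σ 1 * hn'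
      + Real.cosh ζ ^ 2 * N σ 0 * hk' - Real.cosh ζ ^ 2 * X σ 0 * hu
  · rw [hc1, hc2, hs]
    linear_combination -(X σ 1) * hh - Real.cosh ζ ^ 2 * N σ 0 * hn'
      + Real.cosh ζ ^ 2 * N σ 1 * hk' - Real.cosh ζ ^ 2 * X σ 1 * hu
  · rw [hψ]
    field_simp
    ring

end Phase

/-- Parametrisation of a minimal surface invariant under rotations. -/
theorem exists_rotation_param (hP : MinimalPatch U X N)
    (hV : ∀ σ ∈ U, fderiv ℝ X σ (χ σ) = screwField a 0 (X σ))
    {k : ℝ} (hk : ∀ σ ∈ U, N σ 0 * X σ 0 + N σ 1 * X σ 1 = k)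
    (hN2 : ∀ σ ∈ U, N σ 2 ^ 2 < 1) (hc : IsConnected U) (ha : 0 < a) (hk0 : k ≠ 0) :
    ∃ z : ℝ, ∀ σ ∈ U, ∃ ζ ψ : ℝ,
      X σ 0 = k * Real.cosh ζ * Real.cos ψ ∧ X σ 1 = k * Real.cosh ζ * Real.sin ψ ∧
      X σ 2 = z - k * ζ := by
  obtain ⟨σ₀, hσ₀⟩ := hc.nonempty
  refine ⟨X σ₀ 2 + k * Real.artanh (N σ₀ 2), fun σ hσ => ?_⟩
  -- Without pitch, `X₂ + kζ` itself is constant, and the angle of the horizontal normal may be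
  -- chosen separately at each point.
  have hz : X σ 2 + k * Real.artanh (N σ 2) = X σ₀ 2 + k * Real.artanh (N σ₀ 2) := by
    refine eq_of_hasLineDerivAt_zero (F := fun σ => X σ 2 + k * Real.artanh (N σ 2)) hP.isOpen
      hc.isPreconnected (fun r hr => ?_) (fun r hr y => ?_) hσ hσ₀
    · exact (differentiableAt_pi.1 (hP.differentiableAt r hr) 2).add
        ((hP.differentiableAt_artanh_normal hN2 hr).const_mul k)
    · have h1 := hasDerivAt_line_component (hP.differentiableAt r hr) y
      obtain ⟨α, β, hX, hN⟩ := hP.exists_frame hV hr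
        (hP.screwField_ne_zero hV hk ha (Or.inr hk0) hr) y
      have h3 := hP.hasDerivAt_artanh_normal (a := a) hN2 hr (y := y) (β := β) (by rw [hN]; rfl)
      refine ((h1 2).add (h3.const_mul k)).congr_deriv ?_
      rw [hX]
      simp only [Matrix.cons_val, hk r hr]
      ring
  have hh := cosh_sq_artanh_mul (hN2 σ hσ)
  have hu := hP.unit σ hσ
  have hk' := hk σ hσ
  have hn := hP.normal_screwField hV hσ
  rw [zero_mul, add_zero, mul_eq_zero] at hn
  have hn' := hn.resolve_left ha.ne'
  simp only [dotProduct, Fin.sum_univ_three] at hu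
  set ζ := Real.artanh (N σ 2)
  obtain ⟨ψ, hc1, hc2⟩ := exists_cos_sin_eq (u := Real.cosh ζ * N σ 0) (v := Real.cosh ζ * N σ 1)
    (by linear_combination hh + Real.cosh ζ ^ 2 * hu)
  refine ⟨ζ, ψ, ?_, ?_, by linarith⟩
  · rw [← hc1]
    linear_combination -(X σ 0) * hh + Real.cosh ζ ^ 2 * N σ 1 * hn'
      + Real.cosh ζ ^ 2 * N σ 0 * hk' - Real.cosh ζ ^ 2 * X σ 0 * hu
  · rw [← hc2]
    linear_combination -(X σ 1) * hh - Real.cosh ζ ^ 2 * N σ 0 * hn'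
      + Real.cosh ζ ^ 2 * N σ 1 * hk' - Real.cosh ζ ^ 2 * X σ 1 * hu

end MinimalPatch

/-! ### Classification in coordinates adapted to the screw axis. -/

/-- The rotation about the third axis followed by the translation along it. -/
noncomputable def axisMotion (w z : ℝ) (x : Fin 3 → ℝ) : Fin 3 → ℝ :=
  ![Real.cos w * x 0 - Real.sin w * x 1, Real.sin w * x 0 + Real.cos w * x 1, x 2 + z]

namespace MinimalPatch

variable {U : Set (Fin 2 → ℝ)} {X N : (Fin 2 → ℝ) → (Fin 3 → ℝ)}
variable {a b : ℝ} {χ : (Fin 2 → ℝ) → (Fin 2 → ℝ)} {σ : Fin 2 → ℝ}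

/-- Reversing the normal changes the sign of the flux, so `k ≥ 0` may be assumed. -/
theorem neg_normal (hP : MinimalPatch U X N) : MinimalPatch U X (fun σ => -N σ) where
  isOpen := hP.isOpen
  differentiableAt := hP.differentiableAt
  differentiableAt_normal σ hσ := (hP.differentiableAt_normal σ hσ).fun_neg
  unit σ hσ := by simpa using hP.unit σ hσ
  normal σ hσ y := by simpa using hP.normal σ hσ y
  exists_tangent σ hσ Z hZ := hP.exists_tangent σ hσ Z (by simpa using hZ)
  symm σ hσ y z := by simpa [fderiv_fun_neg] using hP.symm σ hσ y z
  trace σ hσ y z h1 h2 := by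
    have := hP.trace σ hσ y z h1 h2
    simp only [fderiv_fun_neg, _root_.neg_apply, neg_dotProduct]
    linarith

/-- An axial normal makes the flux vanish and, by `N · V = 0`, the pitch as well. The bound is what
makes `artanh N₂` available. -/
theorem normal_sq_lt_one (hP : MinimalPatch U X N)
    (hV : ∀ σ ∈ U, fderiv ℝ X σ (χ σ) = screwField a b (X σ))
    {k : ℝ} (hk : ∀ σ ∈ U, N σ 0 * X σ 0 + N σ 1 * X σ 1 = k) (hbk : b ≠ 0 ∨ k ≠ 0)
    (hσ : σ ∈ U) : N σ 2 ^ 2 < 1 := by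
  by_contra! h
  have hu := hP.unit σ hσ
  simp only [dotProduct, Fin.sum_univ_three] at hu
  have h0 : N σ 0 = 0 := by nlinarith [sq_nonneg (N σ 0), sq_nonneg (N σ 1)]
  have h1 : N σ 1 = 0 := by nlinarith [sq_nonneg (N σ 0), sq_nonneg (N σ 1)]
  rcases hbk with hb | hk0
  · have h2 := hP.normal_screwField hV hσ
    rw [h0, h1] at h2
    have h3 : N σ 2 = 0 := (mul_eq_zero.1 (by linarith : b * N σ 2 = 0)).resolve_left hb
    rw [h3] at h
    norm_num at h
  · exact hk0 (by rw [← hk σ hσ, h0, h1]; ring)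

/-- Off the axis, zero flux and `N · V = 0` make the horizontal part of `N` orthogonal to the radial
and to the angular direction. On the axis `V` vanishes and the normal is axial anyway. -/
theorem horizontal_of_flux_eq_zero (hP : MinimalPatch U X N)
    (hV : ∀ σ ∈ U, fderiv ℝ X σ (χ σ) = screwField a 0 (X σ)) (ha : 0 < a)
    (hk : ∀ σ ∈ U, N σ 0 * X σ 0 + N σ 1 * X σ 1 = 0) (hσ : σ ∈ U) (y : Fin 2 → ℝ) :
    fderiv ℝ X σ y 2 = 0 := by
  have h : N σ 0 = 0 ∧ N σ 1 = 0 := by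
    by_cases h0 : screwField a 0 (X σ) = 0
    · exact hP.normal_eq_of_screwField_eq_zero hV ha hσ h0
    · have hr : X σ 0 ^ 2 + X σ 1 ^ 2 ≠ 0 := by
        intro hr
        have h0' : X σ 0 = 0 := by nlinarith [sq_nonneg (X σ 0), sq_nonneg (X σ 1)]
        have h1' : X σ 1 = 0 := by nlinarith [sq_nonneg (X σ 0), sq_nonneg (X σ 1)]
        apply h0
        ext i
        fin_cases i <;> simp [screwField, h0', h1']
      have hn := hP.normal_screwField hV hσ
      rw [zero_mul, add_zero, mul_eq_zero] at hn
      have hn' := hn.resolve_left ha.ne'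
      exact eq_zero_of_rotated_eq_zero hr (hk σ hσ) hn'
  have h1 := hP.unit σ hσ
  have h2 := hP.normal σ hσ y
  simp only [dotProduct, Fin.sum_univ_three, h.1, h.2, zero_mul, zero_add] at h1 h2
  refine (mul_eq_zero.1 h2).resolve_left fun h3 => ?_
  simp [h3] at h1

/-- A tangent vector along which the height grows at the rate given by the flux. -/
theorem exists_meridian (hP : MinimalPatch U X N)
    (hV : ∀ σ ∈ U, fderiv ℝ X σ (χ σ) = screwField a 0 (X σ)) (ha : 0 < a)
    {k : ℝ} (hk : ∀ σ ∈ U, N σ 0 * X σ 0 + N σ 1 * X σ 1 = k) (hk0 : k ≠ 0) (hσ : σ ∈ U) :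
    ∃ y, fderiv ℝ X σ y 2 = a * k ∧ fderiv ℝ N σ y 2 = -(a * (1 - N σ 2 ^ 2)) := by
  obtain ⟨y, hy⟩ := hP.exists_tangent σ hσ (crossProduct (N σ) (screwField a 0 (X σ)))
    (dot_self_cross _ _)
  obtain ⟨α, β, hX, hN⟩ := hP.exists_frame hV hσ
    (hP.screwField_ne_zero hV hk ha (Or.inr hk0) hσ) y
  have h2 : fderiv ℝ X σ y 2 = a * k := by
    rw [hy, ← hk σ hσ]
    simp [cross_apply, screwField]
    ring
  refine ⟨y, h2, ?_⟩
  rw [hX] at h2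
  simp only [Matrix.cons_val, hk σ hσ] at h2
  have hβ : β = 1 := by
    have : (a * k) * (β - 1) = 0 := by linear_combination h2
    have := (mul_eq_zero.1 this).resolve_left (mul_ne_zero ha.ne' hk0)
    linarith
  rw [hN, hβ]
  simp

/-- A quadratic potential whose gradient is tangent to a catenoid is constant. -/
theorem potential_eq_zero (hP : MinimalPatch U X N)
    (hV : ∀ σ ∈ U, fderiv ℝ X σ (χ σ) = screwField a 0 (X σ)) (ha : 0 < a)
    {k : ℝ} (hk : ∀ σ ∈ U, N σ 0 * X σ 0 + N σ 1 * X σ 1 = k) (hk0 : k ≠ 0) (hne : U.Nonempty)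
    {p c d : ℝ} (h : ∀ σ ∈ U, p * k + N σ 2 * (c * X σ 2 + d) = 0) :
    p = 0 ∧ c = 0 ∧ d = 0 := by
  -- Derivative along the meridian, where `X₂' = ak` and `N₂' = -a(1 - N₂²)`, divided by `-a`. The
  -- next identity is the derivative of this one, divided by `2a(1 - N₂²)`.
  have h1 : ∀ σ ∈ U, (1 - N σ 2 ^ 2) * (c * X σ 2 + d) - N σ 2 * (c * k) = 0 := by
    intro σ hσ
    obtain ⟨y, hX, hN⟩ := hP.exists_meridian hV ha hk hk0 hσ
    have h2 := hasDerivAt_line_component (hP.differentiableAt σ hσ) y 2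
    have h3 := hasDerivAt_line_component (hP.differentiableAt_normal σ hσ) y 2
    have h4 := hP.hasDerivAt_of_forall_eq h hσ y
      ((h3.mul ((h2.const_mul c).add_const d)).const_add (p * k))
    rw [hX, hN] at h4
    simp only [zero_smul, add_zero] at h4
    exact mul_left_cancel₀ ha.ne' (by linear_combination -h4)
  have h5 : ∀ σ ∈ U, N σ 2 * (c * X σ 2 + d) + c * k = 0 := by
    intro σ hσ
    obtain ⟨y, hX, hN⟩ := hP.exists_meridian hV ha hk hk0 hσ
    have h2 := hasDerivAt_line_component (hP.differentiableAt σ hσ) y 2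
    have h3 := hasDerivAt_line_component (hP.differentiableAt_normal σ hσ) y 2
    have h4 := hP.hasDerivAt_of_forall_eq h1 hσ y
      ((((h3.pow 2).const_sub 1).mul ((h2.const_mul c).add_const d)).sub (h3.mul_const (c * k)))
    rw [hX, hN] at h4
    simp only [zero_smul, add_zero, Pi.pow_apply] at h4
    have hlt := hP.normal_sq_lt_one hV hk (Or.inr hk0) hσ
    have h6 : (2 * a * (1 - N σ 2 ^ 2)) ≠ 0 := by
      have : 0 < 1 - N σ 2 ^ 2 := by linarith
      positivity
    exact mul_left_cancel₀ h6 (by linear_combination h4)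
  -- The two derivatives combine so that the terms with `ck` cancel and `N₂² + (1 - N₂²) = 1`
  -- multiplies `cX₂ + d`.
  have h6 : ∀ σ ∈ U, c * X σ 2 + d = 0 := fun σ hσ => by
    linear_combination h1 σ hσ + N σ 2 * h5 σ hσ
  obtain ⟨σ, hσ⟩ := hne
  have hc : c = 0 := by
    have := h5 σ hσ
    rw [h6 σ hσ, mul_zero, zero_add] at this
    exact (mul_eq_zero.1 this).resolve_right hk0
  refine ⟨?_, hc, ?_⟩
  · have := h σ hσ
    rw [h6 σ hσ, mul_zero, add_zero] at this
    exact (mul_eq_zero.1 this).resolve_right hk0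
  · have := h6 σ hσ
    rw [hc] at this
    linarith

/-- The quadric through a surface of revolution which is not a plane. -/
theorem screwQuadric_eq_zero_of_rotation (hP : MinimalPatch U X N)
    (hV : ∀ σ ∈ U, fderiv ℝ X σ (χ σ) = screwField a 0 (X σ)) (ha : 0 < a)
    {k : ℝ} (hk : ∀ σ ∈ U, N σ 0 * X σ 0 + N σ 1 * X σ 1 = k) (hk0 : k ≠ 0) (hne : U.Nonempty)
    {α β γ δ ε ζ : ℝ} (h : ∀ σ ∈ U, screwQuadric α β γ δ ε ζ 0 0 (X σ) = 0) :
    α = 0 ∧ β = 0 ∧ γ = 0 ∧ δ = 0 ∧ ε = 0 ∧ ζ = 0 := by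
  have hr : ∀ σ ∈ U, X σ 0 ^ 2 + X σ 1 ^ 2 ≠ 0 := by
    intro σ hσ hr
    have h0' : X σ 0 = 0 := by nlinarith [sq_nonneg (X σ 0), sq_nonneg (X σ 1)]
    have h1' : X σ 1 = 0 := by nlinarith [sq_nonneg (X σ 0), sq_nonneg (X σ 1)]
    exact hk0 (by rw [← hk σ hσ, h0', h1']; ring)
  obtain ⟨σ, hσ⟩ := hne
  obtain ⟨h1, h2⟩ := hP.screwQuadric_second_harmonic hV ha (α := -3 * a ^ 2 * α)
    (β := -3 * a ^ 2 * β) (fun σ hσ => by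
      have := hP.screwQuadric_annihilate hV h hσ
      simp only [screwQuadric] at this ⊢
      linear_combination this) hσ (hr σ hσ)
  have hα : α = 0 := (mul_eq_zero.1 h1).resolve_left (by positivity)
  have hβ : β = 0 := (mul_eq_zero.1 h2).resolve_left (by positivity)
  subst hα hβ
  have h3 : ∀ σ ∈ U, γ * X σ 2 + ε = 0 ∧ δ * X σ 2 + ζ = 0 := by
    intro σ hσ
    have h4 := h σ hσ
    have h5 := hP.screwQuadric_derivative hV h hσ
    simp only [screwQuadric] at h4 h5
    exact eq_zero_of_rotated_eq_zero (hr σ hσ) (by linear_combination h4)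
      (mul_left_cancel₀ ha.ne' (by linear_combination h5))
  -- The height varies along the meridian, so an affine function of it that vanishes on the surface
  -- is zero.
  obtain ⟨y, hX, -⟩ := hP.exists_meridian hV ha hk hk0 hσ
  have h2 := hasDerivAt_line_component (hP.differentiableAt σ hσ) y 2
  have hγ := hP.hasDerivAt_of_forall_eq (fun r hr => (h3 r hr).1) hσ y
    ((h2.const_mul γ).add_const ε)
  have hδ := hP.hasDerivAt_of_forall_eq (fun r hr => (h3 r hr).2) hσ y
    ((h2.const_mul δ).add_const ζ)
  rw [hX] at hγ hδ
  have hγ0 := (mul_eq_zero.1 hγ).resolve_right (mul_ne_zero ha.ne' hk0)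
  have hδ0 := (mul_eq_zero.1 hδ).resolve_right (mul_ne_zero ha.ne' hk0)
  obtain ⟨h4, h5⟩ := h3 σ hσ
  subst hγ0 hδ0
  exact ⟨rfl, rfl, rfl, rfl, by linarith, by linarith⟩

theorem symm_eq_diagonal {B : Matrix (Fin 3) (Fin 3) ℝ} (hB : Bᵀ = B) {κ : ℝ} (h01 : B 0 1 = 0)
    (h02 : B 0 2 = 0) (h12 : B 1 2 = 0) (h00 : B 0 0 = κ) (h11 : B 1 1 = κ) (h22 : B 2 2 = 0) :
    B = Matrix.diagonal ![κ, κ, 0] := by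
  have hs : ∀ i j, B i j = B j i := fun i j => congrFun (congrFun hB j) i
  ext i j
  fin_cases i <;> fin_cases j <;> simp [h01, h02, h12, h00, h11, h22, hs 1 0, hs 2 0, hs 2 1]

/-- Classification of the minimal surfaces which are invariant under a screw motion and solve the
extrinsic equation, in adapted coordinates. -/
theorem classification_aux (hP : MinimalPatch U X N) (hc : IsConnected U)
    (hV : ∀ σ ∈ U, fderiv ℝ X σ (χ σ) = screwField a b (X σ)) (ha : 0 < a) (hb : 0 ≤ b)
    {k : ℝ} (hk : ∀ σ ∈ U, N σ 0 * X σ 0 + N σ 1 * X σ 1 = k) (hk0 : 0 ≤ k)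
    {B : Matrix (Fin 3) (Fin 3) ℝ} (hB : Bᵀ = B) {w : Fin 3 → ℝ} {Ω : ℝ}
    (h1 : ∀ σ ∈ U, (B *ᵥ X σ + w) ⬝ᵥ screwField a b (X σ) = 0)
    (h2 : ∀ σ ∈ U, N σ ⬝ᵥ (B *ᵥ X σ + w
      + Ω ^ 2 • screwField a 0 (screwField a b (X σ))) = 0) :
    (∀ σ ∈ U, ∀ y, fderiv ℝ X σ y 2 = 0) ∨ (w = 0 ∧ ∃ φ z : ℝ,
      (0 < b ∧ (∃ κ, B = Matrix.diagonal ![κ, κ, 0]) ∧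
        ∀ σ ∈ U, ∃ σ', X σ = axisMotion φ z (helicoid a b σ')) ∨
      (b = 0 ∧ B = Matrix.diagonal ![a ^ 2 * Ω ^ 2, a ^ 2 * Ω ^ 2, 0] ∧ ∃ c, 0 < c ∧
        ∀ σ ∈ U, ∃ σ', X σ = axisMotion φ z (catenoid a c σ')) ∨
      (B = Matrix.diagonal ![a ^ 2 * Ω ^ 2, a ^ 2 * Ω ^ 2, 0] ∧ ∃ c l, 0 < c ∧ 0 < l ∧ l < 1 ∧
        b = l * a * c ∧ ∀ σ ∈ U, ∃ σ', X σ = axisMotion φ z (scherk a c l σ'))) := by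
  have hs : ∀ i j, B i j = B j i := fun i j => congrFun (congrFun hB j) i
  -- Constancy of the profile along the flow, as a quadric. The coefficients of `B 2 2` and `w 2`
  -- carry the factor `b`, so for `b = 0` nothing is learned about them here.
  have hq : ∀ σ ∈ U, screwQuadric (a * B 0 1) (a * (B 1 1 - B 0 0)) (a * B 1 2) (-a * B 0 2)
      (a * w 1 + b * B 0 2) (-a * w 0 + b * B 1 2) (b * B 2 2) (b * w 2) (X σ) = 0 := by
    intro σ hσ
    have := h1 σ hσ
    simp [dotProduct, Fin.sum_univ_three, Matrix.mulVec, screwField, hs 1 0, hs 2 0, hs 2 1] at this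
    simp only [screwQuadric]
    linear_combination this
  -- Applying the linear part to `V` gives `-a²` times the horizontal position, so the acceleration
  -- term is `-a²Ω²k`.
  have h2' : ∀ σ ∈ U, N σ 0 * (B 0 0 * X σ 0 + B 0 1 * X σ 1 + B 0 2 * X σ 2 + w 0)
      + N σ 1 * (B 0 1 * X σ 0 + B 1 1 * X σ 1 + B 1 2 * X σ 2 + w 1)
      + N σ 2 * (B 0 2 * X σ 0 + B 1 2 * X σ 1 + B 2 2 * X σ 2 + w 2)
      - a ^ 2 * Ω ^ 2 * k = 0 := by
    intro σ hσ
    have := h2 σ hσ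
    simp [dotProduct, Fin.sum_univ_three, Matrix.mulVec, screwField, hs 1 0, hs 2 0, hs 2 1] at this
    rw [← hk σ hσ]
    linear_combination this
  have ha' := ha.ne'
  rcases hb.eq_or_lt with rfl | hb'
  · rcases hk0.eq_or_lt with rfl | hk'
    · exact Or.inl fun σ hσ y => hP.horizontal_of_flux_eq_zero hV ha hk hσ y
    · right
      obtain ⟨e1, e2, e3, e4, e5, e6⟩ := hP.screwQuadric_eq_zero_of_rotation hV ha hk hk'.ne'
        hc.nonempty (α := a * B 0 1) (β := a * (B 1 1 - B 0 0)) (γ := a * B 1 2)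
        (δ := -a * B 0 2) (ε := a * w 1) (ζ := -a * w 0) (fun σ hσ => by
          have := hq σ hσ
          simp only [screwQuadric] at this ⊢
          linear_combination this)
      have f1 : B 0 1 = 0 := (mul_eq_zero.1 e1).resolve_left ha'
      have f2 : B 1 1 - B 0 0 = 0 := (mul_eq_zero.1 e2).resolve_left ha'
      have f3 : B 1 2 = 0 := (mul_eq_zero.1 e3).resolve_left ha'
      have f4 : B 0 2 = 0 := (mul_eq_zero.1 e4).resolve_left (neg_ne_zero.2 ha')
      have f5 : w 1 = 0 := (mul_eq_zero.1 e5).resolve_left ha'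
      have f6 : w 0 = 0 := (mul_eq_zero.1 e6).resolve_left (neg_ne_zero.2 ha')
      -- Without pitch the remaining entries come from the extrinsic equation, which by now reads
      -- `(B₀₀ - a²Ω²) k + N₂ (B₂₂ X₂ + w₂) = 0`.
      obtain ⟨g1, g2, g3⟩ := hP.potential_eq_zero hV ha hk hk'.ne' hc.nonempty
        (p := B 0 0 - a ^ 2 * Ω ^ 2) (c := B 2 2) (d := w 2) (fun σ hσ => by
          have h3 := h2' σ hσ
          rw [f1, f3, f4, f5, f6] at h3
          linear_combination h3 - B 0 0 * hk σ hσ - N σ 1 * X σ 1 * f2)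
      refine ⟨?_, ?_⟩
      · ext i
        fin_cases i
        · exact f6
        · exact f5
        · exact g3
      · obtain ⟨z, hz⟩ := hP.exists_rotation_param hV hk
          (fun σ hσ => hP.normal_sq_lt_one hV hk (Or.inr hk'.ne') hσ) hc ha hk'.ne'
        refine ⟨0, z, Or.inr (Or.inl ⟨rfl, symm_eq_diagonal hB f1 f4 f3 (by linarith)
          (by linarith) g2, k, hk', fun σ hσ => ?_⟩)⟩
        obtain ⟨ζ, ψ, x0, x1, x2⟩ := hz σ hσ
        refine ⟨![-(k * ζ), ψ / a], ?_⟩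
        have h3 : -(k * ζ) / k = -ζ := by field_simp
        have h4 : a * (ψ / a) = ψ := by field_simp
        ext i
        fin_cases i <;> simp [axisMotion, catenoid, h3, h4, x0, x1, x2]
        ring
  · right
    obtain ⟨σ₁, hσ₁, hr⟩ := hP.exists_radius_ne_zero hc.nonempty
    obtain ⟨e1, e2, e3, e4, e5, e6, e7, e8⟩ :=
      hP.screwQuadric_eq_zero hV ha hb'.ne' hq hσ₁ hr
    have f1 : B 0 1 = 0 := (mul_eq_zero.1 e1).resolve_left ha'
    have f2 : B 1 1 - B 0 0 = 0 := (mul_eq_zero.1 e2).resolve_left ha'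
    have f3 : B 1 2 = 0 := (mul_eq_zero.1 e3).resolve_left ha'
    have f4 : B 0 2 = 0 := (mul_eq_zero.1 e4).resolve_left (neg_ne_zero.2 ha')
    rw [f4, mul_zero, add_zero] at e5
    rw [f3, mul_zero, add_zero] at e6
    have f5 : w 1 = 0 := (mul_eq_zero.1 e5).resolve_left ha'
    have f6 : w 0 = 0 := (mul_eq_zero.1 e6).resolve_left (neg_ne_zero.2 ha')
    have f7 : B 2 2 = 0 := (mul_eq_zero.1 e7).resolve_left hb'.ne'
    have f8 : w 2 = 0 := (mul_eq_zero.1 e8).resolve_left hb'.ne'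
    refine ⟨?_, ?_⟩
    · ext i
      fin_cases i
      · exact f6
      · exact f5
      · exact f8
    · obtain ⟨φ, hφ⟩ := hP.exists_screw_param hV hk
        (fun σ hσ => hP.normal_sq_lt_one hV hk (Or.inl hb'.ne') hσ) hc ha hb'.ne'
      rcases hk0.eq_or_lt with rfl | hk'
      -- For `k = 0` the horizontal position is `(b/a) sinh ζ` times the quarter turn of the
      -- direction at angle `ψ + φ`; this accounts for `π/2`.
      · refine ⟨φ + Real.pi / 2, 0, Or.inl ⟨hb', ⟨B 0 0, symm_eq_diagonal hB f1 f4 f3 rfl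
          (by linarith) f7⟩, fun σ hσ => ?_⟩⟩
        obtain ⟨ζ, ψ, x0, x1, x2⟩ := hφ σ hσ
        refine ⟨![b / a * Real.sinh ζ, ψ / a], ?_⟩
        have h4 : a * (ψ / a) = ψ := by field_simp
        ext i
        fin_cases i <;> simp [axisMotion, helicoid, h4, x0, x1, x2, Real.cos_add, Real.sin_add] <;>
          ring
      -- The parameters are read off from `l c = b/a` and `√(1 - l²) c = k`; in particular the pitch
      -- is `b = l a c`.
      · set c := √(k ^ 2 + (b / a) ^ 2) with hcdef
        have hba : 0 < b / a := by positivity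
        have hc2 : c ^ 2 = k ^ 2 + (b / a) ^ 2 := Real.sq_sqrt (by positivity)
        have hc0 : 0 < c := Real.sqrt_pos.2 (by positivity)
        have hlt : b / a < c := by
          refine lt_of_pow_lt_pow_left₀ 2 hc0.le ?_
          rw [hc2]
          nlinarith
        have hm : √(1 - (b / a / c) ^ 2) = k / c := by
          rw [show 1 - (b / a / c) ^ 2 = (k / c) ^ 2 by
            rw [div_pow, div_pow _ c, eq_div_iff (by positivity), sub_mul,
              div_mul_cancel₀ _ (by positivity)]
            linarith]
          exact Real.sqrt_sq (by positivity)
        obtain ⟨σ, hσ⟩ := hc.nonempty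
        have h3 := h2' σ hσ
        rw [f1, f3, f4, f5, f6, f7, f8] at h3
        -- All that remains of the extrinsic equation. One point suffices, since everything in it is
        -- constant.
        have h5 : (B 0 0 - a ^ 2 * Ω ^ 2) * k = 0 := by
          linear_combination h3 - B 0 0 * hk σ hσ - N σ 1 * X σ 1 * f2
        have h6 := (mul_eq_zero.1 h5).resolve_right hk'.ne'
        refine ⟨φ, 0, Or.inr (Or.inr ⟨symm_eq_diagonal hB f1 f4 f3 (by linarith)
          (by linarith) f7, c, b / a / c, hc0, by positivity, (div_lt_one hc0).2 hlt,
          by field_simp, fun σ hσ => ?_⟩)⟩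
        obtain ⟨ζ, ψ, x0, x1, x2⟩ := hφ σ hσ
        refine ⟨![-(c * ζ), ψ / a], ?_⟩
        have h4 : a * (ψ / a) = ψ := by field_simp
        have h7 : -(c * ζ) / c = -ζ := by field_simp
        have h8 : b / a / c * (c * Real.sinh ζ) = b / a * Real.sinh ζ := by field_simp
        have h9 : k / c * (c * Real.cosh ζ) = k * Real.cosh ζ := by field_simp
        ext i
        fin_cases i
        · simp [axisMotion, scherk, h4, h7, hm, h8, h9, x0, Real.cos_add, Real.sin_add]
          ring
        · simp [axisMotion, scherk, h4, h7, hm, h8, h9, x1, Real.cos_add, Real.sin_add]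
          ring
        · simp [axisMotion, scherk, hm, x2]
          field_simp
          ring

end MinimalPatch

/-! ### Euclidean motions -/

theorem orthogonal_transpose_mul {Q : Matrix (Fin 3) (Fin 3) ℝ}
    (hQ : Q ∈ Matrix.orthogonalGroup (Fin 3) ℝ) : Qᵀ * Q = 1 :=
  (Matrix.mem_orthogonalGroup_iff' (Fin 3) ℝ).1 hQ

theorem orthogonal_mul_transpose {Q : Matrix (Fin 3) (Fin 3) ℝ}
    (hQ : Q ∈ Matrix.orthogonalGroup (Fin 3) ℝ) : Q * Qᵀ = 1 :=
  mul_eq_one_comm.1 (orthogonal_transpose_mul hQ)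

theorem dotProduct_transpose_mulVec {Q : Matrix (Fin 3) (Fin 3) ℝ}
    (hQ : Q ∈ Matrix.orthogonalGroup (Fin 3) ℝ) (x y : Fin 3 → ℝ) :
    (Qᵀ *ᵥ x) ⬝ᵥ (Qᵀ *ᵥ y) = x ⬝ᵥ y := by
  rw [Matrix.dotProduct_mulVec, Matrix.vecMul_transpose, Matrix.mulVec_mulVec,
    orthogonal_mul_transpose hQ, Matrix.one_mulVec]

theorem hasFDerivAt_mulVec_sub {Q : Matrix (Fin 3) (Fin 3) ℝ} {v : Fin 3 → ℝ}
    {X : (Fin 2 → ℝ) → (Fin 3 → ℝ)} {σ : Fin 2 → ℝ} (hX : DifferentiableAt ℝ X σ) :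
    DifferentiableAt ℝ (fun r => Q *ᵥ (X r - v)) σ ∧
      ∀ y, fderiv ℝ (fun r => Q *ᵥ (X r - v)) σ y = Q *ᵥ fderiv ℝ X σ y := by
  have h : HasFDerivAt (fun r => Q *ᵥ (X r - v))
      ((LinearMap.toContinuousLinearMap Q.mulVecLin).comp (fderiv ℝ X σ)) σ :=
    (LinearMap.toContinuousLinearMap Q.mulVecLin).hasFDerivAt.comp σ (hX.hasFDerivAt.sub_const v)
  exact ⟨h.differentiableAt, fun y => by rw [h.fderiv]; rfl⟩

/-- All the conditions are expressed by inner products, so they survive any orthogonal `Q`,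
orientation reversing or not. The `- 0` allows `hasFDerivAt_mulVec_sub` to serve for the normal as
well. -/
theorem MinimalPatch.motion {U : Set (Fin 2 → ℝ)} {X N : (Fin 2 → ℝ) → (Fin 3 → ℝ)}
    (hP : MinimalPatch U X N) {Q : Matrix (Fin 3) (Fin 3) ℝ}
    (hQ : Q ∈ Matrix.orthogonalGroup (Fin 3) ℝ) (v : Fin 3 → ℝ) :
    MinimalPatch U (fun σ => Qᵀ *ᵥ (X σ - v)) (fun σ => Qᵀ *ᵥ (N σ - 0)) := by
  have hX := fun σ (hσ : σ ∈ U) =>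
    (hasFDerivAt_mulVec_sub (Q := Qᵀ) (v := v) (hP.differentiableAt σ hσ)).2
  have hN := fun σ (hσ : σ ∈ U) =>
    (hasFDerivAt_mulVec_sub (Q := Qᵀ) (v := 0) (hP.differentiableAt_normal σ hσ)).2
  have hd := dotProduct_transpose_mulVec hQ
  refine ⟨hP.isOpen, fun σ hσ => (hasFDerivAt_mulVec_sub (hP.differentiableAt σ hσ)).1,
    fun σ hσ => (hasFDerivAt_mulVec_sub (hP.differentiableAt_normal σ hσ)).1, fun σ hσ => ?_,
    fun σ hσ y => ?_, fun σ hσ Z hZ => ?_, fun σ hσ y z => ?_, fun σ hσ y z h1 h2 => ?_⟩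
  · rw [sub_zero, hd, hP.unit σ hσ]
  · rw [hX σ hσ, sub_zero, hd, hP.normal σ hσ]
  · have hZ' : Z = Qᵀ *ᵥ (Q *ᵥ Z) := by
      rw [Matrix.mulVec_mulVec, orthogonal_transpose_mul hQ, Matrix.one_mulVec]
    rw [hZ', sub_zero, hd] at hZ
    obtain ⟨y, hy⟩ := hP.exists_tangent σ hσ _ hZ
    exact ⟨y, by rw [hX σ hσ, hy, ← hZ']⟩
  · rw [hX σ hσ, hX σ hσ, hN σ hσ, hN σ hσ, hd, hd, hP.symm σ hσ]
  · rw [hX σ hσ, hX σ hσ, hd, hd] at h1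
    rw [hX σ hσ, hX σ hσ, hd] at h2
    rw [hX σ hσ, hX σ hσ, hN σ hσ, hN σ hσ, hd, hd, hP.trace σ hσ y z h1 h2]

/-- `m ×` kills the direction of `m` and sends `e` to `m × e`, and `m × e` to a negative multiple of
`e`: the rotational part of a screw field in this frame. -/
theorem cross_eq_of_frame {e m : Fin 3 → ℝ} (he : e ⬝ᵥ e = 1) (hem : e ⬝ᵥ m = 0)
    (y : Fin 3 → ℝ) :
    crossProduct m y = (e ⬝ᵥ y) • crossProduct m e - (crossProduct m e ⬝ᵥ y) • e := by
  simp only [dotProduct, Fin.sum_univ_three] at he hem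
  ext i
  fin_cases i <;> simp [cross_apply, dotProduct, Fin.sum_univ_three]
  · linear_combination -(m 1 * y 2 - m 2 * y 1) * he + (e 1 * y 2 - e 2 * y 1) * hem
  · linear_combination -(m 2 * y 0 - m 0 * y 2) * he + (e 2 * y 0 - e 0 * y 2) * hem
  · linear_combination -(m 0 * y 1 - m 1 * y 0) * he + (e 0 * y 1 - e 1 * y 0) * hem

theorem exists_unit_orthogonal (m : Fin 3 → ℝ) : ∃ e : Fin 3 → ℝ, e ⬝ᵥ e = 1 ∧ e ⬝ᵥ m = 0 := by
  by_cases h : m 0 ^ 2 + m 1 ^ 2 = 0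
  · have h0 : m 0 = 0 := by nlinarith [sq_nonneg (m 0), sq_nonneg (m 1)]
    exact ⟨![1, 0, 0], by simp [dotProduct, Fin.sum_univ_three],
      by simp [dotProduct, Fin.sum_univ_three, h0]⟩
  · have hp : 0 < m 0 ^ 2 + m 1 ^ 2 := lt_of_le_of_ne (by positivity) (Ne.symm h)
    have hs := Real.sq_sqrt hp.le
    have hs0 := (Real.sqrt_pos.2 hp).ne'
    refine ⟨![-m 1 / √(m 0 ^ 2 + m 1 ^ 2), m 0 / √(m 0 ^ 2 + m 1 ^ 2), 0], ?_, ?_⟩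
    · simp [dotProduct, Fin.sum_univ_three]
      field_simp
      rw [hs]
      ring
    · simp [dotProduct, Fin.sum_univ_three]
      ring

/-- Normal form of a Euclidean Killing field with nonzero rotation. -/
theorem exists_screw_normal_form {S : Matrix (Fin 3) (Fin 3) ℝ} (hS : Sᵀ = -S) (hS0 : S ≠ 0)
    (b : Fin 3 → ℝ) :
    ∃ Q ∈ Matrix.orthogonalGroup (Fin 3) ℝ, ∃ (v : Fin 3 → ℝ) (a β : ℝ), 0 < a ∧ 0 ≤ β ∧
      ∀ x, S *ᵥ x + b = Q *ᵥ screwField a β (Qᵀ *ᵥ (x - v)) := by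
  have hs : ∀ i j, S i j = -S j i := fun i j => by
    have := congrFun (congrFun hS j) i
    simpa using this
  have hd : ∀ i, S i i = 0 := fun i => by linarith [hs i i]
  -- The axial vector of `S`; its length is the angular rate `a` and its direction `m` the axis.
  set u : Fin 3 → ℝ := ![S 2 1, S 0 2, S 1 0] with hu
  have hSu : ∀ x, S *ᵥ x = crossProduct u x := by
    intro x
    ext i
    fin_cases i <;> simp [hu, cross_apply, Matrix.mulVec, dotProduct, Fin.sum_univ_three, hd,
      hs 0 1, hs 1 2, hs 2 0] <;> ring
  have hu0 : u ≠ 0 := by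
    intro h
    apply hS0
    have h0 : S 2 1 = 0 := congrFun h 0
    have h1 : S 0 2 = 0 := congrFun h 1
    have h2 : S 1 0 = 0 := congrFun h 2
    ext i j
    fin_cases i <;> fin_cases j <;> simp [hd, h0, h1, h2, hs 0 1, hs 1 2, hs 2 0]
  have hpos : 0 < u ⬝ᵥ u := lt_of_le_of_ne (Finset.sum_nonneg fun i _ => mul_self_nonneg _)
    fun h => hu0 (dotProduct_self_eq_zero.1 h.symm)
  set a := √(u ⬝ᵥ u) with ha
  have ha0 : 0 < a := Real.sqrt_pos.2 hpos
  have ha2 : a * a = u ⬝ᵥ u := Real.mul_self_sqrt hpos.le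
  set m := a⁻¹ • u with hm
  have hum : u = a • m := by rw [hm, smul_smul, mul_inv_cancel₀ ha0.ne', one_smul]
  have hmm : m ⬝ᵥ m = 1 := by
    rw [hm, smul_dotProduct, dotProduct_smul, ← ha2, smul_eq_mul, smul_eq_mul]
    field_simp
  clear_value m
  obtain ⟨e, he, hem⟩ := exists_unit_orthogonal m
  set f := crossProduct m e with hf
  have hff : f ⬝ᵥ f = 1 := by rw [hf, cross_dot_cross, hmm, he, dotProduct_comm m e, hem]; ring
  have hmf : m ⬝ᵥ f = 0 := dot_self_cross m e
  have hef : e ⬝ᵥ f = 0 := dot_cross_self m e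
  -- The sign makes the pitch nonnegative. Flipping the third frame vector leaves the rotation in
  -- the plane of `e`, `f` unchanged and may give `Q` determinant `-1`.
  obtain ⟨s, hs1, hs2⟩ : ∃ s : ℝ, s * s = 1 ∧ 0 ≤ s * (m ⬝ᵥ b) := by
    rcases le_total 0 (m ⬝ᵥ b) with h | h
    · exact ⟨1, by ring, by linarith⟩
    · exact ⟨-1, by ring, by linarith⟩
  have hQ : (Matrix.of ![e, f, s • m])ᵀ ∈ Matrix.orthogonalGroup (Fin 3) ℝ := by
    rw [Matrix.mem_orthogonalGroup_iff', Matrix.transpose_transpose]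
    ext i j
    have : (Matrix.of ![e, f, s • m] * (Matrix.of ![e, f, s • m])ᵀ) i j
      = ![e, f, s • m] i ⬝ᵥ ![e, f, s • m] j := rfl
    rw [this]
    fin_cases i <;> fin_cases j <;>
      simp [he, hff, hmm, hef, hem, hmf, hs1, dotProduct_comm f e, dotProduct_comm m e,
        dotProduct_comm f m]
  -- A point of the screw axis: moving the origin there cancels the part of `b` orthogonal to `m`.
  refine ⟨_, hQ, (a⁻¹) • crossProduct m b, a, s * (m ⬝ᵥ b), ha0, hs2, fun x => ?_⟩
  rw [Matrix.transpose_transpose]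
  have hQx : ∀ y : Fin 3 → ℝ, (Matrix.of ![e, f, s • m])ᵀ *ᵥ y
      = y 0 • e + y 1 • f + (y 2 * s) • m := by
    intro y
    ext i
    simp [Matrix.mulVec, dotProduct, Fin.sum_univ_three]
    ring
  have hQt : ∀ y : Fin 3 → ℝ, Matrix.of ![e, f, s • m] *ᵥ y
      = ![e ⬝ᵥ y, f ⬝ᵥ y, s * (m ⬝ᵥ y)] := by
    intro y
    ext i
    fin_cases i
    · rfl
    · rfl
    · exact smul_dotProduct s m y
  have hcr := cross_eq_of_frame he hem (x - a⁻¹ • crossProduct m b)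
  have hmmb : crossProduct m (crossProduct m b) = (m ⬝ᵥ b) • m - b := by
    have hmm' := hmm
    simp only [dotProduct, Fin.sum_univ_three] at hmm'
    ext i
    fin_cases i <;> simp [cross_apply, dotProduct, Fin.sum_univ_three]
    · linear_combination -b 0 * hmm'
    · linear_combination -b 1 * hmm'
    · linear_combination -b 2 * hmm'
  have hlhs : S *ᵥ x + b = a • crossProduct m (x - a⁻¹ • crossProduct m b) + (m ⬝ᵥ b) • m := by
    rw [hSu, hum, map_smul, LinearMap.smul_apply, map_sub, map_smul, hmmb, smul_sub, smul_smul,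
      mul_inv_cancel₀ ha0.ne', one_smul]
    abel
  rw [hlhs, hcr, hQt, hQx]
  ext i
  simp [screwField]
  linear_combination -(m ⬝ᵥ b) * m i * hs1

/-- The rotation about the third axis. -/
noncomputable def axisRotation (w : ℝ) : Matrix (Fin 3) (Fin 3) ℝ :=
  !![Real.cos w, -Real.sin w, 0; Real.sin w, Real.cos w, 0; 0, 0, 1]

theorem axisMotion_eq (w z : ℝ) (x : Fin 3 → ℝ) :
    axisMotion w z x = axisRotation w *ᵥ x + ![0, 0, z] := by
  ext i
  fin_cases i <;> simp [axisMotion, axisRotation, dotProduct, Fin.sum_univ_three]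
  ring

theorem axisRotation_mem (w : ℝ) : axisRotation w ∈ Matrix.orthogonalGroup (Fin 3) ℝ := by
  rw [Matrix.mem_orthogonalGroup_iff']
  have := Real.sin_sq_add_cos_sq w
  ext i j
  fin_cases i <;> fin_cases j <;>
    simp [axisRotation, Matrix.mul_apply, Fin.sum_univ_three] <;> linarith

theorem axisRotation_screwField (w z a b : ℝ) (x : Fin 3 → ℝ) :
    axisRotation w *ᵥ screwField a b ((axisRotation w)ᵀ *ᵥ (x - ![0, 0, z]))
      = screwField a b x := by
  have := Real.sin_sq_add_cos_sq w
  ext i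
  fin_cases i <;>
    simp [axisRotation, screwField, Matrix.mulVec, dotProduct, Fin.sum_univ_three]
  · linear_combination -(a * x 1) * this
  · linear_combination (a * x 0) * this

theorem axisRotation_diagonal (w κ : ℝ) :
    axisRotation w * Matrix.diagonal ![κ, κ, 0] * (axisRotation w)ᵀ
      = Matrix.diagonal ![κ, κ, 0] := by
  have := Real.sin_sq_add_cos_sq w
  ext i j
  fin_cases i <;> fin_cases j <;>
    simp [axisRotation, Matrix.mul_apply, Fin.sum_univ_three, Matrix.vecMul, dotProduct,
      Matrix.diagonal_apply]
  · linear_combination κ * this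
  · ring
  · ring
  · linear_combination κ * this

/-! ### Return to the original frame and proof of the classification. -/

section

variable {U : Set (Fin 2 → ℝ)} {X N : (Fin 2 → ℝ) → (Fin 3 → ℝ)}
  {χ : (Fin 2 → ℝ) → (Fin 2 → ℝ)}

/-- Motions along and about the axis preserve the screw field, so they can be absorbed into `Q` and
`v`. -/
theorem isPieceOf_of_axisMotion {Q : Matrix (Fin 3) (Fin 3) ℝ}
    (hQ : Q ∈ Matrix.orthogonalGroup (Fin 3) ℝ) {v : Fin 3 → ℝ} {a b φ z : ℝ}
    (hV : ∀ σ ∈ U, fderiv ℝ X σ (χ σ) = Q *ᵥ screwField a b (Qᵀ *ᵥ (X σ - v)))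
    {Y : (Fin 2 → ℝ) → (Fin 3 → ℝ)}
    (h : ∀ σ ∈ U, ∃ σ', Qᵀ *ᵥ (X σ - v) = axisMotion φ z (Y σ')) :
    IsPieceOf Y a b (Q * axisRotation φ) (v + Q *ᵥ ![0, 0, z]) U X χ := by
  intro σ hσ
  have hQQ : ∀ x, Q *ᵥ Qᵀ *ᵥ x = x := fun x => by
    rw [Matrix.mulVec_mulVec, orthogonal_mul_transpose hQ, Matrix.one_mulVec]
  constructor
  · obtain ⟨σ', hσ'⟩ := h σ hσ
    refine ⟨σ', ?_⟩
    have := congrArg (Q *ᵥ ·) hσ'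
    simp only [hQQ, axisMotion_eq, Matrix.mulVec_add, Matrix.mulVec_mulVec] at this
    rw [sub_eq_iff_eq_add.1 this]
    abel
  · have h1 : (Q * axisRotation φ)ᵀ *ᵥ (X σ - (v + Q *ᵥ ![0, 0, z]))
        = (axisRotation φ)ᵀ *ᵥ (Qᵀ *ᵥ (X σ - v) - ![0, 0, z]) := by
      rw [Matrix.transpose_mul, ← Matrix.mulVec_mulVec, ← sub_sub, Matrix.mulVec_sub _ (X σ - v),
        Matrix.mulVec_mulVec _ _ Q, orthogonal_transpose_mul hQ, Matrix.one_mulVec]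
    rw [hV σ hσ, h1, ← Matrix.mulVec_mulVec, axisRotation_screwField]

/-- The normal of a minimal surface invariant under a translation is constant. -/
theorem MinimalPatch.fderiv_normal_eq_zero_of_translation (hP : MinimalPatch U X N)
    {b : Fin 3 → ℝ} (hb : b ≠ 0) (hV : ∀ σ ∈ U, fderiv ℝ X σ (χ σ) = b) {σ : Fin 2 → ℝ}
    (hσ : σ ∈ U) (y : Fin 2 → ℝ) : fderiv ℝ N σ y = 0 := by
  have hN := hP.unit σ hσ
  have hNb : ∀ σ ∈ U, N σ ⬝ᵥ b = 0 := fun σ hσ => by rw [← hV σ hσ, hP.normal σ hσ]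
  have hL : ∀ y, fderiv ℝ N σ y ⬝ᵥ b = 0 := by
    intro y
    have := dotProduct_fderiv_of_eq_const hP.isOpen (G := fun _ => b) hNb hσ
      (hP.differentiableAt_normal σ hσ) (differentiableAt_const b) y
    simpa using this
  obtain ⟨e, he⟩ := hP.exists_tangent σ hσ (crossProduct (N σ) b) (dot_self_cross _ _)
  -- `dN · V = 0` because `V` is constant. Minimality then removes the component of `dN e` along `N
  -- × V`; by symmetry the same component of every `dN y` vanishes.
  have hee : fderiv ℝ N σ e = 0 := by
    refine eq_zero_of_dotProduct_frame hN (hNb σ hσ) hb (hP.normal_fderiv_normal hσ e)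
      (by rw [dotProduct_comm, hL]) ?_
    have := hP.trace σ hσ (χ σ) e (by
      rw [hV σ hσ, he, cross_dot_cross, hN, hNb σ hσ]
      ring) (by rw [hV σ hσ, he]; exact dot_cross_self _ _)
    rw [hV σ hσ, hL, zero_add, he] at this
    rw [dotProduct_comm, this]
  refine eq_zero_of_dotProduct_frame hN (hNb σ hσ) hb (hP.normal_fderiv_normal hσ y)
    (by rw [dotProduct_comm, hL]) ?_
  rw [← he, dotProduct_comm, hP.symm σ hσ, hee, zero_dotProduct]

/-- The extrinsic equation on a plane. -/
theorem MinimalPatch.plane_eigenvector (hP : MinimalPatch U X N) (hc : IsConnected U)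
    {S : Matrix (Fin 3) (Fin 3) ℝ} {b : Fin 3 → ℝ}
    (hV : ∀ σ ∈ U, fderiv ℝ X σ (χ σ) = S *ᵥ X σ + b)
    {A : Matrix (Fin 3) (Fin 3) ℝ} (hA : Aᵀ = A) {Ω : ℝ}
    (h2 : ∀ σ ∈ U, N σ ⬝ᵥ (A *ᵥ X σ + Ω ^ 2 • S *ᵥ (S *ᵥ X σ + b)) = 0)
    {ν : Fin 3 → ℝ} (hν : ν ⬝ᵥ ν = 1) (h : ∀ σ ∈ U, ∀ y, ν ⬝ᵥ fderiv ℝ X σ y = 0) :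
    ∃ d μ : ℝ, (∀ σ ∈ U, ν ⬝ᵥ X σ = d) ∧ A *ᵥ ν = μ • ν ∧ μ * d = 0 := by
  obtain ⟨σ₀, hσ₀⟩ := hc.nonempty
  have hmul : ∀ (M : Matrix (Fin 3) (Fin 3) ℝ) σ, σ ∈ U →
      DifferentiableAt ℝ (fun r => M *ᵥ X r) σ ∧
        ∀ y, fderiv ℝ (fun r => M *ᵥ X r) σ y = M *ᵥ fderiv ℝ X σ y := fun M σ hσ => by
    simpa using hasFDerivAt_mulVec_sub (Q := M) (v := 0) (hP.differentiableAt σ hσ)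
  have hd : ∀ σ ∈ U, ν ⬝ᵥ X σ = ν ⬝ᵥ X σ₀ := by
    intro σ hσ
    refine hP.isOpen.is_const_of_fderiv_eq_zero (𝕜 := ℝ) hc.isPreconnected (f := fun r => ν ⬝ᵥ X r)
      (fun r hr => ?_) (fun r hr => ?_) hσ hσ₀
    · refine DifferentiableAt.differentiableWithinAt ?_
      simp only [dotProduct]
      exact DifferentiableAt.fun_sum fun i _ =>
        (differentiableAt_pi.1 (hP.differentiableAt r hr) i).const_mul _
    · ext y : 1
      rw [fderiv_dotProduct (F := fun _ => ν) (differentiableAt_const ν) (hP.differentiableAt r hr),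
        h r hr]
      simp
  have hνN : ∀ σ ∈ U, ν = (N σ ⬝ᵥ ν) • N σ := by
    intro σ hσ
    have hN := hP.unit σ hσ
    obtain ⟨y, hy⟩ := hP.exists_tangent σ hσ (ν - (N σ ⬝ᵥ ν) • N σ) (by
      rw [dotProduct_sub, dotProduct_smul, hN, smul_eq_mul, mul_one, sub_self])
    have h3 := h σ hσ y
    rw [hy] at h3
    rw [← sub_eq_zero, ← dotProduct_self_eq_zero]
    nth_rewrite 1 [sub_dotProduct]
    rw [h3, smul_dotProduct, dotProduct_sub, dotProduct_smul, hN]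
    simp
  -- `V` is tangent to the plane, so `ν · V = 0`; the derivative along `χ` shows that the
  -- acceleration `SV` is tangent too, and the `Ω` term drops out.
  have hscrew : ∀ σ ∈ U, ν ⬝ᵥ S *ᵥ (S *ᵥ X σ + b) = 0 := by
    intro σ hσ
    have h3 : ∀ r ∈ U, ν ⬝ᵥ (S *ᵥ X r) = -(ν ⬝ᵥ b) := by
      intro r hr
      have := h r hr (χ r)
      rw [hV r hr, dotProduct_add] at this
      linarith
    have h4 := dotProduct_fderiv_of_eq_const hP.isOpen (F := fun _ => ν) h3 hσ
      (differentiableAt_const ν) (hmul S σ hσ).1 (χ σ)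
    rw [(hmul S σ hσ).2, hV σ hσ] at h4
    simpa using h4
  have hA0 : ∀ σ ∈ U, ν ⬝ᵥ A *ᵥ X σ = 0 := by
    intro σ hσ
    have h3 := h2 σ hσ
    have h4 : ν ⬝ᵥ (A *ᵥ X σ + Ω ^ 2 • S *ᵥ (S *ᵥ X σ + b)) = 0 := by
      rw [hνN σ hσ, smul_dotProduct, h3, smul_zero]
    rwa [dotProduct_add, dotProduct_smul, hscrew σ hσ, smul_zero, add_zero] at h4
  have hAs : ∀ x y : Fin 3 → ℝ, x ⬝ᵥ A *ᵥ y = (A *ᵥ x) ⬝ᵥ y := fun x y => by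
    rw [Matrix.dotProduct_mulVec, ← Matrix.mulVec_transpose, hA]
  -- Differentiating `ν · AX = 0` makes `Aν` normal to the surface, hence a multiple of `ν`.
  have hAt : ∀ y, (A *ᵥ ν) ⬝ᵥ fderiv ℝ X σ₀ y = 0 := by
    intro y
    have h4 := dotProduct_fderiv_of_eq_const hP.isOpen (F := fun _ => ν) hA0 hσ₀
      (differentiableAt_const ν) (hmul A σ₀ hσ₀).1 y
    rw [(hmul A σ₀ hσ₀).2] at h4
    rw [← hAs]
    simpa using h4
  have hμ : A *ᵥ ν = (ν ⬝ᵥ A *ᵥ ν) • ν := by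
    have hW : N σ₀ ⬝ᵥ (A *ᵥ ν - (ν ⬝ᵥ A *ᵥ ν) • ν) = 0 := by
      have h5 : ν ⬝ᵥ (A *ᵥ ν - (ν ⬝ᵥ A *ᵥ ν) • ν) = 0 := by
        rw [dotProduct_sub, dotProduct_smul, hν, smul_eq_mul, mul_one, sub_self]
      rw [hνN σ₀ hσ₀, smul_dotProduct, ← hνN σ₀ hσ₀, smul_eq_mul, mul_eq_zero] at h5
      refine h5.resolve_left fun h6 => ?_
      have h7 := hνN σ₀ hσ₀
      rw [h6, zero_smul] at h7
      rw [h7, zero_dotProduct] at hν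
      exact zero_ne_one hν
    obtain ⟨y, hy⟩ := hP.exists_tangent σ₀ hσ₀ _ hW
    have h8 := hAt y
    have h9 := h σ₀ hσ₀ y
    rw [hy] at h8 h9
    rw [← sub_eq_zero, ← dotProduct_self_eq_zero]
    nth_rewrite 1 [sub_dotProduct]
    rw [h8, smul_dotProduct, h9, smul_zero, sub_zero]
  refine ⟨ν ⬝ᵥ X σ₀, ν ⬝ᵥ A *ᵥ ν, hd, hμ, ?_⟩
  rw [← smul_eq_mul, ← smul_dotProduct, ← hμ, ← hAs, hA0 σ₀ hσ₀]

/-- Classification of the minimal surfaces in `ℝ³` which are invariant under a Killing field and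
solve the extrinsic equation with a quadratic profile. -/
theorem MinimalPatch.classification (hP : MinimalPatch U X N) (hc : IsConnected U)
    {S : Matrix (Fin 3) (Fin 3) ℝ} (hS : Sᵀ = -S) {b : Fin 3 → ℝ}
    (hV : ∀ σ ∈ U, fderiv ℝ X σ (χ σ) = S *ᵥ X σ + b) (hχ : ∃ σ ∈ U, S *ᵥ X σ + b ≠ 0)
    {A : Matrix (Fin 3) (Fin 3) ℝ} (hA : Aᵀ = A) {Ω : ℝ}
    (h1 : ∀ σ ∈ U, (A *ᵥ X σ) ⬝ᵥ (S *ᵥ X σ + b) = 0)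
    (h2 : ∀ σ ∈ U, N σ ⬝ᵥ (A *ᵥ X σ + Ω ^ 2 • S *ᵥ (S *ᵥ X σ + b)) = 0) :
    (∃ (ν : Fin 3 → ℝ) (d μ : ℝ), ν ⬝ᵥ ν = 1 ∧ (∀ σ ∈ U, ν ⬝ᵥ X σ = d) ∧
        A *ᵥ ν = μ • ν ∧ μ * d = 0) ∨
      (∃ Q ∈ Matrix.orthogonalGroup (Fin 3) ℝ, ∃ v : Fin 3 → ℝ, A *ᵥ v = 0 ∧
        ∃ a : ℝ, 0 < a ∧
        ((∃ lam κ : ℝ, 0 < lam ∧ IsPieceOf (helicoid a lam) a lam Q v U X χ ∧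
            A = Q * Matrix.diagonal ![κ, κ, 0] * Qᵀ) ∨
        (∃ c : ℝ, 0 < c ∧ IsPieceOf (catenoid a c) a 0 Q v U X χ ∧
            A = Q * Matrix.diagonal ![a ^ 2 * Ω ^ 2, a ^ 2 * Ω ^ 2, 0] * Qᵀ) ∨
        (∃ c l : ℝ, 0 < c ∧ 0 < l ∧ l < 1 ∧ IsPieceOf (scherk a c l) a (l * a * c) Q v U X χ ∧
            A = Q * Matrix.diagonal ![a ^ 2 * Ω ^ 2, a ^ 2 * Ω ^ 2, 0] * Qᵀ))) := by
  by_cases hS0 : S = 0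
  · left
    subst hS0
    obtain ⟨σ₀, hσ₀, hb⟩ := hχ
    rw [Matrix.zero_mulVec, zero_add] at hb
    have hN : ∀ σ ∈ U, N σ = N σ₀ := fun σ hσ =>
      hP.isOpen.is_const_of_fderiv_eq_zero hc.isPreconnected
        (fun r hr => (hP.differentiableAt_normal r hr).differentiableWithinAt)
        (fun r hr => by
          ext y : 1
          exact hP.fderiv_normal_eq_zero_of_translation hb
            (fun σ hσ => by rw [hV σ hσ, Matrix.zero_mulVec, zero_add]) hr y) hσ hσ₀
    obtain ⟨d, μ, h⟩ := hP.plane_eigenvector hc hV hA h2 (hP.unit σ₀ hσ₀)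
      (fun σ hσ y => by rw [← hN σ hσ, hP.normal σ hσ])
    exact ⟨_, d, μ, hP.unit σ₀ hσ₀, h⟩
  · obtain ⟨Q, hQ, v, a, β, ha, hβ, hnf⟩ := exists_screw_normal_form hS hS0 b
    have hQQ := orthogonal_mul_transpose hQ
    have hQQ' := orthogonal_transpose_mul hQ
    have hP' := hP.motion hQ v
    have hX' : ∀ σ ∈ U, ∀ y, fderiv ℝ (fun σ => Qᵀ *ᵥ (X σ - v)) σ y = Qᵀ *ᵥ fderiv ℝ X σ y :=
      fun σ hσ => (hasFDerivAt_mulVec_sub (hP.differentiableAt σ hσ)).2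
    have hV' : ∀ σ ∈ U, fderiv ℝ (fun σ => Qᵀ *ᵥ (X σ - v)) σ (χ σ)
        = screwField a β (Qᵀ *ᵥ (X σ - v)) := by
      intro σ hσ
      rw [hX' σ hσ, hV σ hσ, hnf, Matrix.mulVec_mulVec, hQQ', Matrix.one_mulVec]
    -- The linear part is the difference of the normal form at `y + v` and at `v`.
    have hSlin : ∀ y, S *ᵥ y = Q *ᵥ screwField a 0 (Qᵀ *ᵥ y) := by
      intro y
      have e1 := hnf (y + v)
      have e2 := hnf v
      rw [add_sub_cancel_right, ← zero_add (Qᵀ *ᵥ y), screwField_add_screwField,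
        Matrix.mulVec_add S, Matrix.mulVec_add Q] at e1
      rw [sub_self, Matrix.mulVec_zero] at e2
      rw [← e2] at e1
      have e3 : S *ᵥ y + (S *ᵥ v + b) = Q *ᵥ screwField a 0 (Qᵀ *ᵥ y) + (S *ᵥ v + b) := by
        rw [← add_assoc, e1, add_comm]
      exact add_right_cancel e3
    set B := Qᵀ * A * Q with hBdef
    set w := Qᵀ *ᵥ (A *ᵥ v) with hw
    have hB : Bᵀ = B := by
      rw [hBdef, Matrix.transpose_mul, Matrix.transpose_mul, hA, Matrix.transpose_transpose,
        Matrix.mul_assoc]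
    have hAB : A = Q * B * Qᵀ := by
      rw [hBdef, ← Matrix.mul_assoc, ← Matrix.mul_assoc, hQQ, Matrix.one_mul, Matrix.mul_assoc,
        hQQ, Matrix.mul_one]
    -- In the moved frame the gradient of the profile becomes affine. Its constant term `w` vanishes
    -- exactly when `Av = 0`.
    have hBX : ∀ x, B *ᵥ (Qᵀ *ᵥ (x - v)) + w = Qᵀ *ᵥ (A *ᵥ x) := by
      intro x
      rw [hBdef, Matrix.mulVec_mulVec, Matrix.mul_assoc, hQQ, Matrix.mul_one,
        ← Matrix.mulVec_mulVec, hw, ← Matrix.mulVec_add, ← Matrix.mulVec_add, sub_add_cancel]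
    have hd := dotProduct_transpose_mulVec hQ
    have h1' : ∀ σ ∈ U, (B *ᵥ (Qᵀ *ᵥ (X σ - v)) + w) ⬝ᵥ screwField a β (Qᵀ *ᵥ (X σ - v)) = 0 := by
      intro σ hσ
      rw [← hV' σ hσ, hBX, hX' σ hσ, hd, hV σ hσ, h1 σ hσ]
    have h2' : ∀ σ ∈ U, (Qᵀ *ᵥ (N σ - 0)) ⬝ᵥ (B *ᵥ (Qᵀ *ᵥ (X σ - v)) + w
        + Ω ^ 2 • screwField a 0 (screwField a β (Qᵀ *ᵥ (X σ - v)))) = 0 := by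
      intro σ hσ
      have e1 : screwField a 0 (screwField a β (Qᵀ *ᵥ (X σ - v)))
          = Qᵀ *ᵥ (S *ᵥ (S *ᵥ X σ + b)) := by
        rw [hSlin, Matrix.mulVec_mulVec _ Qᵀ Q, hQQ', Matrix.one_mulVec, ← hV σ hσ, ← hX' σ hσ,
          hV' σ hσ]
      rw [e1, hBX, ← Matrix.mulVec_smul, ← Matrix.mulVec_add, sub_zero, hd, h2 σ hσ]
    obtain ⟨σ₀, hσ₀⟩ := hc.nonempty
    -- The normal is reversed if necessary, so that the flux is nonnegative.
    have hmain : ∃ N' k, MinimalPatch U (fun σ => Qᵀ *ᵥ (X σ - v)) N' ∧ 0 ≤ k ∧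
        (∀ σ ∈ U, N' σ 0 * (Qᵀ *ᵥ (X σ - v)) 0 + N' σ 1 * (Qᵀ *ᵥ (X σ - v)) 1 = k) ∧
        ∀ σ ∈ U, N' σ ⬝ᵥ (B *ᵥ (Qᵀ *ᵥ (X σ - v)) + w
          + Ω ^ 2 • screwField a 0 (screwField a β (Qᵀ *ᵥ (X σ - v)))) = 0 := by
      have hflux := fun σ hσ => hP'.flux_eq hc.isPreconnected hV' ha (σ := σ) hσ hσ₀
      rcases le_total 0 ((Qᵀ *ᵥ (N σ₀ - 0)) 0 * (Qᵀ *ᵥ (X σ₀ - v)) 0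
        + (Qᵀ *ᵥ (N σ₀ - 0)) 1 * (Qᵀ *ᵥ (X σ₀ - v)) 1) with h | h
      · exact ⟨_, _, hP', h, hflux, h2'⟩
      · refine ⟨_, _, hP'.neg_normal, neg_nonneg.2 h, fun σ hσ => ?_, fun σ hσ => ?_⟩
        · rw [← hflux σ hσ]
          simp only [Pi.neg_apply]
          ring
        · rw [neg_dotProduct, h2' σ hσ, neg_zero]
    obtain ⟨N', k, hP'', hk0, hk, h2''⟩ := hmain
    rcases hP''.classification_aux hc hV' ha hβ hk hk0 hB h1' h2'' with h | ⟨hw0, φ, z, h⟩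
    · left
      obtain ⟨d, μ, h'⟩ := hP.plane_eigenvector hc hV hA h2 (ν := Q *ᵥ ![0, 0, 1])
        (by
          rw [← hd, Matrix.mulVec_mulVec, hQQ', Matrix.one_mulVec]
          simp [dotProduct, Fin.sum_univ_three])
        (fun σ hσ y => by
          rw [← hd, Matrix.mulVec_mulVec, hQQ', Matrix.one_mulVec, ← hX' σ hσ]
          have := h σ hσ y
          simpa [dotProduct, Fin.sum_univ_three] using this)
      refine ⟨_, d, μ, ?_, h'⟩
      rw [← hd, Matrix.mulVec_mulVec, hQQ', Matrix.one_mulVec]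
      simp [dotProduct, Fin.sum_univ_three]
    · right
      have hV'' : ∀ σ ∈ U, fderiv ℝ X σ (χ σ) = Q *ᵥ screwField a β (Qᵀ *ᵥ (X σ - v)) :=
        fun σ hσ => by rw [hV σ hσ, hnf]
      have hAv : A *ᵥ v = 0 := by
        have := congrArg (Q *ᵥ ·) hw0
        simpa only [hw, Matrix.mulVec_mulVec, ← Matrix.mul_assoc, hQQ, Matrix.one_mul,
          Matrix.mulVec_zero] using this
      have hdiag : ∀ κ, B = Matrix.diagonal ![κ, κ, 0] →
          A = Q * axisRotation φ * Matrix.diagonal ![κ, κ, 0] * (Q * axisRotation φ)ᵀ := by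
        intro κ hκ
        have e1 : Q * axisRotation φ * Matrix.diagonal ![κ, κ, 0] * (Q * axisRotation φ)ᵀ
            = Q * (axisRotation φ * Matrix.diagonal ![κ, κ, 0] * (axisRotation φ)ᵀ) * Qᵀ := by
          simp only [Matrix.transpose_mul, Matrix.mul_assoc]
        rw [e1, axisRotation_diagonal, ← hκ]
        exact hAB
      -- The axis lies in the kernel of the profile, so the translation along it does not spoil `Av
      -- = 0`.
      have hker : ∀ κ, B = Matrix.diagonal ![κ, κ, 0] → A *ᵥ (v + Q *ᵥ ![0, 0, z]) = 0 := by
        intro κ hκ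
        rw [Matrix.mulVec_add, hAv, zero_add, hAB, Matrix.mulVec_mulVec, Matrix.mul_assoc, hQQ',
          Matrix.mul_one, ← Matrix.mulVec_mulVec, hκ]
        have : Matrix.diagonal ![κ, κ, 0] *ᵥ ![0, 0, z] = 0 := by
          ext i
          fin_cases i <;> simp [Matrix.mulVec_diagonal]
        rw [this, Matrix.mulVec_zero]
      have hQR : Q * axisRotation φ ∈ Matrix.orthogonalGroup (Fin 3) ℝ :=
        mul_mem hQ (axisRotation_mem φ)
      rcases h with ⟨hb, ⟨κ, hκ⟩, h⟩ | ⟨hb, hκ, c, hc0, h⟩ | ⟨hκ, c, l, hc0, hl0, hl1, hb, h⟩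
      · exact ⟨_, hQR, _, hker _ hκ, a, ha, Or.inl ⟨β, κ, hb,
          isPieceOf_of_axisMotion hQ hV'' h, hdiag _ hκ⟩⟩
      · subst hb
        exact ⟨_, hQR, _, hker _ hκ, a, ha, Or.inr (Or.inl ⟨c, hc0,
          isPieceOf_of_axisMotion hQ hV'' h, hdiag _ hκ⟩)⟩
      · subst hb
        exact ⟨_, hQR, _, hker _ hκ, a, ha, Or.inr (Or.inr ⟨c, l, hc0, hl0, hl1,
          isPieceOf_of_axisMotion hQ hV'' h, hdiag _ hκ⟩)⟩

end

theorem profile3_mulVec_apply {n : ℕ} (A : Fin (n + 4) → ℝ) (x : Fin 3 → ℝ) (i : Fin 3) :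
    (profile3 A *ᵥ x) i = A (incl3 n i) * x i := by
  rw [profile3, Matrix.mulVec_diagonal]
  fin_cases i
  · rfl
  · rfl
  · have : (2 : Fin (n + 4)) = incl3 n 2 := by
      ext
      simp [incl3]
    change A 2 * _ = _
    rw [this]
    rfl

theorem stationary_minimal_classification {n : ℕ} (hn : 1 ≤ n) (A : Fin (n + 4) → ℝ)
    {U : Set (Fin 2 → ℝ)} {X : (Fin 2 → ℝ) → (Fin 3 → ℝ)} {χ : (Fin 2 → ℝ) → (Fin 2 → ℝ)}
    {Ω : ℝ} (hU : IsOpen U) (hc : IsConnected U) (hX : IsMinimalSurface U X)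
    (hst : IsStationarySurface A U X χ)
    (hsol : SolvesExtrinsicEquation n (planeWaveMetric A) (typeII (n + 4) X) (velocityField Ω χ)
      (cylinder U)) :
    (∃ (ν : Fin 3 → ℝ) (d μ : ℝ), ν ⬝ᵥ ν = 1 ∧ (∀ σ ∈ U, ν ⬝ᵥ X σ = d) ∧
        profile3 A *ᵥ ν = μ • ν ∧ μ * d = 0) ∨
      (∃ Q ∈ Matrix.orthogonalGroup (Fin 3) ℝ, ∃ v : Fin 3 → ℝ, profile3 A *ᵥ v = 0 ∧
        ∃ a : ℝ, 0 < a ∧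
        ((∃ lam κ : ℝ, 0 < lam ∧ IsPieceOf (helicoid a lam) a lam Q v U X χ ∧
            profile3 A = Q * Matrix.diagonal ![κ, κ, 0] * Qᵀ) ∨
        (∃ c : ℝ, 0 < c ∧ IsPieceOf (catenoid a c) a 0 Q v U X χ ∧
            profile3 A = Q * Matrix.diagonal ![a ^ 2 * Ω ^ 2, a ^ 2 * Ω ^ 2, 0] * Qᵀ) ∨
        (∃ c l : ℝ, 0 < c ∧ 0 < l ∧ l < 1 ∧ IsPieceOf (scherk a c l) a (l * a * c) Q v U X χ ∧
            profile3 A = Q * Matrix.diagonal ![a ^ 2 * Ω ^ 2, a ^ 2 * Ω ^ 2, 0] * Qᵀ))) := by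
  obtain ⟨N, hP, hsecond⟩ := exists_minimalPatch hU hX
  obtain ⟨S, b, hS, hSb⟩ := hst.exists_affine hP.differentiableAt
  have hV : ∀ σ ∈ U, fderiv ℝ X σ (χ σ) = S *ᵥ X σ + b := fun σ hσ => (hSb σ hσ).1
  refine hP.classification (A := profile3 A) hc hS hV ?_ (Matrix.diagonal_transpose _)
    (fun σ hσ => ?_)
    (fun σ hσ => ?_)
  · obtain ⟨σ, hσ, hχ⟩ := hst.1
    refine ⟨σ, hσ, fun h => hχ (hX.2.1 σ hσ ?_)⟩
    rw [hV σ hσ, h, map_zero]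
  · rw [← hV σ hσ, ← (hSb σ hσ).2]
    simp only [dotProduct, profile3_mulVec_apply]
  · have hcd := contDiffAt_of_contDiffOn hU hX.1 hσ
    have hmem : (Sum.elim 0 σ : Fin 2 ⊕ Fin 2 → ℝ) ∈ cylinder U := hσ
    obtain ⟨hpos, heq⟩ := hsol _ hmem
    have h1 := (extrinsicEquation_typeII_iff A hn hcd
      (isUnit_inducedMetric (hP.differentiableAt σ hσ) (hX.2.1 σ hσ)) (hX.2.2 σ hσ) Ω χ hpos).1
      heq (N σ) ((isNormal_iff (hP.differentiableAt σ hσ) _).2 (hP.normal σ hσ))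
    have h2 : N σ ⬝ᵥ (profile3 A *ᵥ X σ + Ω ^ 2 • fderiv ℝ (fderiv ℝ X) σ (χ σ) (χ σ)) = 0 := by
      rw [← h1]
      simp only [dotProduct]
      refine Finset.sum_congr rfl fun i _ => ?_
      simp only [Sum.elim_inr, pd_pd_component hcd, Pi.add_apply, Pi.smul_apply,
        profile3_mulVec_apply, fderiv_fderiv_apply _ (χ σ) (χ σ), Finset.sum_apply, smul_eq_mul]
    have h3 := hsecond σ hσ (χ σ) (χ σ)
    have h4 : fderiv ℝ N σ (χ σ) ⬝ᵥ (S *ᵥ X σ) + N σ ⬝ᵥ (S *ᵥ fderiv ℝ X σ (χ σ))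
        + fderiv ℝ N σ (χ σ) ⬝ᵥ b = 0 := by
      have hm : DifferentiableAt ℝ (fun r => S *ᵥ (X r - (0 : Fin 3 → ℝ)) + b) σ ∧
          ∀ y, fderiv ℝ (fun r => S *ᵥ (X r - (0 : Fin 3 → ℝ)) + b) σ y
            = S *ᵥ fderiv ℝ X σ y := by
        obtain ⟨m1, m2⟩ :=
          hasFDerivAt_mulVec_sub (Q := S) (v := 0) (hP.differentiableAt σ hσ)
        exact ⟨m1.add_const b, fun y => by rw [fderiv_add_const, m2]⟩
      have h5 := dotProduct_fderiv_of_eq_const hU (F := N)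
        (G := fun r => S *ᵥ (X r - (0 : Fin 3 → ℝ)) + b) (c := 0)
        (fun r hr => by rw [sub_zero, ← hV r hr, hP.normal r hr]) hσ
        (hP.differentiableAt_normal σ hσ) hm.1 (χ σ)
      rw [hm.2, sub_zero, dotProduct_add] at h5
      linarith
    rw [hV σ hσ, dotProduct_add] at h3
    rw [hV σ hσ] at h4
    rw [dotProduct_add, dotProduct_smul] at h2 ⊢
    -- Both sides equal `-(dN χ · V)`, one by differentiating `N · dX = 0` and the other by
    -- differentiating `N · V = 0`. No derivative of `χ` is involved.
    have h6 : N σ ⬝ᵥ fderiv ℝ (fderiv ℝ X) σ (χ σ) (χ σ) = N σ ⬝ᵥ S *ᵥ (S *ᵥ X σ + b) := by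
      linarith
    rw [← h6, h2]

/-! ### Screw fields as Killing fields of the plane wave. -/

section Stationarity

variable {n : ℕ}

/-- The Killing field that is the screw motion field in the first three transverse coordinates. -/
def screwKilling (n : ℕ) (a b : ℝ) (x : Fin 2 ⊕ Fin (n + 4) → ℝ) : Fin 2 ⊕ Fin (n + 4) → ℝ :=
  Sum.elim 0 fun q => a * ((if q = 1 then 1 else 0) * x (Sum.inr 0)
    - (if q = 0 then 1 else 0) * x (Sum.inr 1)) + b * (if q = 2 then 1 else 0)

theorem hasFDerivAt_coord {ι : Type*} [Fintype ι] (μ : ι) (x : ι → ℝ) :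
    HasFDerivAt (fun y : ι → ℝ => y μ) (ContinuousLinearMap.proj (R := ℝ) μ) x :=
  (ContinuousLinearMap.proj (R := ℝ) (φ := fun _ : ι => ℝ) μ).hasFDerivAt

theorem pd_screwKilling (a b : ℝ) (μ : Fin 2 ⊕ Fin (n + 4)) (q : Fin (n + 4))
    (x : Fin 2 ⊕ Fin (n + 4) → ℝ) :
    pd μ (fun y => screwKilling n a b y (Sum.inr q)) x
      = a * ((if q = 1 then 1 else 0) * (if μ = Sum.inr 0 then 1 else 0)
        - (if q = 0 then 1 else 0) * (if μ = Sum.inr 1 then 1 else 0)) := by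
  have h := (((((hasFDerivAt_coord (Sum.inr 0 : Fin 2 ⊕ Fin (n + 4)) x).const_mul
    (if q = 1 then (1 : ℝ) else 0)).sub ((hasFDerivAt_coord (Sum.inr 1) x).const_mul
      (if q = 0 then (1 : ℝ) else 0))).const_mul a).add_const (b * (if q = 2 then 1 else 0)))
  have h' : HasFDerivAt (fun y => screwKilling n a b y (Sum.inr q)) _ x := h
  rw [pd, h'.fderiv]
  have e : ∀ ν, (Pi.single μ (1 : ℝ) : Fin 2 ⊕ Fin (n + 4) → ℝ) ν = if μ = ν then 1 else 0 := by
    intro ν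
    simp [Pi.single_apply, eq_comm]
  simp only [_root_.smul_apply, _root_.sub_apply, ContinuousLinearMap.proj_apply, e, smul_eq_mul]

/-- The transverse equations hold because the linear part is antisymmetric. In the wave block the
condition is that the profile has zero derivative `2a(A₁ - A₀)x₀x₁ + 2bA₂x₂`. -/
theorem isKilling_screwKilling {A : Fin (n + 4) → ℝ} {a b : ℝ} (h01 : A 0 = A 1)
    (h2 : b * A 2 = 0) : IsKilling (planeWaveMetric A) (screwKilling n a b) := by
  have hl : ∀ μ (i : Fin 2) x, pd μ (fun y => screwKilling n a b y (Sum.inl i)) x = 0 :=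
    fun μ i x => pd_const μ 0 x
  rintro x (i | p) (j | q)
  · simp only [Fintype.sum_sum_type, hl, pd_inl_planeWaveMetric, pd_inr_planeWaveMetric_inl,
      planeWaveMetric_inl_inr, planeWaveMetric_inr_inl, mul_zero, zero_mul, add_zero,
      Finset.sum_const_zero, zero_add]
    simp only [screwKilling, Sum.elim_inr]
    have : ∀ q : Fin (n + 4), (a * ((if q = 1 then 1 else 0) * x (Sum.inr 0)
        - (if q = 0 then 1 else 0) * x (Sum.inr 1)) + b * (if q = 2 then 1 else 0))
          * -(2 * A q * x (Sum.inr q))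
        = (if q = 1 then -(2 * a * x (Sum.inr 0) * A q * x (Sum.inr q)) else 0)
          + (if q = 0 then 2 * a * x (Sum.inr 1) * A q * x (Sum.inr q) else 0)
          + (if q = 2 then -(2 * (b * A q) * x (Sum.inr q)) else 0) := by
      intro q
      split_ifs <;> ring
    simp only [this, Finset.sum_add_distrib, Finset.sum_ite_eq', Finset.mem_univ, if_true, h2, h01]
    ring
  · simp [Fintype.sum_sum_type, hl, pd_screwKilling]
  · simp [Fintype.sum_sum_type, hl, pd_screwKilling]
  · simp only [Fintype.sum_sum_type, hl, pd_screwKilling, planeWaveMetric_inl_inr,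
      planeWaveMetric_inr_inl, planeWaveMetric_inr_inr]
    simp [Finset.sum_add_distrib]
    split_ifs <;> ring

theorem contDiff_screwKilling (a b : ℝ) : ContDiff ℝ ∞ (screwKilling n a b) := by
  rw [contDiff_pi]
  rintro (i | q)
  · exact contDiff_const
  · simp only [screwKilling, Sum.elim_inr]
    fun_prop

theorem fin_two_eq : (2 : Fin (n + 4)) = ⟨2, by omega⟩ :=
  Fin.ext (Nat.mod_eq_of_lt (show 2 < n + 4 by omega))

theorem incl3_two : incl3 n 2 = 2 := by
  rw [fin_two_eq]
  rfl

theorem screwKilling_typeII (a b : ℝ) (X : (Fin 2 → ℝ) → (Fin 3 → ℝ)) (s : Fin 2 ⊕ Fin 2 → ℝ) :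
    screwKilling n a b (typeII (n + 4) X s) = Sum.elim (0 : Fin 2 → ℝ)
      (fun q : Fin (n + 4) => if h : (q : ℕ) < 3 then
        screwField a b (X (fun j => s (Sum.inr j))) ⟨q, h⟩ else 0) := by
  have e0 : typeII (n + 4) X s (Sum.inr 0) = X (fun j => s (Sum.inr j)) 0 := rfl
  have e1 : typeII (n + 4) X s (Sum.inr 1) = X (fun j => s (Sum.inr j)) 1 := rfl
  funext μ
  rcases μ with i | q
  · rfl
  · simp only [screwKilling, Sum.elim_inr, e0, e1, fin_two_eq]
    obtain ⟨q, hq⟩ := q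
    rcases q with _ | _ | _ | q
    · simp [screwField, Fin.ext_iff]
    · simp [screwField, Fin.ext_iff]
    · simp [screwField, Fin.ext_iff]
    · have : ¬ (q + 1 + 1 + 1 < 3) := by omega
      simp [this, Fin.ext_iff]

variable {A : Fin (n + 4) → ℝ} {X : (Fin 2 → ℝ) → (Fin 3 → ℝ)} {χ : (Fin 2 → ℝ) → (Fin 2 → ℝ)}
  {a b : ℝ}

theorem isStationarySurface_of_screwField (hX : Differentiable ℝ X) (hχ : ∃ σ, χ σ ≠ 0)
    (h : ∀ σ, fderiv ℝ X σ (χ σ) = screwField a b (X σ)) (h01 : A 0 = A 1) (h2 : b * A 2 = 0) :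
    IsStationarySurface A Set.univ X χ := by
  refine ⟨by simpa using hχ, screwKilling n a b, contDiff_screwKilling a b,
    isKilling_screwKilling h01 h2, fun s _ => ?_⟩
  rw [fderiv_typeII (hX _), screwKilling_typeII]
  simp only [Sum.elim_inl, Sum.elim_inr, h]

/-- The converse side of stationarity: evaluated at suitable points of an explicit surface, this
yields the conditions on the `A_q`. -/
theorem IsStationarySurface.profile_screwField (hst : IsStationarySurface A Set.univ X χ)
    (hX : Differentiable ℝ X) (h : ∀ σ, fderiv ℝ X σ (χ σ) = screwField a b (X σ))
    (σ : Fin 2 → ℝ) : a * (A 1 - A 0) * (X σ 0 * X σ 1) + b * A 2 * X σ 2 = 0 := by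
  obtain ⟨_, _, _, H⟩ := hst.exists_affine (fun σ _ => hX σ)
  have := (H σ trivial).2
  rw [h, Fin.sum_univ_three, incl3_two] at this
  change A 0 * X σ 0 * -(a * X σ 1) + A 1 * X σ 1 * (a * X σ 0) + A 2 * X σ 2 * b = 0 at this
  linarith

end Stationarity

/-! ### The blackfold equations on the timelike region of a complete parametrisation. -/

section Blackfold

variable {n : ℕ} {A : Fin (n + 4) → ℝ} {X : (Fin 2 → ℝ) → (Fin 3 → ℝ)}
  {χ : (Fin 2 → ℝ) → (Fin 2 → ℝ)} {Ω : ℝ}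

/-- The function `𝐤²` on the surface. -/
noncomputable def surfaceModulusSq (A : Fin (n + 4) → ℝ) (X : (Fin 2 → ℝ) → (Fin 3 → ℝ)) (Ω : ℝ)
    (χ : (Fin 2 → ℝ) → (Fin 2 → ℝ)) (σ : Fin 2 → ℝ) : ℝ :=
  1 + ∑ i, A (incl3 n i) * X σ i ^ 2 - Ω ^ 2 * ∑ i, fderiv ℝ X σ (χ σ) i ^ 2

theorem mem_timelikeRegion (hX : ContDiff ℝ ∞ X) {s : Fin 2 ⊕ Fin 2 → ℝ} :
    s ∈ timelikeRegion A X Ω χ ↔ 0 < surfaceModulusSq A X Ω χ (fun j => s (Sum.inr j)) := by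
  rw [timelikeRegion, Set.mem_ofPred_eq, modulusSq_typeII A (hX.differentiable (by simp) _)]
  rfl

theorem timelikeRegion_nonempty_iff (hX : ContDiff ℝ ∞ X) :
    (timelikeRegion A X Ω χ).Nonempty ↔ ∃ σ, 0 < surfaceModulusSq A X Ω χ σ := by
  constructor
  · rintro ⟨s, hs⟩
    exact ⟨_, (mem_timelikeRegion hX).1 hs⟩
  · rintro ⟨σ, hσ⟩
    exact ⟨Sum.elim 0 σ, (mem_timelikeRegion hX).2 hσ⟩

theorem continuous_surfaceModulusSq (hX : ContDiff ℝ ∞ X) (hχ : Continuous χ) :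
    Continuous (surfaceModulusSq A X Ω χ) := by
  have h1 : Continuous fun σ => fderiv ℝ X σ (χ σ) :=
    (hX.continuous_fderiv (by simp)).clm_apply hχ
  have h2 := hX.continuous
  unfold surfaceModulusSq
  fun_prop

/-- The boundary condition is automatic: the frontier of the positivity set of a continuous function
lies in its zero set. -/
theorem solvesBlackfoldEquations_iff (hn : 1 ≤ n) (hm : IsMinimalSurface Set.univ X)
    (hχ : Continuous χ) :
    SolvesBlackfoldEquations n (planeWaveMetric A) (typeII (n + 4) X) (velocityField Ω χ)
      (timelikeRegion A X Ω χ) ↔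
    ∀ σ, 0 < surfaceModulusSq A X Ω χ σ → ∀ ν, IsNormal X σ ν →
      ∑ i, ν i * (A (incl3 n i) * X σ i + Ω ^ 2 * ∑ a, ∑ b, χ σ a * χ σ b *
        pd a (fun r => pd b (fun σ => X σ i) r) σ) = 0 := by
  have hX : ContDiff ℝ ∞ X := contDiffOn_univ.1 hm.1
  have hu := fun s : Fin 2 ⊕ Fin 2 → ℝ =>
    isUnit_inducedMetric (hX.differentiable (by simp) fun j => s (Sum.inr j)) (hm.2.1 _ trivial)
  have key := fun (s : Fin 2 ⊕ Fin 2 → ℝ) (hs : s ∈ timelikeRegion A X Ω χ) =>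
    extrinsicEquation_typeII_iff A hn hX.contDiffAt (hu s) (hm.2.2 _ trivial) Ω χ hs
  constructor
  · rintro ⟨h, -⟩ σ hσ
    have hs : (Sum.elim 0 σ : Fin 2 ⊕ Fin 2 → ℝ) ∈ timelikeRegion A X Ω χ :=
      (mem_timelikeRegion hX).2 hσ
    exact (key _ hs).1 (h _ hs).2
  · intro h
    refine ⟨fun s hs => ⟨hs, (key s hs).2 (h _ ((mem_timelikeRegion hX).1 hs))⟩, fun s hs => ?_⟩
    have hc : Continuous fun s : Fin 2 ⊕ Fin 2 → ℝ =>
        surfaceModulusSq A X Ω χ (fun j => s (Sum.inr j)) :=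
      (continuous_surfaceModulusSq hX hχ).comp surfaceCoord.continuous
    have he : timelikeRegion A X Ω χ
        = {s | 0 < surfaceModulusSq A X Ω χ (fun j => s (Sum.inr j))} :=
      Set.ext fun s => mem_timelikeRegion hX
    rw [he] at hs
    rw [modulusSq_typeII A (hX.differentiable (by simp) _)]
    exact (frontier_lt_subset_eq continuous_const hc hs).symm

end Blackfold

/-! ### Surfaces with known partial derivatives. -/

section Partials

variable {X X₀ X₁ Y₀₀ Y₀₁ Y₁₀ Y₁₁ : (Fin 2 → ℝ) → (Fin 3 → ℝ)}

/-- The linear map `y ↦ y₀ u + y₁ v`. -/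
noncomputable def partialsMap (u v : Fin 3 → ℝ) : (Fin 2 → ℝ) →L[ℝ] (Fin 3 → ℝ) :=
  (ContinuousLinearMap.proj (R := ℝ) (φ := fun _ : Fin 2 => ℝ) 0).smulRight u
    + (ContinuousLinearMap.proj (R := ℝ) (φ := fun _ : Fin 2 => ℝ) 1).smulRight v

@[simp] theorem partialsMap_apply (u v : Fin 3 → ℝ) (y : Fin 2 → ℝ) :
    partialsMap u v y = y 0 • u + y 1 • v := rfl

/-- The surface `X` has the partial derivatives `X₀` and `X₁`. -/
def HasPartials (X X₀ X₁ : (Fin 2 → ℝ) → (Fin 3 → ℝ)) : Prop :=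
  ∀ σ, HasFDerivAt X (partialsMap (X₀ σ) (X₁ σ)) σ

namespace HasPartials

theorem differentiable (h : HasPartials X X₀ X₁) : Differentiable ℝ X :=
  fun σ => (h σ).differentiableAt

theorem fderiv_apply (h : HasPartials X X₀ X₁) (σ y : Fin 2 → ℝ) :
    fderiv ℝ X σ y = y 0 • X₀ σ + y 1 • X₁ σ := by
  rw [(h σ).fderiv, partialsMap_apply]

theorem fderiv_coordField (h : HasPartials X X₀ X₁) (σ : Fin 2 → ℝ) :
    fderiv ℝ X σ (coordField σ) = X₁ σ := by
  simp [h.fderiv_apply, coordField]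

theorem pd_zero (h : HasPartials X X₀ X₁) (i : Fin 3) (σ : Fin 2 → ℝ) :
    pd 0 (fun r => X r i) σ = X₀ σ i := by
  rw [pd_component (h.differentiable σ), h.fderiv_apply]
  simp

theorem pd_one (h : HasPartials X X₀ X₁) (i : Fin 3) (σ : Fin 2 → ℝ) :
    pd 1 (fun r => X r i) σ = X₁ σ i := by
  rw [pd_component (h.differentiable σ), h.fderiv_apply]
  simp

theorem isNormal_iff (h : HasPartials X X₀ X₁) {σ : Fin 2 → ℝ} {ν : Fin 3 → ℝ} :
    IsNormal X σ ν ↔ ν ⬝ᵥ X₀ σ = 0 ∧ ν ⬝ᵥ X₁ σ = 0 := by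
  simp only [IsNormal, Fin.forall_fin_two, h.pd_zero, h.pd_one, dotProduct]

/-- In orthogonal coordinates the induced metric is diagonal, and clearing its denominators turns
the trace of the second fundamental form into `hm`. -/
theorem isMinimalSurface (hX : ContDiff ℝ ∞ X) (h : HasPartials X X₀ X₁)
    (h0 : HasPartials X₀ Y₀₀ Y₀₁) (h1 : HasPartials X₁ Y₁₀ Y₁₁)
    (p0 : ∀ σ, 0 < X₀ σ ⬝ᵥ X₀ σ) (p1 : ∀ σ, 0 < X₁ σ ⬝ᵥ X₁ σ) (p01 : ∀ σ, X₀ σ ⬝ᵥ X₁ σ = 0)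
    (hm : ∀ σ ν, ν ⬝ᵥ X₀ σ = 0 → ν ⬝ᵥ X₁ σ = 0 →
      (X₁ σ ⬝ᵥ X₁ σ) * (ν ⬝ᵥ Y₀₀ σ) + (X₀ σ ⬝ᵥ X₀ σ) * (ν ⬝ᵥ Y₁₁ σ) = 0) :
    IsMinimalSurface Set.univ X := by
  refine ⟨hX.contDiffOn, fun σ _ => ?_, fun σ _ ν hν => ?_⟩
  · rw [injective_iff_map_eq_zero]
    intro y hy
    rw [h.fderiv_apply] at hy
    have e0 := congrArg (fun z => X₀ σ ⬝ᵥ z) hy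
    have e1 := congrArg (fun z => X₁ σ ⬝ᵥ z) hy
    simp only [dotProduct_add, dotProduct_smul, p01, dotProduct_comm (X₁ σ) (X₀ σ), smul_eq_mul,
      mul_zero, add_zero, zero_add, dotProduct_zero, mul_eq_zero, (p0 σ).ne', (p1 σ).ne',
      or_false] at e0 e1
    funext i
    fin_cases i
    exacts [e0, e1]
  · obtain ⟨n0, n1⟩ := h.isNormal_iff.1 hν
    have hg : inducedMetric (fun _ => 1) X σ
        = Matrix.diagonal ![X₀ σ ⬝ᵥ X₀ σ, X₁ σ ⬝ᵥ X₁ σ] := by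
      have e := p01 σ
      have e' := p01 σ
      rw [dotProduct_comm] at e'
      ext i j
      fin_cases i <;> fin_cases j <;>
        simp [inducedMetric_one_apply, h.pd_zero, h.pd_one, ← dotProduct.eq_1, e, e']
    have hg' : (inducedMetric (fun _ => 1) X σ)⁻¹
        = Matrix.diagonal ![(X₀ σ ⬝ᵥ X₀ σ)⁻¹, (X₁ σ ⬝ᵥ X₁ σ)⁻¹] := by
      rw [hg]
      refine Matrix.inv_eq_right_inv ?_
      rw [Matrix.diagonal_mul_diagonal, ← Matrix.diagonal_one]
      congr 1
      funext i
      fin_cases i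
      · exact mul_inv_cancel₀ (p0 σ).ne'
      · exact mul_inv_cancel₀ (p1 σ).ne'
    have e0 : ∀ i, (fun r => pd 0 (fun σ => X σ i) r) = fun r => X₀ r i :=
      fun i => funext fun r => h.pd_zero i r
    have e1 : ∀ i, (fun r => pd 1 (fun σ => X σ i) r) = fun r => X₁ r i :=
      fun i => funext fun r => h.pd_one i r
    have hm' := hm σ ν n0 n1
    simp only [meanCurvature, hg', extrinsicCurvature_one, Fin.sum_univ_two, e0, e1, h0.pd_zero,
      h1.pd_one]
    simp only [← dotProduct.eq_1, Matrix.diagonal_apply_eq, Matrix.cons_val_zero,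
      Matrix.cons_val_one, ne_eq, Fin.reduceEq, not_false_eq_true, Matrix.diagonal_apply_ne,
      zero_mul, add_zero, zero_add]
    have := (p0 σ).ne'
    have := (p1 σ).ne'
    field_simp
    linarith

theorem solvesBlackfoldEquations_iff {n : ℕ} (hn : 1 ≤ n) {A : Fin (n + 4) → ℝ} {Ω : ℝ}
    (hm : IsMinimalSurface Set.univ X) (h : HasPartials X X₀ X₁) (h1 : HasPartials X₁ Y₁₀ Y₁₁) :
    SolvesBlackfoldEquations n (planeWaveMetric A) (typeII (n + 4) X) (velocityField Ω coordField)
      (timelikeRegion A X Ω coordField) ↔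
    ∀ σ, 0 < surfaceModulusSq A X Ω coordField σ → ∀ ν, ν ⬝ᵥ X₀ σ = 0 → ν ⬝ᵥ X₁ σ = 0 →
      ∑ i, ν i * (A (incl3 n i) * X σ i + Ω ^ 2 * Y₁₁ σ i) = 0 := by
  rw [_root_.solvesBlackfoldEquations_iff hn hm (χ := coordField) continuous_const]
  have e1 : ∀ i, (fun r => pd 1 (fun σ => X σ i) r) = fun r => X₁ r i :=
    fun i => funext fun r => h.pd_one i r
  simp only [h.isNormal_iff, and_imp, coordField, Fin.sum_univ_two, e1, h1.pd_one]
  simp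

end HasPartials

end Partials

/-! ### Surfaces swept out by a curve under a screw motion. -/

section ScrewSurface

variable {n : ℕ} {A : Fin (n + 4) → ℝ} {Ω a b e d : ℝ} {f g f' g' f'' g'' : ℝ → ℝ}

/-- The surface swept out by a curve under a screw motion, in the coordinates `(ρ, φ)`. -/
noncomputable def screwSurface (a b e d : ℝ) (f g : ℝ → ℝ) (σ : Fin 2 → ℝ) : Fin 3 → ℝ :=
  ![f (σ 0) * Real.cos (a * σ 1) - g (σ 0) * Real.sin (a * σ 1),
    f (σ 0) * Real.sin (a * σ 1) + g (σ 0) * Real.cos (a * σ 1), b * σ 1 + e * σ 0 + d]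

theorem contDiff_screwSurface (hf : ContDiff ℝ ∞ f) (hg : ContDiff ℝ ∞ g) :
    ContDiff ℝ ∞ (screwSurface a b e d f g) := by
  rw [contDiff_pi]
  intro i
  have h : ∀ j, ContDiff ℝ ∞ fun σ : Fin 2 → ℝ => σ j := fun j => by fun_prop
  have hf' := hf.comp (h 0)
  have hg' := hg.comp (h 0)
  simp only [Function.comp_def] at hf' hg'
  fin_cases i <;> simp only [screwSurface, Fin.zero_eta, Fin.mk_one, Fin.reduceFinMk,
    Matrix.cons_val] <;> fun_prop

theorem hasPartials_screwSurface (hf : ∀ x, HasDerivAt f (f' x) x)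
    (hg : ∀ x, HasDerivAt g (g' x) x) :
    HasPartials (screwSurface a b e d f g) (screwSurface a 0 0 e f' g')
      (screwSurface a 0 0 b (fun x => -(a * g x)) (fun x => a * f x)) := by
  intro σ
  rw [hasFDerivAt_pi']
  have h0 := hasFDerivAt_coord 0 σ
  have h1 := hasFDerivAt_coord 1 σ
  have hF := (hf (σ 0)).comp_hasFDerivAt σ h0
  have hG := (hg (σ 0)).comp_hasFDerivAt σ h0
  have hc := (h1.const_mul a).cos
  have hs := (h1.const_mul a).sin
  simp only [Function.comp_def] at hF hG
  intro i
  fin_cases i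
  · refine ((hF.mul hc).sub (hG.mul hs)).congr_fderiv ?_
    ext y
    simp [screwSurface]
    ring
  · refine ((hF.mul hs).add (hG.mul hc)).congr_fderiv ?_
    ext y
    simp [screwSurface]
    ring
  · refine (((h1.const_mul b).add (h0.const_mul e)).add_const d).congr_fderiv ?_
    ext y
    simp [screwSurface]
    ring

theorem screwSurface_dotProduct {b₁ e₁ d₁ b₂ e₂ d₂ : ℝ} {f₁ g₁ f₂ g₂ : ℝ → ℝ} (σ : Fin 2 → ℝ) :
    screwSurface a b₁ e₁ d₁ f₁ g₁ σ ⬝ᵥ screwSurface a b₂ e₂ d₂ f₂ g₂ σ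
      = f₁ (σ 0) * f₂ (σ 0) + g₁ (σ 0) * g₂ (σ 0)
        + (b₁ * σ 1 + e₁ * σ 0 + d₁) * (b₂ * σ 1 + e₂ * σ 0 + d₂) := by
  simp only [screwSurface, dotProduct, Fin.sum_univ_three, Matrix.cons_val]
  linear_combination (f₁ (σ 0) * f₂ (σ 0) + g₁ (σ 0) * g₂ (σ 0))
    * Real.cos_sq_add_sin_sq (a * σ 1)

/-- With `E`, `G` the squared lengths of the coordinate vectors `X₀`, `X₁`, minimality holds if `G
X₀₀ + E X₁₁` is tangent. Here that vector is `α X₀`; it is horizontal while `X₀` has height `e`,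
hence the condition `α e = 0`. -/
theorem isMinimalSurface_screwSurface (hfs : ContDiff ℝ ∞ f) (hgs : ContDiff ℝ ∞ g)
    (hf : ∀ x, HasDerivAt f (f' x) x) (hg : ∀ x, HasDerivAt g (g' x) x)
    (hf' : ∀ x, HasDerivAt f' (f'' x) x) (hg' : ∀ x, HasDerivAt g' (g'' x) x)
    (p0 : ∀ x, 0 < f' x ^ 2 + g' x ^ 2 + e ^ 2)
    (p1 : ∀ x, 0 < a ^ 2 * (f x ^ 2 + g x ^ 2) + b ^ 2)
    (p01 : ∀ x, a * (f x * g' x - g x * f' x) + e * b = 0) (α : ℝ → ℝ)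
    (hα : ∀ x, α x * e = 0)
    (hmf : ∀ x, (a ^ 2 * (f x ^ 2 + g x ^ 2) + b ^ 2) * f'' x
      - a ^ 2 * (f' x ^ 2 + g' x ^ 2 + e ^ 2) * f x = α x * f' x)
    (hmg : ∀ x, (a ^ 2 * (f x ^ 2 + g x ^ 2) + b ^ 2) * g'' x
      - a ^ 2 * (f' x ^ 2 + g' x ^ 2 + e ^ 2) * g x = α x * g' x) :
    IsMinimalSurface Set.univ (screwSurface a b e d f g) := by
  have h := hasPartials_screwSurface (a := a) (b := b) (e := e) (d := d) hf hg
  have h0 := hasPartials_screwSurface (a := a) (b := 0) (e := 0) (d := e) hf' hg'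
  have h1 := hasPartials_screwSurface (a := a) (b := 0) (e := 0) (d := b)
    (fun x => ((hg x).const_mul a).neg) (fun x => (hf x).const_mul a)
  have q0 : ∀ σ : Fin 2 → ℝ, screwSurface a 0 0 e f' g' σ ⬝ᵥ screwSurface a 0 0 e f' g' σ
      = f' (σ 0) ^ 2 + g' (σ 0) ^ 2 + e ^ 2 := by
    intro σ
    rw [screwSurface_dotProduct]
    ring
  have q1 : ∀ σ : Fin 2 → ℝ, screwSurface a 0 0 b (fun x => -(a * g x)) (fun x => a * f x) σ ⬝ᵥ
      screwSurface a 0 0 b (fun x => -(a * g x)) (fun x => a * f x) σ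
      = a ^ 2 * (f (σ 0) ^ 2 + g (σ 0) ^ 2) + b ^ 2 := by
    intro σ
    rw [screwSurface_dotProduct]
    ring
  refine HasPartials.isMinimalSurface (contDiff_screwSurface hfs hgs) h h0 h1 (fun σ => ?_)
    (fun σ => ?_) (fun σ => ?_) (fun σ ν n0 n1 => ?_)
  · rw [q0]
    exact p0 _
  · rw [q1]
    exact p1 _
  · rw [screwSurface_dotProduct]
    linear_combination p01 (σ 0)
  · rw [q0, q1]
    simp only [screwSurface, dotProduct, Fin.sum_univ_three, Matrix.cons_val, Pi.neg_apply] at n0 ⊢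
    linear_combination α (σ 0) * n0 - ν 2 * hα (σ 0)
      + (ν 0 * Real.cos (a * σ 1) + ν 1 * Real.sin (a * σ 1)) * hmf (σ 0)
      + (-ν 0 * Real.sin (a * σ 1) + ν 1 * Real.cos (a * σ 1)) * hmg (σ 0)

theorem fderiv_screwSurface_coordField (hf : ∀ x, HasDerivAt f (f' x) x)
    (hg : ∀ x, HasDerivAt g (g' x) x) (σ : Fin 2 → ℝ) :
    fderiv ℝ (screwSurface a b e d f g) σ (coordField σ)
      = screwField a b (screwSurface a b e d f g σ) := by
  rw [(hasPartials_screwSurface hf hg).fderiv_coordField]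
  funext i
  fin_cases i <;> simp [screwSurface, screwField] <;> ring

theorem surfaceModulusSq_screwSurface (hf : ∀ x, HasDerivAt f (f' x) x)
    (hg : ∀ x, HasDerivAt g (g' x) x) (h01 : A 0 = A 1) (σ : Fin 2 → ℝ) :
    surfaceModulusSq A (screwSurface a b e d f g) Ω coordField σ
      = 1 + A 0 * (f (σ 0) ^ 2 + g (σ 0) ^ 2) + A 2 * (b * σ 1 + e * σ 0 + d) ^ 2
        - Ω ^ 2 * (a ^ 2 * (f (σ 0) ^ 2 + g (σ 0) ^ 2) + b ^ 2) := by
  have i0 : incl3 n 0 = 0 := rfl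
  have i1 : incl3 n 1 = 1 := rfl
  simp only [surfaceModulusSq, fderiv_screwSurface_coordField hf hg, screwField, screwSurface,
    Fin.sum_univ_three, Matrix.cons_val, i0, i1, incl3_two, ← h01]
  linear_combination (A 0 - Ω ^ 2 * a ^ 2) * (f (σ 0) ^ 2 + g (σ 0) ^ 2)
    * Real.cos_sq_add_sin_sq (a * σ 1)

/-- The parameter `x₀` marks a point of the curve with `g = 0` and no height of its own. On its
orbit position and height are explicit, and two angles are enough to test stationarity. -/
theorem isStationaryBlackfold_screwSurface_iff (hn : 1 ≤ n) (ha : 0 < a)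
    (hm : IsMinimalSurface Set.univ (screwSurface a b e 0 f g))
    (hf : ∀ x, HasDerivAt f (f' x) x) (hg : ∀ x, HasDerivAt g (g' x) x)
    {x₀ : ℝ} (hf0 : f x₀ ≠ 0) (hg0 : g x₀ = 0) (he : e * x₀ = 0) :
    IsStationaryBlackfold n A (screwSurface a b e 0 f g) Ω coordField ↔
      A 0 = A 1 ∧ b * A 2 = 0 ∧
      (∃ x y : ℝ, 0 < 1 + A 0 * (f x ^ 2 + g x ^ 2) + A 2 * (b * y + e * x) ^ 2
        - Ω ^ 2 * (a ^ 2 * (f x ^ 2 + g x ^ 2) + b ^ 2)) ∧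
      ∀ x y : ℝ, 0 < 1 + A 0 * (f x ^ 2 + g x ^ 2) + A 2 * (b * y + e * x) ^ 2
        - Ω ^ 2 * (a ^ 2 * (f x ^ 2 + g x ^ 2) + b ^ 2) →
        ∀ ν, ν ⬝ᵥ screwSurface a 0 0 e f' g' ![x, y] = 0 →
          ν ⬝ᵥ screwField a b (screwSurface a b e 0 f g ![x, y]) = 0 →
          (A 0 - a ^ 2 * Ω ^ 2) * (ν 0 * screwSurface a b e 0 f g ![x, y] 0
            + ν 1 * screwSurface a b e 0 f g ![x, y] 1) + ν 2 * (A 2 * (b * y + e * x)) = 0 := by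
  have h := hasPartials_screwSurface (a := a) (b := b) (e := e) (d := 0) hf hg
  have h1 := hasPartials_screwSurface (a := a) (b := 0) (e := 0) (d := b)
    (fun x => ((hg x).const_mul a).neg) (fun x => (hf x).const_mul a)
  have hX : ContDiff ℝ ∞ (screwSurface a b e 0 f g) := contDiffOn_univ.1 hm.1
  have hst : IsStationarySurface A Set.univ (screwSurface a b e 0 f g) coordField ↔
      A 0 = A 1 ∧ b * A 2 = 0 := by
    constructor
    · intro hs
      have key := fun y => hs.profile_screwField h.differentiable
        (fderiv_screwSurface_coordField hf hg) ![x₀, y]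
      simp only [screwSurface, Matrix.cons_val, hg0, he, zero_mul, sub_zero, add_zero] at key
      have hb : b * A 2 = 0 := by
        -- At the angle `π` the product of the horizontal coordinates vanishes while the height is
        -- `bπ/a`, which isolates `b A₂`.
        have := key (Real.pi / a)
        rw [mul_div_cancel₀ _ ha.ne', Real.sin_pi] at this
        have h3 : b * A 2 * (b * (Real.pi / a)) = 0 := by linarith
        rcases mul_eq_zero.1 h3 with h3 | h3
        · exact h3
        · rcases mul_eq_zero.1 h3 with h3 | h3
          · simp [h3]
          · exact absurd h3 (div_pos Real.pi_pos ha).ne'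
      refine ⟨?_, hb⟩
      -- At the angle `π/4` the product of the horizontal coordinates is `f(x₀)²/2 ≠ 0`.
      have := key (Real.pi / 4 / a)
      rw [mul_div_cancel₀ _ ha.ne', hb, Real.cos_pi_div_four, Real.sin_pi_div_four] at this
      have h2 : (√2 : ℝ) ^ 2 = 2 := Real.sq_sqrt (by norm_num)
      have h3 : a * (f x₀ ^ 2 / 2) * (A 1 - A 0) = 0 := by
        linear_combination this - a * (A 1 - A 0) * f x₀ ^ 2 / 4 * h2
      rcases mul_eq_zero.1 h3 with h3 | h3
      · exact absurd h3 (by positivity)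
      · linarith
    · rintro ⟨h01, h2⟩
      refine isStationarySurface_of_screwField h.differentiable ⟨0, ?_⟩
        (fderiv_screwSurface_coordField hf hg) h01 h2
      intro h0
      simpa [coordField] using congrFun h0 1
  have hσ : ∀ {P : (Fin 2 → ℝ) → Prop}, (∀ σ, P σ) ↔ ∀ x y, P ![x, y] := by
    intro P
    refine ⟨fun H x y => H _, fun H σ => ?_⟩
    have := H (σ 0) (σ 1)
    rwa [← List.ofFn_inj.1 (by simp : List.ofFn σ = List.ofFn ![σ 0, σ 1])] at this
  have hσ' : ∀ {P : (Fin 2 → ℝ) → Prop}, (∃ σ, P σ) ↔ ∃ x y, P ![x, y] := by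
    intro P
    have := hσ (P := fun σ => ¬ P σ)
    rw [← not_iff_not]
    simpa using this
  rw [IsStationaryBlackfold, hst, and_assoc]
  refine and_congr_right fun h01 => and_congr_right fun h2 => ?_
  rw [timelikeRegion_nonempty_iff hX, h.solvesBlackfoldEquations_iff hn hm h1, hσ, hσ']
  simp only [surfaceModulusSq_screwSurface hf hg h01, add_zero, Matrix.cons_val_zero,
    Matrix.cons_val_one]
  refine and_congr_right fun _ => forall_congr' fun x => forall_congr' fun y =>
    forall_congr' fun _ => forall_congr' fun ν => forall_congr' fun _ => ?_
  rw [← h.fderiv_coordField, fderiv_screwSurface_coordField hf hg]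
  refine forall_congr' fun _ => ?_
  have i0 : incl3 n 0 = 0 := rfl
  have i1 : incl3 n 1 = 1 := rfl
  simp only [Fin.sum_univ_three, i0, i1, incl3_two, ← h01, screwSurface, Matrix.cons_val,
    Pi.neg_apply]
  constructor <;> intro H <;> linear_combination H

end ScrewSurface

/-! ### The plane. -/

section Plane

variable {n : ℕ} {A : Fin (n + 4) → ℝ}

theorem hasPartials_planeSurface :
    HasPartials planeSurface (fun _ => ![1, 0, 0]) (fun _ => ![0, 1, 0]) := by
  intro σ
  rw [hasFDerivAt_pi']
  intro i
  fin_cases i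
  · refine (hasFDerivAt_coord 0 σ).congr_fderiv ?_
    ext y
    simp
  · refine (hasFDerivAt_coord 1 σ).congr_fderiv ?_
    ext y
    simp
  · refine (hasFDerivAt_const (0 : ℝ) σ).congr_fderiv ?_
    ext y
    simp

theorem hasPartials_const (v : Fin 3 → ℝ) :
    HasPartials (fun _ => v) (fun _ => 0) (fun _ => 0) := by
  intro σ
  refine (hasFDerivAt_const v σ).congr_fderiv ?_
  ext y
  simp

theorem contDiff_planeSurface : ContDiff ℝ ∞ planeSurface := by
  rw [contDiff_pi]
  intro i
  fin_cases i <;> simp only [planeSurface, Fin.zero_eta, Fin.mk_one, Fin.reduceFinMk,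
    Matrix.cons_val] <;> fun_prop

theorem isMinimalSurface_planeSurface : IsMinimalSurface Set.univ planeSurface :=
  hasPartials_planeSurface.isMinimalSurface contDiff_planeSurface (hasPartials_const _)
    (hasPartials_const _) (by simp [dotProduct, Fin.sum_univ_three])
    (by simp [dotProduct, Fin.sum_univ_three]) (by simp [dotProduct, Fin.sum_univ_three])
    (by simp)

theorem fderiv_planeSurface_rotField (a : ℝ) (σ : Fin 2 → ℝ) :
    fderiv ℝ planeSurface σ (rotField a σ) = screwField a 0 (planeSurface σ) := by
  rw [hasPartials_planeSurface.fderiv_apply]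
  funext i
  fin_cases i <;> simp [rotField, screwField, planeSurface]

/-- Normals have only a third component, and there both the position and the second derivatives
vanish, whatever the profile and `Ω` are. -/
theorem solvesBlackfoldEquations_planeSurface (hn : 1 ≤ n) (a Ω : ℝ) :
    SolvesBlackfoldEquations n (planeWaveMetric A) (typeII (n + 4) planeSurface)
      (velocityField Ω (rotField a)) (timelikeRegion A planeSurface Ω (rotField a)) := by
  have hc : Continuous (rotField a) := by
    refine continuous_pi fun i => ?_
    fin_cases i <;> simp only [rotField, Fin.zero_eta, Fin.mk_one, Matrix.cons_val] <;> fun_prop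
  rw [solvesBlackfoldEquations_iff hn isMinimalSurface_planeSurface hc]
  intro σ _ ν hν
  obtain ⟨n0, n1⟩ := hasPartials_planeSurface.isNormal_iff.1 hν
  simp only [dotProduct, Fin.sum_univ_three, Matrix.cons_val, mul_one, mul_zero, add_zero,
    zero_add] at n0 n1
  simp [Fin.sum_univ_three, n0, n1, planeSurface]

theorem isStationaryBlackfold_planeSurface_iff (hn : 1 ≤ n) {a : ℝ} (ha : 0 < a) (Ω : ℝ) :
    IsStationaryBlackfold n A planeSurface Ω (rotField a) ↔ A 0 = A 1 := by
  constructor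
  · rintro ⟨hst, -⟩
    have := hst.profile_screwField hasPartials_planeSurface.differentiable
      (fderiv_planeSurface_rotField a) ![1, 1]
    simp [planeSurface, ha.ne'] at this
    linarith
  · intro h01
    refine ⟨isStationarySurface_of_screwField hasPartials_planeSurface.differentiable
      ⟨![1, 0], fun h => ?_⟩ (fderiv_planeSurface_rotField a) h01 (zero_mul _),
      (timelikeRegion_nonempty_iff contDiff_planeSurface).2 ⟨0, ?_⟩,
      solvesBlackfoldEquations_planeSurface hn a Ω⟩
    · have := congrFun h 1
      simp [rotField, ha.ne'] at this
    · simp only [surfaceModulusSq, fderiv_planeSurface_rotField]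
      simp [planeSurface, screwField, Fin.sum_univ_three]

end Plane

/-! ### The helicoid, the catenoid and Scherk's second surface. -/

section Instances

variable {n : ℕ} {A : Fin (n + 4) → ℝ} {a c l lam Ω : ℝ}

theorem helicoid_eq_screwSurface (a lam : ℝ) :
    helicoid a lam = screwSurface a lam 0 0 (fun x => x) (fun _ => 0) := by
  funext σ
  simp [helicoid, screwSurface]

theorem isMinimalSurface_helicoid (hlam : 0 < lam) :
    IsMinimalSurface Set.univ (helicoid a lam) := by
  rw [helicoid_eq_screwSurface]
  refine isMinimalSurface_screwSurface (f' := fun _ => 1) (f'' := fun _ => 0) (g' := fun _ => 0)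
    (g'' := fun _ => 0) contDiff_id contDiff_const hasDerivAt_id' (fun x => hasDerivAt_const x 0)
    (fun x => hasDerivAt_const x 1) (fun x => hasDerivAt_const x 0) (fun x => by norm_num)
    (fun x => by positivity) (fun x => by ring) (fun x => -(a ^ 2 * x)) (fun x => by ring)
    (fun x => by ring) (fun x => by ring)

/-- Here `𝐤² = 1 - Ω²λ² + (A₀ - a²Ω²)ρ²`, which is positive somewhere exactly under the last
condition. The extrinsic equation is automatic: the horizontal position is a multiple of the ruling,
hence tangent. -/
theorem isStationaryBlackfold_helicoid_iff (hn : 1 ≤ n) (ha : 0 < a) (hlam : 0 < lam) :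
    IsStationaryBlackfold n A (helicoid a lam) Ω coordField ↔
      A 0 = A 1 ∧ A 2 = 0 ∧ (Ω ^ 2 * lam ^ 2 < 1 ∨ a ^ 2 * Ω ^ 2 < A 0) := by
  have hm := isMinimalSurface_helicoid (a := a) hlam
  rw [helicoid_eq_screwSurface] at hm ⊢
  rw [isStationaryBlackfold_screwSurface_iff hn ha hm hasDerivAt_id'
    (fun x => hasDerivAt_const x 0) (x₀ := 1) one_ne_zero rfl (zero_mul _)]
  simp only [mul_eq_zero, hlam.ne', false_or]
  refine and_congr_right fun h01 => and_congr_right fun h2 => ?_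
  constructor
  · rintro ⟨⟨x, y, hxy⟩, -⟩
    by_contra! H
    rw [h2] at hxy
    nlinarith [mul_nonneg (sub_nonneg.2 H.2) (sq_nonneg x)]
  · intro H
    refine ⟨?_, fun x y _ ν n0 n1 => ?_⟩
    · simp only [h2]
      rcases H with H | H
      · exact ⟨0, 0, by linarith⟩
      · have hδ : 0 < A 0 - a ^ 2 * Ω ^ 2 := sub_pos.2 H
        -- The radius at which `(A₀ - a²Ω²)ρ²` compensates `Ω²λ²`, so that `𝐤² = 1`.
        refine ⟨√(Ω ^ 2 * lam ^ 2 / (A 0 - a ^ 2 * Ω ^ 2)), 0, ?_⟩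
        rw [Real.sq_sqrt (by positivity)]
        have : (A 0 - a ^ 2 * Ω ^ 2) * (Ω ^ 2 * lam ^ 2 / (A 0 - a ^ 2 * Ω ^ 2))
          = Ω ^ 2 * lam ^ 2 := mul_div_cancel₀ _ hδ.ne'
        linarith
    · simp only [screwSurface, dotProduct, Fin.sum_univ_three, Matrix.cons_val] at n0 ⊢
      rw [h2]
      linear_combination (A 0 - a ^ 2 * Ω ^ 2) * x * n0

theorem hasDerivAt_cosh_div (c x : ℝ) (k : ℝ) :
    HasDerivAt (fun x => k * Real.cosh (x / c)) (k / c * Real.sinh (x / c)) x := by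
  refine (((Real.hasDerivAt_cosh _).comp x
    ((hasDerivAt_id' x).div_const c)).const_mul k).congr_deriv ?_
  ring

theorem hasDerivAt_sinh_div (c x : ℝ) (k : ℝ) :
    HasDerivAt (fun x => k * Real.sinh (x / c)) (k / c * Real.cosh (x / c)) x := by
  refine (((Real.hasDerivAt_sinh _).comp x
    ((hasDerivAt_id' x).div_const c)).const_mul k).congr_deriv ?_
  ring

theorem contDiff_cosh_div (c k : ℝ) : ContDiff ℝ ∞ fun x => k * Real.cosh (x / c) :=
  contDiff_const.mul (Real.contDiff_cosh.comp (contDiff_id.div_const c))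

theorem contDiff_sinh_div (c k : ℝ) : ContDiff ℝ ∞ fun x => k * Real.sinh (x / c) :=
  contDiff_const.mul (Real.contDiff_sinh.comp (contDiff_id.div_const c))

/-- The minimal surfaces `screwSurface` over a hyperbola, including catenoids and
Scherk's second surfaces. -/
theorem isMinimalSurface_hyperbolic {m : ℝ} (ha : 0 < a) (hc : 0 < c) (hml : m ^ 2 + l ^ 2 = 1) :
    IsMinimalSurface Set.univ (screwSurface a (l * a * c) m 0
      (fun x => m * c * Real.cosh (x / c)) (fun x => -(l * c) * Real.sinh (x / c))) := by
  have hs : ∀ x, Real.sinh (x / c) ^ 2 = Real.cosh (x / c) ^ 2 - 1 := fun x => by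
    rw [Real.cosh_sq]
    ring
  -- The two squared lengths are `cosh²` and `a²c² cosh²`. Since `f'' = f/c²` and `g'' = g/c²`, the
  -- minimality condition holds with `α = 0`.
  have q0 : ∀ x, (m * c / c * Real.sinh (x / c)) ^ 2 + (-(l * c) / c * Real.cosh (x / c)) ^ 2
      + m ^ 2 = Real.cosh (x / c) ^ 2 := by
    intro x
    field_simp
    linear_combination m ^ 2 * hs x + Real.cosh (x / c) ^ 2 * hml
  have q1 : ∀ x, a ^ 2 * ((m * c * Real.cosh (x / c)) ^ 2 + (-(l * c) * Real.sinh (x / c)) ^ 2)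
      + (l * a * c) ^ 2 = a ^ 2 * c ^ 2 * Real.cosh (x / c) ^ 2 := by
    intro x
    linear_combination a ^ 2 * c ^ 2 * (l ^ 2 * hs x + Real.cosh (x / c) ^ 2 * hml)
  refine isMinimalSurface_screwSurface (contDiff_cosh_div _ _) (contDiff_sinh_div _ _)
    (fun x => hasDerivAt_cosh_div _ _ _) (fun x => hasDerivAt_sinh_div _ _ _)
    (fun x => hasDerivAt_sinh_div _ _ _) (fun x => hasDerivAt_cosh_div _ _ _)
    (fun x => ?_) (fun x => ?_) (fun x => ?_) 0 (fun x => zero_mul _) (fun x => ?_) (fun x => ?_)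
  · rw [q0]
    positivity
  · rw [q1]
    positivity
  · field_simp
    linear_combination l * m * a * c * hs x
  · rw [q0, q1, Pi.zero_apply]
    field_simp
    ring
  · rw [q0, q1, Pi.zero_apply]
    field_simp
    ring

theorem catenoid_eq_screwSurface (a c : ℝ) :
    catenoid a c = screwSurface a (0 * a * c) 1 0 (fun x => 1 * c * Real.cosh (x / c))
      (fun x => -(0 * c) * Real.sinh (x / c)) := by
  funext σ
  simp [catenoid, screwSurface]

theorem isMinimalSurface_catenoid (ha : 0 < a) (hc : 0 < c) :
    IsMinimalSurface Set.univ (catenoid a c) := by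
  rw [catenoid_eq_screwSurface]
  exact isMinimalSurface_hyperbolic ha hc (by norm_num)

/-- Subtracting `1/c²` times the function from its second derivative leaves `(2q/c) cosh(x/c)`, so
`q = 0` and then `p = 0`. -/
theorem eq_zero_of_eventually_cosh_sinh (hc : 0 < c) {p q x₀ : ℝ}
    (h : ∀ᶠ x in nhds x₀, p * Real.cosh (x / c) + q * (x * Real.sinh (x / c)) = 0) :
    p = 0 ∧ q = 0 := by
  have hd : ∀ x, HasDerivAt (fun x => p * Real.cosh (x / c) + q * (x * Real.sinh (x / c)))
      ((p / c + q) * Real.sinh (x / c) + q / c * (x * Real.cosh (x / c))) x := by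
    intro x
    refine ((hasDerivAt_cosh_div c x p).add
      (((hasDerivAt_id' x).mul (hasDerivAt_sinh_div c x 1)).const_mul q)).congr_deriv ?_
          |>.congr_of_eventuallyEq ?_
    · ring
    · exact Filter.Eventually.of_forall fun x => by simp
  have hd' : ∀ x, HasDerivAt
      (fun x => (p / c + q) * Real.sinh (x / c) + q / c * (x * Real.cosh (x / c)))
      ((p / c + 2 * q) / c * Real.cosh (x / c) + q / c ^ 2 * (x * Real.sinh (x / c))) x := by
    intro x
    refine ((hasDerivAt_sinh_div c x (p / c + q)).add
      (((hasDerivAt_id' x).mul (hasDerivAt_cosh_div c x 1)).const_mul (q / c))).congr_deriv ?_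
          |>.congr_of_eventuallyEq ?_
    · ring
    · exact Filter.Eventually.of_forall fun x => by simp
  have h1 : ∀ᶠ x in nhds x₀,
      (p / c + q) * Real.sinh (x / c) + q / c * (x * Real.cosh (x / c)) = 0 := by
    filter_upwards [h.eventually_nhds] with x hx
    rw [← (hd x).deriv, Filter.EventuallyEq.deriv_eq (f := fun _ => 0) hx, deriv_const]
  have h2 : (p / c + 2 * q) / c * Real.cosh (x₀ / c)
      + q / c ^ 2 * (x₀ * Real.sinh (x₀ / c)) = 0 := by
    rw [← (hd' x₀).deriv, Filter.EventuallyEq.deriv_eq (f := fun _ => 0) h1, deriv_const]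
  have h0 := h.self_of_nhds
  have hC := (Real.cosh_pos (x₀ / c)).ne'
  have hq : q = 0 := by
    field_simp at h2
    have : 2 * c * Real.cosh (x₀ / c) * q = 0 := by linarith
    simpa [hc.ne', hC] using this
  refine ⟨?_, hq⟩
  simpa [hq, hC] using h0

theorem isStationaryBlackfold_catenoid_iff (hn : 1 ≤ n) (ha : 0 < a) (hc : 0 < c) :
    IsStationaryBlackfold n A (catenoid a c) Ω coordField ↔
      A 0 = a ^ 2 * Ω ^ 2 ∧ A 1 = a ^ 2 * Ω ^ 2 ∧ A 2 = 0 ∧ (Ω ≠ 0 → 0 < A 0) := by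
  have hm := isMinimalSurface_catenoid ha hc
  rw [catenoid_eq_screwSurface] at hm ⊢
  rw [isStationaryBlackfold_screwSurface_iff hn ha hm (fun x => hasDerivAt_cosh_div _ _ _)
    (fun x => hasDerivAt_sinh_div _ _ _) (x₀ := 0) (by simpa using hc.ne') (by simp) (by simp)]
  constructor
  · rintro ⟨h01, -, ⟨x₀, y₀, h0⟩, H⟩
    have hcont : Continuous fun x => 1 + A 0 * ((1 * c * Real.cosh (x / c)) ^ 2
        + (-(0 * c) * Real.sinh (x / c)) ^ 2) + A 2 * (0 * a * c * y₀ + 1 * x) ^ 2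
        - Ω ^ 2 * (a ^ 2 * ((1 * c * Real.cosh (x / c)) ^ 2
        + (-(0 * c) * Real.sinh (x / c)) ^ 2) + (0 * a * c) ^ 2) := by
      fun_prop
    have hev := hcont.continuousAt.eventually (lt_mem_nhds h0)
    -- The extrinsic equation is available only where `𝐤² > 0`; this set is open, so the equation
    -- holds for all nearby `x`. It is tested on the normal `(cos aφ, sin aφ, -sinh(x/c))`.
    have key : ∀ᶠ x in nhds x₀, (A 0 - a ^ 2 * Ω ^ 2) * c * Real.cosh (x / c)
        + -A 2 * (x * Real.sinh (x / c)) = 0 := by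
      filter_upwards [hev] with x hx
      have hcs := Real.cos_sq_add_sin_sq (a * y₀)
      have := H x y₀ hx ![Real.cos (a * y₀), Real.sin (a * y₀), -Real.sinh (x / c)] ?_ ?_
      · simp only [screwSurface, Matrix.cons_val] at this
        linear_combination this - (A 0 - a ^ 2 * Ω ^ 2) * c * Real.cosh (x / c) * hcs
      · simp only [screwSurface, dotProduct, Fin.sum_univ_three, Matrix.cons_val]
        field_simp
        linear_combination Real.sinh (x / c) * hcs
      · simp only [screwSurface, screwField, dotProduct, Fin.sum_univ_three, Matrix.cons_val]
        ring
    obtain ⟨h1, h2⟩ := eq_zero_of_eventually_cosh_sinh hc key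
    have h0' : A 0 = a ^ 2 * Ω ^ 2 := by
      have := (mul_eq_zero.1 h1).resolve_right hc.ne'
      linarith
    refine ⟨h0', h01 ▸ h0', by linarith, fun hΩ => ?_⟩
    rw [h0']
    positivity
  · rintro ⟨h0, h1, h2, -⟩
    -- Under these conditions `𝐤² = 1` on the whole catenoid.
    refine ⟨by rw [h0, h1], by simp, ⟨0, 0, ?_⟩, fun x y _ ν _ _ => ?_⟩
    · simp only [h0, h2]
      ring_nf
      norm_num
    · rw [h0, h2]
      ring

theorem scherk_eq_screwSurface (a c l : ℝ) :
    scherk a c l = screwSurface a (l * a * c) √(1 - l ^ 2) 0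
      (fun x => √(1 - l ^ 2) * c * Real.cosh (x / c)) (fun x => -(l * c) * Real.sinh (x / c)) := by
  funext σ i
  fin_cases i <;> simp [scherk, screwSurface] <;> ring

theorem isMinimalSurface_scherk (ha : 0 < a) (hc : 0 < c) (hl : 0 < l) (hl1 : l < 1) :
    IsMinimalSurface Set.univ (scherk a c l) := by
  rw [scherk_eq_screwSurface]
  refine isMinimalSurface_hyperbolic ha hc ?_
  rw [Real.sq_sqrt (by nlinarith)]
  ring

theorem isStationaryBlackfold_scherk_iff (hn : 1 ≤ n) (ha : 0 < a) (hc : 0 < c) (hl : 0 < l)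
    (hl1 : l < 1) :
    IsStationaryBlackfold n A (scherk a c l) Ω coordField ↔
      A 0 = a ^ 2 * Ω ^ 2 ∧ A 1 = a ^ 2 * Ω ^ 2 ∧ A 2 = 0 ∧ (Ω ≠ 0 → 0 < A 0) ∧
        a ^ 2 * c ^ 2 * l ^ 2 * Ω ^ 2 < 1 := by
  have hm := isMinimalSurface_scherk ha hc hl hl1
  have hpos : 0 < 1 - l ^ 2 := by nlinarith
  have hm0 : 0 < √(1 - l ^ 2) := Real.sqrt_pos.2 hpos
  rw [scherk_eq_screwSurface] at hm ⊢
  rw [isStationaryBlackfold_screwSurface_iff hn ha hm (fun x => hasDerivAt_cosh_div _ _ _)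
    (fun x => hasDerivAt_sinh_div _ _ _) (x₀ := 0) (by simp [hc.ne', hm0.ne']) (by simp) (by simp)]
  generalize √(1 - l ^ 2) = m at hm0
  constructor
  · rintro ⟨h01, h2, ⟨x, y, h0⟩, H⟩
    have h2' : A 2 = 0 := (mul_eq_zero.1 h2).resolve_left (by positivity)
    have hcs := Real.cos_sq_add_sin_sq (a * y)
    have hch := Real.cosh_sq_sub_sinh_sq (x / c)
    set C := Real.cosh (x / c) with hC
    set S := Real.sinh (x / c) with hS
    set X := screwSurface a (l * a * c) m 0 (fun x => m * c * Real.cosh (x / c))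
      (fun x => -(l * c) * Real.sinh (x / c)) ![x, y] with hX
    set V := screwField a (l * a * c) X with hV
    set R := screwSurface a 0 0 m (fun x => m * c / c * Real.sinh (x / c))
      (fun x => -(l * c) / c * Real.cosh (x / c)) ![x, y] with hR
    -- One timelike point suffices: `A₂ = 0` is already known from the nonzero pitch, and the
    -- pairing of the normal `R × V` with the horizontal position is strictly negative, so the
    -- coefficient `A₀ - a²Ω²` must vanish.
    have key := H x y h0 (crossProduct R V) (by rw [dotProduct_comm, dot_self_cross])
      (by rw [dotProduct_comm, dot_cross_self])
    have e : (crossProduct R V) 0 * X 0 + (crossProduct R V) 1 * X 1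
        = -(l ^ 2 * m * a * c ^ 2) - m * a * c ^ 2 * (m ^ 2 * C ^ 2 + l ^ 2 * S ^ 2) := by
      simp only [cross_apply, hV, hR, hX, screwField, screwSurface, Matrix.cons_val, ← hC, ← hS]
      field_simp
      linear_combination (-m * l ^ 2 * C ^ 2 + m * l ^ 2 * S ^ 2
        - m * (m ^ 2 * C ^ 2 + l ^ 2 * S ^ 2)) * hcs - l ^ 2 * m * hch
    rw [e, h2', zero_mul, mul_zero, add_zero, mul_eq_zero, or_iff_left] at key
    swap
    · have h3 : 0 < l ^ 2 * m * a * c ^ 2 := by positivity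
      have h4 : 0 ≤ m * a * c ^ 2 * (m ^ 2 * C ^ 2 + l ^ 2 * S ^ 2) := by positivity
      linarith
    have h0' : A 0 = a ^ 2 * Ω ^ 2 := by linarith
    refine ⟨h0', h01 ▸ h0', h2', fun hΩ => ?_, ?_⟩
    · rw [h0']
      positivity
    -- With these values `𝐤²` is the constant `1 - a²c²l²Ω²`, and `h0` says that it is positive.
    · rw [h0', h2'] at h0
      linarith
  · rintro ⟨h0, h1, h2, -, h3⟩
    refine ⟨by rw [h0, h1], by simp [h2], ⟨0, 0, ?_⟩, fun x y _ ν _ _ => ?_⟩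
    · simp only [h0, h2]
      linarith
    · rw [h0, h2]
      ring

end Instances

theorem mainTheorem4 (n : ℕ) (hn : 1 ≤ n) (A : Fin (n + 4) → ℝ) :
    -- the only solutions are the four surfaces
    (∀ (U : Set (Fin 2 → ℝ)) (X : (Fin 2 → ℝ) → (Fin 3 → ℝ)) (χ : (Fin 2 → ℝ) → (Fin 2 → ℝ))
        (Ω : ℝ), IsOpen U → IsConnected U → IsMinimalSurface U X → IsStationarySurface A U X χ →
        SolvesExtrinsicEquation n (planeWaveMetric A) (typeII (n + 4) X) (velocityField Ω χ)
          (cylinder U) →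
      -- plane
      (∃ (ν : Fin 3 → ℝ) (d μ : ℝ), ν ⬝ᵥ ν = 1 ∧ (∀ σ ∈ U, ν ⬝ᵥ X σ = d) ∧
        profile3 A *ᵥ ν = μ • ν ∧ μ * d = 0) ∨
      (∃ Q ∈ Matrix.orthogonalGroup (Fin 3) ℝ, ∃ v : Fin 3 → ℝ, profile3 A *ᵥ v = 0 ∧
        ∃ a : ℝ, 0 < a ∧
        -- helicoid
        ((∃ lam κ : ℝ, 0 < lam ∧ IsPieceOf (helicoid a lam) a lam Q v U X χ ∧
            profile3 A = Q * Matrix.diagonal ![κ, κ, 0] * Qᵀ) ∨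
        -- catenoid
        (∃ c : ℝ, 0 < c ∧ IsPieceOf (catenoid a c) a 0 Q v U X χ ∧
            profile3 A = Q * Matrix.diagonal ![a ^ 2 * Ω ^ 2, a ^ 2 * Ω ^ 2, 0] * Qᵀ) ∨
        -- Scherk's second surface
        (∃ c l : ℝ, 0 < c ∧ 0 < l ∧ l < 1 ∧ IsPieceOf (scherk a c l) a (l * a * c) Q v U X χ ∧
            profile3 A = Q * Matrix.diagonal ![a ^ 2 * Ω ^ 2, a ^ 2 * Ω ^ 2, 0] * Qᵀ)))) ∧
    -- the plane is a minimal surface and a solution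
    (IsMinimalSurface Set.univ planeSurface ∧ ∀ a Ω : ℝ, 0 < a →
      (IsStationaryBlackfold n A planeSurface Ω (rotField a) ↔ A 0 = A 1) ∧
      SolvesBlackfoldEquations n (planeWaveMetric A) (typeII (n + 4) planeSurface)
        (velocityField 0 (rotField a)) (timelikeRegion A planeSurface 0 (rotField a))) ∧
    -- the helicoid is a minimal surface and a solution
    (∀ a lam Ω : ℝ, 0 < a → 0 < lam →
      IsMinimalSurface Set.univ (helicoid a lam) ∧
      (IsStationaryBlackfold n A (helicoid a lam) Ω coordField ↔
        A 0 = A 1 ∧ A 2 = 0 ∧ (Ω ^ 2 * lam ^ 2 < 1 ∨ a ^ 2 * Ω ^ 2 < A 0))) ∧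
    -- the catenoid is a minimal surface and a solution
    (∀ a c Ω : ℝ, 0 < a → 0 < c →
      IsMinimalSurface Set.univ (catenoid a c) ∧
      (IsStationaryBlackfold n A (catenoid a c) Ω coordField ↔
        A 0 = a ^ 2 * Ω ^ 2 ∧ A 1 = a ^ 2 * Ω ^ 2 ∧ A 2 = 0 ∧ (Ω ≠ 0 → 0 < A 0))) ∧
    -- Scherk's second surface is a minimal surface and a solution
    (∀ a c l Ω : ℝ, 0 < a → 0 < c → 0 < l → l < 1 →
      IsMinimalSurface Set.univ (scherk a c l) ∧
      (IsStationaryBlackfold n A (scherk a c l) Ω coordField ↔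
        A 0 = a ^ 2 * Ω ^ 2 ∧ A 1 = a ^ 2 * Ω ^ 2 ∧ A 2 = 0 ∧ (Ω ≠ 0 → 0 < A 0) ∧
        a ^ 2 * c ^ 2 * l ^ 2 * Ω ^ 2 < 1)) := by
  refine ⟨fun U X χ Ω hU hc hX hst hsol =>
      stationary_minimal_classification hn A hU hc hX hst hsol,
    ⟨isMinimalSurface_planeSurface, fun a Ω ha =>
      ⟨isStationaryBlackfold_planeSurface_iff hn ha Ω,
        solvesBlackfoldEquations_planeSurface hn a 0⟩⟩,
    fun a lam Ω ha hlam =>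
      ⟨isMinimalSurface_helicoid hlam, isStationaryBlackfold_helicoid_iff hn ha hlam⟩,
    fun a c Ω ha hc =>
      ⟨isMinimalSurface_catenoid ha hc, isStationaryBlackfold_catenoid_iff hn ha hc⟩,
    fun a c l Ω ha hc hl hl1 => ⟨isMinimalSurface_scherk ha hc hl hl1,
      isStationaryBlackfold_scherk_iff hn ha hc hl hl1⟩⟩
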